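/- Let $\mathbb S_n$ be the space of real symmetric $n\times n$ matrices with the trace inner product and the Frobenius norm, $K_n\subseteq\mathbb S_n$ the cone of positive semidefinite matrices, $L\subseteq\mathbb S_n$ a subspace and $c\in\mathbb S_n$. The problem $(K_n,L,c)$ is strongly feasible if $(L+c)\cap\operatorname{int}K_n\ne\emptyset$; weakly feasible if $(L+c)\cap\operatorname{int}K_n=\emptyset$ but $(L+c)\cap K_n\neq\emptyset$; weakly infeasible if $(L+c)\cap K_n=\emptyset$ and $\operatorname{dist}(K_n,L+c)=0$; strongly infeasible if $(L+c)\cap K_n=\emptyset$ and $\operatorname{dist}(K_n,L+c)>0$; and in weak status if it is weakly feasible or weakly infeasible. Write $\overline\pi_k(x)$ for the lower right $(n-k)\times(n-k)$ block of $x$. A weak-feasibility certificate of $(K_d,L',c')$ is a pair $(x,y)$ with $x\in(L'+c')\cap K_d$, $y\in L'^{\perp}\cap K_d$, $y\neq0$, $\langle y,c'\rangle=0$. The forward procedure FP starts with $\widetilde L=L$, $\widetilde c=c$, $P=I_n$, $i=1$ and repeats the following, where $d$ is the size of the current matrices. Find (i) $\widetilde A_i\in\widetilde L\cap K_d$ with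 trace $1$, or (ii) $\widetilde B\in\widetilde L^\perp\cap\operatorname{int}K_d$ with trace $1$; in case (ii) stop. In case (i) let $k_i=\operatorname{rank}\widetilde A_i$, choose a non-singular $\widetilde P$ with $\widetilde P^T\widetilde A_i\widetilde P=\widehat A_i\oplus0$ and $\widehat A_i$ a positive definite $k_i\times k_i$ matrix, put $M=I_{n-d}\oplus\widetilde P$, replace $P$ by $PM$, take any $A_i\in P^TLP$ with $\overline\pi_{k_1+\dots+k_{i-1}}(A_i)=\widetilde P^T\widetilde A_i\widetilde P$, replace $A_j$ by $M^TA_jM$ for $j<i$, replace $\widetilde L,\widetilde c$ by $\overline\pi_{k_i}(\widetilde P^T\widetilde L\widetilde P)$, $\overline\pi_{k_i}(\widetilde P^T\widetilde c\widetilde P)$, and increase $i$ by one. An FP datum for $(K_n,L,c)$ consists of $k_1,\dots,k_m\ge1$ with $N=k_1+\dots+k_m\le n$, a non-singular $P$, matrices $A_1,\dots,A_m\in P^TLP$ such that $\overline\pi_{k_1+\dots+k_{i-1}}(A_i)=\widehat A_i\oplus0$ with $\widehat A_i$ positive definite of size $k_i$, and $\widetilde B\in\overline\pi_N(P^TLP)^\perp\cap\operatorname{int}K_{n-N}$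 with trace $1$. Its last subproblem is $(K_{n-N},\overline\pi_N(P^TLP),\overline\pi_N(P^TcP))$. A certificate for $(K_n,L,c)$ is an FP datum together with a weak-feasibility certificate of its last subproblem. **Statement.** 1. For all $n$, $L$, $c$: every output $(k_i,A_i,P,\widetilde B)$ of FP is an FP datum. For every FP datum, $(K_n,L,c)$ is in weak status if and only if the last subproblem has a weak-feasibility certificate. If $(K_n,L,c)$ is in weak status, then FP has an output. Hence $(K_n,L,c)$ is in weak status if and only if it has a certificate. If it has no certificate, then either it is strongly feasible and $L+c$ contains a positive definite matrix, or it is strongly infeasible and there is $s\in K_n\cap L^\perp$ with $\langle s,c\rangle=-1$. 2. The number of coordinates of a certificate is bounded by a polynomial in $n$, and whether given data form a certificate for a given $(K_n,L,c)$ can be decided in polynomial time in the Blum–Shub–Smale model of real computation; here and below $L$ is given by the coefficients of a system of linear equations, and the size of an input is its number of real coordinates. 3. Deciding whether a given $(K_n,L,c)$ is in weak status is in $\mathrm{NP}\cap\mathrm{coNP}$ in the Blum–Shub–Smale model. -/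

import Mathlib

open Matrix

/-! ### Semidefinite feasibility problems -/

namespace SDFP

/-- The space `𝕊ₙ` of real symmetric `n × n` matrices. -/
def symSubmodule (n : ℕ) : Submodule ℝ (Matrix (Fin n) (Fin n) ℝ) where
  carrier := {x | x.IsSymm}
  add_mem' := fun hx hy => hx.add hy
  zero_mem' := Matrix.isSymm_zero
  smul_mem' := fun r _ hx => hx.smul r

abbrev Sym (n : ℕ) : Type := ↥(symSubmodule n)

/-- The cone `Kₙ` of positive semidefinite matrices, as a subset of `𝕊ₙ`. -/
def K (n : ℕ) : Set (Sym n) := {x | x.1.PosSemidef}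

/-- The trace inner product. -/
def ip {n : ℕ} (x y : Sym n) : ℝ := (x.1 * y.1).trace

/-- The orthogonal complement in `𝕊ₙ`. -/
def perp {n : ℕ} (L : Submodule ℝ (Sym n)) : Set (Sym n) := {y | ∀ x ∈ L, ip y x = 0}

/-- The affine space `L + c`. -/
def aff {n : ℕ} (L : Submodule ℝ (Sym n)) (c : Sym n) : Set (Sym n) := {x | ∃ l ∈ L, x = l + c}

/-- The distance `inf ‖x - y‖` of two sets, in the Frobenius norm. -/
noncomputable def setDist {n : ℕ} (C D : Set (Sym n)) : ℝ :=
  sInf {r | ∃ x ∈ C, ∃ y ∈ D, r = Real.sqrt (ip (x - y) (x - y))}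

def StronglyFeasible {n : ℕ} (L : Submodule ℝ (Sym n)) (c : Sym n) : Prop :=
  (aff L c ∩ interior (K n)).Nonempty

def WeaklyFeasible {n : ℕ} (L : Submodule ℝ (Sym n)) (c : Sym n) : Prop :=
  aff L c ∩ interior (K n) = ∅ ∧ (aff L c ∩ K n).Nonempty

def WeaklyInfeasible {n : ℕ} (L : Submodule ℝ (Sym n)) (c : Sym n) : Prop :=
  aff L c ∩ K n = ∅ ∧ setDist (K n) (aff L c) = 0

def StronglyInfeasible {n : ℕ} (L : Submodule ℝ (Sym n)) (c : Sym n) : Prop :=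
  aff L c ∩ K n = ∅ ∧ 0 < setDist (K n) (aff L c)

def WeakStatus {n : ℕ} (L : Submodule ℝ (Sym n)) (c : Sym n) : Prop :=
  WeaklyFeasible L c ∨ WeaklyInfeasible L c

/-- Certificate of strong feasibility: a positive definite point of `L + c`. -/
def StrongFeasCert {n : ℕ} (L : Submodule ℝ (Sym n)) (c x : Sym n) : Prop :=
  x ∈ aff L c ∧ x.1.PosDef

/-- Certificate of weak feasibility: a feasible point `x` and the normal `y` of a hyperplane
that contains `L + c` and supports the cone. -/
def WeakFeasCert {n : ℕ} (L : Submodule ℝ (Sym n)) (c x y : Sym n) : Prop :=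
  (x ∈ aff L c ∧ x ∈ K n) ∧ (y ∈ perp L ∧ y ∈ K n ∧ y ≠ 0 ∧ ip y c = 0)

/-- Certificate of strong infeasibility: a dual improving direction. -/
def StrongInfeasCert {n : ℕ} (L : Submodule ℝ (Sym n)) (c s : Sym n) : Prop :=
  s ∈ K n ∧ s ∈ perp L ∧ ip s c = -1

/-! ### Congruences and principal blocks -/

/-- The congruence `x ↦ Qᵀ x Q` on `𝕊ₙ`. -/
def cong {n : ℕ} (Q : Matrix (Fin n) (Fin n) ℝ) : Sym n →ₗ[ℝ] Sym n where
  toFun x := ⟨Qᵀ * x.1 * Q, by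
    have hx : (x.1)ᵀ = x.1 := x.2
    change (Qᵀ * x.1 * Q)ᵀ = Qᵀ * x.1 * Q
    simp only [Matrix.transpose_mul, Matrix.transpose_transpose, hx, Matrix.mul_assoc]⟩
  map_add' x y := by
    apply Subtype.ext
    change Qᵀ * (x.1 + y.1) * Q = Qᵀ * x.1 * Q + Qᵀ * y.1 * Q
    rw [Matrix.mul_add, Matrix.add_mul]
  map_smul' r x := by
    apply Subtype.ext
    change Qᵀ * (r • x.1) * Q = r • (Qᵀ * x.1 * Q)
    rw [Matrix.mul_smul, Matrix.smul_mul]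

/-- The position in an `n × n` matrix of the `i`-th row of its lower right `d × d` block. -/
def tailIdx {d n : ℕ} (h : d ≤ n) (i : Fin d) : Fin n := ⟨n - d + i, by omega⟩

/-- The lower right `d × d` principal submatrix; this is `π̄ₖ` for `k = n - d`. -/
def lowerRight {d n : ℕ} (h : d ≤ n) : Sym n →ₗ[ℝ] Sym d where
  toFun x := ⟨x.1.submatrix (tailIdx h) (tailIdx h), by
    have hx : (x.1)ᵀ = x.1 := x.2
    change (x.1.submatrix (tailIdx h) (tailIdx h))ᵀ = x.1.submatrix (tailIdx h) (tailIdx h)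
    rw [Matrix.transpose_submatrix, hx]⟩
  map_add' _ _ := rfl
  map_smul' _ _ := rfl

/-- The `d × d` matrix with upper left block `A` of size `k × k` and zeros elsewhere (`k ≤ d`). -/
def pad {k : ℕ} (d : ℕ) (A : Matrix (Fin k) (Fin k) ℝ) : Matrix (Fin d) (Fin d) ℝ :=
  fun i j => if h : (i : ℕ) < k ∧ (j : ℕ) < k then A ⟨i, h.1⟩ ⟨j, h.2⟩ else 0

/-- The `n × n` block diagonal matrix with blocks `I` and `Q`, where `Q` is `d × d`. -/
def blockM {d n : ℕ} (_h : d ≤ n) (Q : Matrix (Fin d) (Fin d) ℝ) : Matrix (Fin n) (Fin n) ℝ :=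
  fun i j =>
    if h : n - d ≤ (i : ℕ) ∧ n - d ≤ (j : ℕ) then
      Q ⟨i - (n - d), by omega⟩ ⟨j - (n - d), by omega⟩
    else if i = j then 1 else 0

/-! ### The forward procedure -/

/-- The variables of the forward procedure: `dirs` lists the pairs `(kᵢ, Aᵢ)` found so far,
`d` is the size of the current subproblem `(K_d, Lt, ct)`, and `P` is the current congruence. -/
structure FPState (n : ℕ) where
  dirs : List (ℕ × Sym n)
  d : ℕ
  size_eq : (dirs.map Prod.fst).sum + d = n
  P : Matrix (Fin n) (Fin n) ℝ
  Lt : Submodule ℝ (Sym d)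
  ct : Sym d

theorem FPState.d_le {n : ℕ} (s : FPState n) : s.d ≤ n := by
  have := s.size_eq
  omega

def FPState.init {n : ℕ} (L : Submodule ℝ (Sym n)) (c : Sym n) : FPState n where
  dirs := []
  d := n
  size_eq := by simp
  P := 1
  Lt := L
  ct := c

/-- One pass through the loop of the forward procedure applied to `(Kₙ, L, c)`, with alternative
(i): a direction `At` of the current subproblem is found and the subproblem is reduced. -/
def FPStep {n : ℕ} (L : Submodule ℝ (Sym n)) (s s' : FPState n) : Prop :=
  ∃ (At : Sym s.d) (Q : Matrix (Fin s.d) (Fin s.d) ℝ)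
    (Ah : Matrix (Fin At.1.rank) (Fin At.1.rank) ℝ) (A : Sym n) (h : s'.d ≤ s.d),
    (At ∈ s.Lt ∧ At ∈ K s.d ∧ At.1.trace = 1) ∧
    (IsUnit Q.det ∧ Ah.PosDef ∧ Qᵀ * At.1 * Q = pad s.d Ah) ∧
    s'.P = s.P * blockM s.d_le Q ∧
    (A ∈ L.map (cong s'.P) ∧ lowerRight s.d_le A = cong Q At) ∧
    s'.dirs = s.dirs.map (fun kA => (kA.1, cong (blockM s.d_le Q) kA.2)) ++ [(At.1.rank, A)] ∧
    s'.d + At.1.rank = s.d ∧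
    s'.Lt = (s.Lt.map (cong Q)).map (lowerRight h) ∧
    s'.ct = lowerRight h (cong Q s.ct)

/-- What the forward procedure returns: the pairs `(kᵢ, Aᵢ)`, the matrix `P` and the matrix
`B`, whose size `d = n - (k₁ + ⋯ + kₘ)` is that of the last subproblem. -/
structure FPOutput (n : ℕ) where
  dirs : List (ℕ × Sym n)
  d : ℕ
  size_eq : (dirs.map Prod.fst).sum + d = n
  P : Matrix (Fin n) (Fin n) ℝ
  B : Sym d

theorem FPOutput.d_le {n : ℕ} (O : FPOutput n) : O.d ≤ n := by
  have := O.size_eq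
  omega

/-- `O` is a possible output of a run of the forward procedure on `(Kₙ, L, c)` that stops with
alternative (ii). -/
inductive IsFPOutput {n : ℕ} (L : Submodule ℝ (Sym n)) (c : Sym n) : FPOutput n → Prop
  | final (s : FPState n) (B : Sym s.d)
      (reach : Relation.ReflTransGen (FPStep L) (FPState.init L c) s)
      (hB : B ∈ perp s.Lt ∧ B ∈ interior (K s.d) ∧ B.1.trace = 1) :
      IsFPOutput L c ⟨s.dirs, s.d, s.size_eq, s.P, B⟩

/-- The linear part `π̄(PᵀLP)` of the last subproblem. -/
def FPOutput.lastL {n : ℕ} (O : FPOutput n) (L : Submodule ℝ (Sym n)) : Submodule ℝ (Sym O.d) :=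
  (L.map (cong O.P)).map (lowerRight O.d_le)

/-- The displacement `π̄(PᵀcP)` of the last subproblem. -/
def FPOutput.lastC {n : ℕ} (O : FPOutput n) (c : Sym n) : Sym O.d :=
  lowerRight O.d_le (cong O.P c)

/-- The specification of the output: `P` is non-singular, every `Aᵢ` lies in `PᵀLP`, its lower
right block from position `k₁ + ⋯ + kᵢ₋₁` on is `Âᵢ ⊕ 0` with `Âᵢ` positive definite of size
`kᵢ > 0`, and `B`, of trace one, attests that the last subproblem has no nonzero hyper feasible
direction. -/
def FPOutput.MeetsSpec {n : ℕ} (O : FPOutput n) (L : Submodule ℝ (Sym n)) : Prop :=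
  IsUnit O.P.det ∧
  (∀ i : Fin O.dirs.length,
    0 < (O.dirs.get i).1 ∧
    (O.dirs.get i).2 ∈ L.map (cong O.P) ∧
    ∃ Ah : Matrix (Fin (O.dirs.get i).1) (Fin (O.dirs.get i).1) ℝ, Ah.PosDef ∧
      (lowerRight (Nat.sub_le n (((O.dirs.take i).map Prod.fst).sum)) (O.dirs.get i).2).1 =
        pad (n - ((O.dirs.take i).map Prod.fst).sum) Ah) ∧
  (O.B ∈ perp (O.lastL L) ∧ O.B ∈ interior (K O.d) ∧ O.B.1.trace = 1)

/-- The data of a certificate of weak status: an output of the forward procedure and the data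
`(x, y)` of a certificate of weak feasibility of the last subproblem. -/
structure WeakCert (n : ℕ) where
  out : FPOutput n
  x : Sym out.d
  y : Sym out.d

def WeakCert.IsValid {n : ℕ} (D : WeakCert n) (L : Submodule ℝ (Sym n)) (c : Sym n) : Prop :=
  D.out.MeetsSpec L ∧ WeakFeasCert (D.out.lastL L) (D.out.lastC c) D.x D.y

end SDFP

/-! ### The Blum–Shub–Smale model over the reals -/

namespace BSS

/-- Instructions of a machine with real registers `x₀, x₁, …` and two index registers `r`, `w`. -/
inductive Instr where
  /-- `x_j := p(x) / q(x)` -/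
  | comp (j : ℕ) (p q : MvPolynomial ℕ ℝ)
  /-- if `p(x) ≥ 0` then go to instruction `l`, else to the next one -/
  | branch (p : MvPolynomial ℕ ℝ) (l : ℕ)
  /-- `r := 0` -/
  | resetR
  /-- `r := r + 1` -/
  | incR
  /-- `w := 0` -/
  | resetW
  /-- `w := w + 1` -/
  | incW
  /-- `x_w := x_r` -/
  | copy

/-- A machine is a finite list of instructions. -/
abbrev Machine : Type := List Instr

structure Config where
  pc : ℕ
  r : ℕ
  w : ℕ
  x : ℕ → ℝ

open Classical in
/-- The effect of one instruction; a division by zero has no successor configuration. -/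
noncomputable def Instr.exec (c : Config) : Instr → Option Config
  | .comp j p q =>
      if MvPolynomial.eval c.x q = 0 then none
      else some { c with
        pc := c.pc + 1
        x := Function.update c.x j (MvPolynomial.eval c.x p / MvPolynomial.eval c.x q) }
  | .branch p l => some { c with pc := if 0 ≤ MvPolynomial.eval c.x p then l else c.pc + 1 }
  | .resetR => some { c with pc := c.pc + 1, r := 0 }
  | .incR => some { c with pc := c.pc + 1, r := c.r + 1 }
  | .resetW => some { c with pc := c.pc + 1, w := 0 }
  | .incW => some { c with pc := c.pc + 1, w := c.w + 1 }
  | .copy => some { c with pc := c.pc + 1, x := Function.update c.x c.w (c.x c.r) }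

/-- One step of computation; there is none once the program counter has left the program. -/
noncomputable def step (M : Machine) (c : Config) : Option Config :=
  (M[c.pc]?).bind (Instr.exec c)

/-- The initial configuration: the length of the input stands in `x₀`, its entries stand in the
registers of odd index, and all other registers are zero and free for work. -/
noncomputable def init (input : List ℝ) : Config where
  pc := 0
  r := 0
  w := 0
  x := fun j =>
    if j = 0 then (input.length : ℝ)
    else if j % 2 = 1 then input.getD (j / 2) 0
    else 0

/-- `M`, started on `input`, halts after at most `T` steps with `x₀ = a`. -/
def HaltsWith (M : Machine) (input : List ℝ) (T : ℕ) (a : ℝ) : Prop :=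
  ∃ t ≤ T, ∃ c : Config, (fun o : Option Config => o.bind (step M))^[t] (some (init input)) = some c ∧
    M.length ≤ c.pc ∧ c.x 0 = a

/-- The decision problem with set of instances `X` and set of yes-instances `Yes` is in `P`. The
size of an instance is its length. -/
def InP (X Yes : Set (List ℝ)) : Prop :=
  ∃ (M : Machine) (p : Polynomial ℕ), ∀ x ∈ X,
    (x ∈ Yes → HaltsWith M x (p.eval x.length) 1) ∧
    (x ∉ Yes → HaltsWith M x (p.eval x.length) 0)

/-- The code of a pair of vectors. -/
def pair (x w : List ℝ) : List ℝ := (x.length : ℝ) :: (x ++ w)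

/-- `NP`: membership is attested by real vectors of polynomial length that are verified in
polynomial time. -/
def InNP (X Yes : Set (List ℝ)) : Prop :=
  ∃ (V : Set (List ℝ)) (q : Polynomial ℕ),
    InP {z | ∃ x ∈ X, ∃ w : List ℝ, w.length ≤ q.eval x.length ∧ z = pair x w} V ∧
    ∀ x ∈ X, (x ∈ Yes ↔ ∃ w : List ℝ, w.length ≤ q.eval x.length ∧ pair x w ∈ V)

/-- `coNP`: the complementary problem is in `NP`. -/
def InCoNP (X Yes : Set (List ℝ)) : Prop := InNP X (X \ Yes)

end BSS

/-! ### Encodings -/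

namespace SDFP

/-- An instance `(Kₙ, L, c)`, with `L` given as the solution set of `r` linear equations. -/
structure Instance where
  n : ℕ
  r : ℕ
  a : Fin r → Matrix (Fin n) (Fin n) ℝ
  c : Sym n

/-- The subspace `L = {x ∈ 𝕊ₙ | ∑ a_{ij} x_{ij} = 0 for each of the given equations}`. -/
def Instance.L (I : Instance) : Submodule ℝ (Sym I.n) where
  carrier := {x | ∀ e, ∑ i, ∑ j, I.a e i j * x.1 i j = 0}
  add_mem' := by
    intro x y hx hy e
    have h1 := hx e
    have h2 := hy e
    simp only [Submodule.coe_add, Matrix.add_apply, mul_add, Finset.sum_add_distrib, h1, h2,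
      add_zero]
  zero_mem' := by
    intro e
    simp
  smul_mem' := by
    intro r x hx e
    have h1 := hx e
    have h2 : ∑ i, ∑ j, I.a e i j * (r • x).1 i j = r * ∑ i, ∑ j, I.a e i j * x.1 i j := by
      simp only [Finset.mul_sum]
      refine Finset.sum_congr rfl fun i _ => Finset.sum_congr rfl fun j _ => ?_
      simp only [Submodule.coe_smul, Matrix.smul_apply, smul_eq_mul]
      ring
    rw [h2, h1, mul_zero]

/-- The entries of a matrix, row by row. -/
def entries {d : ℕ} (M : Matrix (Fin d) (Fin d) ℝ) : List ℝ :=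
  (List.ofFn fun i => List.ofFn fun j => M i j).flatten

/-- The code of an instance: `n`, `r`, the coefficients of the equations, the entries of `c`. -/
def Instance.encode (I : Instance) : List ℝ :=
  [(I.n : ℝ), (I.r : ℝ)] ++ (List.ofFn fun e => entries (I.a e)).flatten ++ entries I.c.1

/-- The code of a certificate: `m`, `d`, `k₁, …, kₘ`, then the entries of `A₁, …, Aₘ`, `P`, `B`,
`x`, `y`. -/
def WeakCert.encode {n : ℕ} (D : WeakCert n) : List ℝ :=
  [(D.out.dirs.length : ℝ), (D.out.d : ℝ)] ++ D.out.dirs.map (fun kA => (kA.1 : ℝ)) ++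
    (D.out.dirs.map (fun kA => entries kA.2.1)).flatten ++ entries D.out.P ++
    entries D.out.B.1 ++ entries D.x.1 ++ entries D.y.1

/-- The codes of all instances. -/
def instances : Set (List ℝ) := Set.range Instance.encode

/-- The codes of the instances in weak status. -/
def weakInstances : Set (List ℝ) := Instance.encode '' {I | WeakStatus I.L I.c}

/-- The codes of all pairs of an instance and the data of a certificate of the same size. -/
def certPairs : Set (List ℝ) :=
  {z | ∃ (I : Instance) (D : WeakCert I.n), z = BSS.pair I.encode D.encode}

/-- The codes of those pairs in which the certificate is valid for the instance. -/
def validCertPairs : Set (List ℝ) :=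
  {z | ∃ (I : Instance) (D : WeakCert I.n), D.IsValid I.L I.c ∧
    z = BSS.pair I.encode D.encode}

end SDFP

/-! ### Structured programs for the Blum–Shub–Smale model -/

namespace BSS

/-! Weak status is first expressed by strong feasibility alone. If a positive semidefinite matrix
lies at distance less than `ε` from a point `y` of `L + c`, then `y + ε I` is positive definite;
hence the distance is zero exactly when `(L, c + ε I)` is strongly feasible for every `ε > 0`
(`setDist_eq_zero_iff`). Weak status is this almost feasibility together with the failure of strong
feasibility (`weakStatus_iff`).

Strong feasibility survives a step of the forward procedure in both directions. Non-singular
congruences preserve positive definiteness, and if `L` contains `A = Â ⊕ 0` with `Â` positive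
definite, then `x + t A` is positive definite for large `t` as soon as the complementary block of
`x` is (`exists_posDef_add_smul`). Almost feasibility survives too: any positive definite
perturbation serves as well as the identity (`almostFeasible_iff_of_posDef`), and the lower right
block of the identity is the identity. In the last subproblem the positive definite `B` orthogonal
to the linear part bounds the trace of feasible points, so compactness turns almost feasibility into
feasibility (`AlmostFeasible.feasible`), and the failure of strong feasibility gives a supporting
hyperplane by separation (`exists_separating`). Together this is `weakStatus_iff_of_meetsSpec`.

Separation applied to `L^⊥` shows that one of the two alternatives of the procedure is available at
every positive size (`exists_psd_or_perp_posDef`). Each direction lowers the size, and size zero is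
reached only by strongly feasible problems, so in weak status there is an output. Outside weak
status there is either a positive definite point of `L + c` or, by separating `L + c + ε I` from the
cone, a dual improving direction (`not_weakStatus_iff`).

The complexity statements rest on a small language of expressions with bounded sums, case
distinctions, divisions and iterated matrix updates. Its expressions are compiled into machines with
a polynomial time bound (`Ex.evaluates`), so a problem decided by the sign of one expression is in
`P` (`InP.of_ex`). Everything to be verified reduces to symmetric Gaussian elimination. Definiteness
and semidefiniteness are read off the pivots (`qfPos_iff_elim`, `qfNonneg_iff_elim`). A linear
system is solvable exactly when the last pivot of the Gram matrix of its columns, with the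
right-hand side put last, vanishes (`elim_gram_eq_zero_iff`); this covers membership in `L^⊥` and in
images of `L`. A certificate of weak status, or a single matrix that is a certificate of strong
feasibility or strong infeasibility, is then tested by one expression, which gives `NP` and `coNP`.
-/

/-- The part of a configuration other than the program counter. -/
structure St where
  r : ℕ
  w : ℕ
  x : ℕ → ℝ

/-- The configuration with the given program counter. -/
def St.cfg (s : St) (pc : ℕ) : Config := ⟨pc, s.r, s.w, s.x⟩

/-- Structured programs. -/
inductive Cmd where
  | prim (i : Instr)
  | seq (a b : Cmd)
  /-- if `p(x) ≥ 0` then `a` else `b` -/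
  | ite (p : MvPolynomial ℕ ℝ) (a b : Cmd)
  /-- while `p(x) < 0` do `a` -/
  | loop (p : MvPolynomial ℕ ℝ) (a : Cmd)

/-- The number of instructions of the translation of a structured program. -/
def Cmd.size : Cmd → ℕ
  | .prim _ => 1
  | .seq a b => a.size + b.size
  | .ite _ a b => b.size + a.size + 2
  | .loop _ a => a.size + 2

/-- The translation of a structured program, to be placed at position `o`. -/
noncomputable def Cmd.code : Cmd → ℕ → List Instr
  | .prim i, _ => [i]
  | .seq a b, o => a.code o ++ b.code (o + a.size)
  -- The code of `b` stands first. The zero polynomial is nonnegative everywhere, so `branch 0` is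
  -- an unconditional jump, here over the code of `a`.
  | .ite p a b, o =>
      ([Instr.branch p (o + 1 + b.size + 1)] ++ b.code (o + 1)) ++
        ([Instr.branch 0 (o + (b.size + a.size + 2))] ++ a.code (o + 1 + b.size + 1))
  | .loop p a, o =>
      ([Instr.branch p (o + (a.size + 2))] ++ a.code (o + 1)) ++ [Instr.branch 0 o]

theorem Cmd.length_code (c : Cmd) (o : ℕ) : (c.code o).length = c.size := by
  induction c generalizing o with
  | prim i => rfl
  | seq a b iha ihb => simp [Cmd.code, Cmd.size, iha, ihb]
  | ite p a b iha ihb => simp [Cmd.code, Cmd.size, iha, ihb]; omega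
  | loop p a iha => simp [Cmd.code, Cmd.size, iha]

/-- The list `l` stands in the program `M` from position `o` on. -/
def Placed (M : Machine) (o : ℕ) (l : List Instr) : Prop :=
  ∀ i, i < l.length → M[o + i]? = l[i]?

theorem Placed.left {M : Machine} {o : ℕ} {l l' : List Instr} (h : Placed M o (l ++ l')) :
    Placed M o l := by
  intro i hi
  rw [h i (by simp; omega), List.getElem?_append_left hi]

theorem Placed.right {M : Machine} {o : ℕ} {l l' : List Instr} (h : Placed M o (l ++ l')) :
    Placed M (o + l.length) l' := by
  intro i hi
  rw [add_assoc, h (l.length + i) (by simp; omega), List.getElem?_append_right (by omega)]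
  simp

theorem Placed.head {M : Machine} {o : ℕ} {i : Instr} (h : Placed M o [i]) :
    M[o]? = some i := by
  simpa using h 0 (by simp)

/-- `M` passes from `c` to `c'` in `t` steps. -/
def Steps (M : Machine) (c : Config) (t : ℕ) (c' : Config) : Prop :=
  (fun o : Option Config => o.bind (step M))^[t] (some c) = some c'

theorem Steps.trans {M : Machine} {c c' c'' : Config} {t t' : ℕ} (h : Steps M c t c')
    (h' : Steps M c' t' c'') : Steps M c (t + t') c'' := by
  unfold Steps at *
  rw [add_comm, Function.iterate_add_apply, h, h']

theorem Steps.single {M : Machine} {c c' : Config} {i : Instr} (hi : M[c.pc]? = some i)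
    (h : Instr.exec c i = some c') : Steps M c 1 c' := by
  simp [Steps, step, hi, h]

/-- The translation of `c`, placed anywhere, leads from the state `s` to `s'` in `t` steps. -/
def Runs (c : Cmd) (s : St) (t : ℕ) (s' : St) : Prop :=
  ∀ (M : Machine) (o : ℕ), Placed M o (c.code o) → Steps M (s.cfg o) t (s'.cfg (o + c.size))

theorem Runs.prim {i : Instr} {s s' : St}
    (h : ∀ o, Instr.exec (s.cfg o) i = some (s'.cfg (o + 1))) : Runs (.prim i) s 1 s' :=
  fun _ o hM => Steps.single (Placed.head hM) (h o)

theorem Runs.seq {a b : Cmd} {s s' s'' : St} {t t' : ℕ} (h : Runs a s t s')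
    (h' : Runs b s' t' s'') : Runs (.seq a b) s (t + t') s'' := by
  intro M o hM
  have h1 := h M o hM.left
  have h2 := hM.right
  rw [Cmd.length_code] at h2
  have h3 := h' M _ h2
  rw [Cmd.size, ← add_assoc]
  exact h1.trans h3

theorem Steps.branch_pos {M : Machine} {s : St} {o l : ℕ} {p : MvPolynomial ℕ ℝ}
    (hi : M[o]? = some (.branch p l)) (h : 0 ≤ MvPolynomial.eval s.x p) :
    Steps M (s.cfg o) 1 (s.cfg l) :=
  Steps.single (i := .branch p l) hi (by simp [Instr.exec, St.cfg, h])

theorem Steps.branch_neg {M : Machine} {s : St} {o l : ℕ} {p : MvPolynomial ℕ ℝ}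
    (hi : M[o]? = some (.branch p l)) (h : MvPolynomial.eval s.x p < 0) :
    Steps M (s.cfg o) 1 (s.cfg (o + 1)) :=
  Steps.single (i := .branch p l) hi (by simp [Instr.exec, St.cfg, not_le.mpr h])

theorem Runs.ite_pos {p : MvPolynomial ℕ ℝ} {a b : Cmd} {s s' : St} {t : ℕ}
    (hp : 0 ≤ MvPolynomial.eval s.x p) (h : Runs a s t s') : Runs (.ite p a b) s (1 + t) s' := by
  intro M o hM
  have h1 := hM.right.right
  simp only [List.length_append, List.length_singleton, Cmd.length_code] at h1
  have h2 := h M (o + 1 + b.size + 1) (by rwa [← add_assoc] at h1)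
  have h3 : o + (Cmd.ite p a b).size = o + 1 + b.size + 1 + a.size := by
    simp only [Cmd.size]; omega
  rw [h3]
  exact (Steps.branch_pos hM.left.left.head hp).trans h2

theorem Runs.ite_neg {p : MvPolynomial ℕ ℝ} {a b : Cmd} {s s' : St} {t : ℕ}
    (hp : MvPolynomial.eval s.x p < 0) (h : Runs b s t s') :
    Runs (.ite p a b) s (1 + t + 1) s' := by
  intro M o hM
  have h1 := h M (o + 1) (by simpa using hM.left.right)
  have h4 := hM.right.left.head
  simp only [List.length_append, List.length_singleton, Cmd.length_code, ← add_assoc] at h4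
  refine ((Steps.branch_neg hM.left.left.head hp).trans h1).trans ?_
  have h5 := Steps.branch_pos (s := s') h4 (by simp)
  simp only [Cmd.size, ← add_assoc]
  exact h5

theorem Runs.loop_stop {p : MvPolynomial ℕ ℝ} {a : Cmd} {s : St}
    (hp : 0 ≤ MvPolynomial.eval s.x p) : Runs (.loop p a) s 1 s :=
  fun _ _ hM => Steps.branch_pos hM.left.left.head hp

theorem Runs.loop_step {p : MvPolynomial ℕ ℝ} {a : Cmd} {s s' s'' : St} {t t' : ℕ}
    (hp : MvPolynomial.eval s.x p < 0) (h : Runs a s t s') (h' : Runs (.loop p a) s' t' s'') :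
    Runs (.loop p a) s (1 + t + 1 + t') s'' := by
  intro M o hM
  have h1 := h M (o + 1) (by simpa using hM.left.right)
  have h4 := hM.right.head
  simp only [List.length_append, List.length_singleton, Cmd.length_code, ← add_assoc] at h4
  refine (((Steps.branch_neg hM.left.left.head hp).trans h1).trans ?_).trans (h' M o hM)
  exact Steps.branch_pos (s := s') h4 (by simp)

/-- Started in `s`, the program `c` stops after at most `T` steps in a state that satisfies `Q`. -/
def Exec (c : Cmd) (s : St) (T : ℕ) (Q : St → Prop) : Prop :=
  ∃ t ≤ T, ∃ s', Runs c s t s' ∧ Q s'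

theorem Exec.mono {c : Cmd} {s : St} {T T' : ℕ} {Q Q' : St → Prop} (h : Exec c s T Q)
    (hT : T ≤ T') (hQ : ∀ s', Q s' → Q' s') : Exec c s T' Q' := by
  obtain ⟨t, ht, s', h1, h2⟩ := h
  exact ⟨t, ht.trans hT, s', h1, hQ _ h2⟩

/-- The postcondition of the first command is an execution statement about the second. Proofs can
thus walk through a program command by command, carrying the current state and never naming
intermediate times. -/
theorem Exec.seq {a b : Cmd} {s : St} {T T' : ℕ} {Q : St → Prop}
    (h : Exec a s T fun s' => Exec b s' T' Q) : Exec (.seq a b) s (T + T') Q := by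
  obtain ⟨t, ht, s', h1, t', ht', s'', h2, h3⟩ := h
  exact ⟨t + t', by omega, s'', h1.seq h2, h3⟩

theorem Exec.ite {p : MvPolynomial ℕ ℝ} {a b : Cmd} {s : St} {T : ℕ} {Q : St → Prop}
    (ha : 0 ≤ MvPolynomial.eval s.x p → Exec a s T Q)
    (hb : MvPolynomial.eval s.x p < 0 → Exec b s T Q) : Exec (.ite p a b) s (T + 2) Q := by
  by_cases hp : 0 ≤ MvPolynomial.eval s.x p
  · obtain ⟨t, ht, s', h1, h2⟩ := ha hp
    exact ⟨1 + t, by omega, s', h1.ite_pos hp, h2⟩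
  · obtain ⟨t, ht, s', h1, h2⟩ := hb (not_le.mp hp)
    exact ⟨1 + t + 1, by omega, s', h1.ite_neg (not_le.mp hp), h2⟩

/-- The assignment `x_j := p(x)`. -/
noncomputable def Cmd.set (j : ℕ) (p : MvPolynomial ℕ ℝ) : Cmd := .prim (.comp j p 1)

theorem Exec.set {j : ℕ} {p : MvPolynomial ℕ ℝ} {s : St} {Q : St → Prop}
    (h : Q { s with x := Function.update s.x j (MvPolynomial.eval s.x p) }) :
    Exec (.set j p) s 1 Q :=
  ⟨1, le_rfl, _, Runs.prim (fun o => by simp [Instr.exec, St.cfg]), h⟩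

theorem Exec.comp {j : ℕ} {p q : MvPolynomial ℕ ℝ} {s : St} {Q : St → Prop}
    (hq : MvPolynomial.eval s.x q ≠ 0)
    (h : Q ⟨s.r, s.w, Function.update s.x j
      (MvPolynomial.eval s.x p / MvPolynomial.eval s.x q)⟩) :
    Exec (.prim (.comp j p q)) s 1 Q :=
  ⟨1, le_rfl, _, Runs.prim (fun o => by simp [Instr.exec, St.cfg, hq]), h⟩

/-- Counting loop: for `x_j = 0, 1, …` as long as `x_j < x_b` do `a`. -/
noncomputable def Cmd.count (j b : ℕ) (a : Cmd) : Cmd :=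
  .seq (.set j 0) (.loop (MvPolynomial.X j - MvPolynomial.X b)
    (.seq a (.set j (MvPolynomial.X j + 1))))

/-- Induction on the number of rounds that remain. A round costs `T` for the body and three more
steps: the test, the increment and the jump back. The final `2` pays for the initialisation and the
last test. The body may use the counter but must leave its value unchanged. -/
theorem Exec.count {j b n T : ℕ} {a : Cmd} {s : St} {Q : St → Prop} (Inv : ℕ → St → Prop)
    (hInv : ∀ k s, Inv k s → s.x j = k ∧ s.x b = n)
    (h0 : Inv 0 { s with x := Function.update s.x j 0 })
    (hstep : ∀ k s, k < n → Inv k s →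
      Exec a s T fun s' => s'.x j = k ∧ Inv (k + 1) { s' with x := Function.update s'.x j (k + 1) })
    (hQ : ∀ s, Inv n s → Q s) : Exec (.count j b a) s (n * (T + 3) + 2) Q := by
  have key : ∀ (e k : ℕ) (s : St), k + e = n → Inv k s →
      Exec (.loop (MvPolynomial.X j - MvPolynomial.X b)
        (.seq a (.set j (MvPolynomial.X j + 1)))) s (e * (T + 3) + 1) Q := by
    intro e
    induction e with
    | zero =>
      intro k s hk hi
      obtain ⟨h1, h2⟩ := hInv k s hi
      have : k = n := by omega
      subst this
      exact ⟨1, by omega, s, Runs.loop_stop (by simp [h1, h2]), hQ _ hi⟩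
    | succ e ih =>
      intro k s hk hi
      obtain ⟨h1, h2⟩ := hInv k s hi
      obtain ⟨t, ht, s', h3, h4, h5⟩ := hstep k s (by omega) hi
      obtain ⟨t', ht', s'', h6, h7⟩ := ih (k + 1) _ (by omega) h5
      have h8 : Exec (.set j (MvPolynomial.X j + 1)) s' 1
          fun u => u = { s' with x := Function.update s'.x j (k + 1) } :=
        Exec.set (by simp [h4])
      obtain ⟨t1, ht1, u, h9, rfl⟩ := h8
      have hlt : (k : ℝ) < n := by exact_mod_cast (by omega : k < n)
      exact ⟨_, by rw [Nat.succ_mul]; omega, s'',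
        Runs.loop_step (by simp [h1, h2, hlt]) (h3.seq h9) h6, h7⟩
  refine Exec.mono (T := 1 + (n * (T + 3) + 1)) (Exec.seq (Exec.set ?_)) (by omega)
    (fun _ h => h)
  simpa using key n 0 _ (by omega) h0

/-- `k` repetitions of an instruction followed by `c`. -/
def Cmd.rep (i : Instr) : ℕ → Cmd → Cmd
  | 0, c => c
  | k + 1, c => .seq (.prim i) (Cmd.rep i k c)

theorem Exec.rep_incR {k : ℕ} {c : Cmd} {s : St} {T : ℕ} {Q : St → Prop}
    (h : Exec c { s with r := s.r + k } T Q) : Exec (.rep .incR k c) s (k + T) Q := by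
  induction k generalizing s with
  | zero => simpa [Cmd.rep] using h
  | succ k ih =>
    refine Exec.mono (T := 1 + (k + T)) (Exec.seq ⟨1, le_rfl, { s with r := s.r + 1 },
      Runs.prim (fun o => rfl), ih ?_⟩) (by omega) (fun _ h => h)
    rwa [show s.r + 1 + k = s.r + (k + 1) by omega]

theorem Exec.rep_incW {k : ℕ} {c : Cmd} {s : St} {T : ℕ} {Q : St → Prop}
    (h : Exec c { s with w := s.w + k } T Q) : Exec (.rep .incW k c) s (k + T) Q := by
  induction k generalizing s with
  | zero => simpa [Cmd.rep] using h
  | succ k ih =>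
    refine Exec.mono (T := 1 + (k + T)) (Exec.seq ⟨1, le_rfl, { s with w := s.w + 1 },
      Runs.prim (fun o => rfl), ih ?_⟩) (by omega) (fun _ h => h)
    rwa [show s.w + 1 + k = s.w + (k + 1) by omega]

theorem Exec.resetR {s : St} {Q : St → Prop} (h : Q { s with r := 0 }) :
    Exec (.prim .resetR) s 1 Q := ⟨1, le_rfl, _, Runs.prim (fun _ => rfl), h⟩

theorem Exec.resetW {s : St} {Q : St → Prop} (h : Q { s with w := 0 }) :
    Exec (.prim .resetW) s 1 Q := ⟨1, le_rfl, _, Runs.prim (fun _ => rfl), h⟩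

theorem Exec.copy {s : St} {Q : St → Prop}
    (h : Q { s with x := Function.update s.x s.w (s.x s.r) }) :
    Exec (.prim .copy) s 1 Q := ⟨1, le_rfl, _, Runs.prim (fun _ => rfl), h⟩

/-- A program without effect on the registers, repeated in the body of loops that move an index
register: the instruction `x_j := x_j`. -/
noncomputable def Cmd.skip (j : ℕ) : Cmd := .set j (MvPolynomial.X j)

theorem Exec.skip {j : ℕ} {s : St} {Q : St → Prop} (h : Q s) : Exec (.skip j) s 1 Q :=
  Exec.set (by simpa using h)

/-- `x_d := x_{b + g k}` for `k = x_a`, with the scratch register `x_j`. -/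
noncomputable def Cmd.fetch (d b g a j : ℕ) : Cmd :=
  .seq (.prim .resetR) (.rep .incR b (.seq (.count j a (.rep .incR g (.skip j)))
    (.seq (.prim .resetW) (.rep .incW d (.prim .copy)))))

/-- The index registers can only be reset and incremented, so the address `b + g k` is reached by
counting: `b` increments, then `k` rounds of `g` increments. The cost is linear in `k`. The
condition `hj` keeps the loop counter from overwriting the value that is to be read. -/
theorem Exec.fetch {d b g a j k : ℕ} {s : St} {Q : St → Prop} (hk : s.x a = k)
    (hja : a ≠ j) (hj : b + g * k ≠ j)
    (h : ∀ r w, Q ⟨r, w, Function.update (Function.update s.x j k) d (s.x (b + g * k))⟩) :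
    Exec (.fetch d b g a j) s (1 + (b + ((k * (g + 1 + 3) + 2) + (1 + (d + 1))))) Q := by
  refine Exec.seq (Exec.resetR (Exec.rep_incR (Exec.seq ?_)))
  refine Exec.count
    (fun i u => u.r = b + g * i ∧ u.w = s.w ∧ u.x = Function.update s.x j i) ?_ ?_ ?_ ?_
  · rintro i u ⟨-, -, h3⟩
    simp [h3, hja, hk]
  · simp
  · rintro i u hi ⟨h1, h2, h3⟩
    refine Exec.rep_incR (Exec.skip ⟨by simp [h3], ?_, h2, ?_⟩)
    · simp [h1]; ring
    · simp [h3]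
  · rintro u ⟨h1, h2, h3⟩
    refine Exec.seq (Exec.resetW (Exec.rep_incW (Exec.copy ?_)))
    simp only [h3, h1, zero_add, Function.update_of_ne hj]
    exact h _ _

/-- `x_{b + g k} := x_e` for `k = x_a`, with the scratch register `x_j`. -/
noncomputable def Cmd.store (e b g a j : ℕ) : Cmd :=
  .seq (.prim .resetW) (.rep .incW b (.seq (.count j a (.rep .incW g (.skip j)))
    (.seq (.prim .resetR) (.rep .incR e (.prim .copy)))))

theorem Exec.store {e b g a j k : ℕ} {s : St} {Q : St → Prop} (hk : s.x a = k)
    (hja : a ≠ j) (hj : e ≠ j)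
    (h : ∀ r w, Q ⟨r, w, Function.update (Function.update s.x j k) (b + g * k) (s.x e)⟩) :
    Exec (.store e b g a j) s (1 + (b + ((k * (g + 1 + 3) + 2) + (1 + (e + 1))))) Q := by
  refine Exec.seq (Exec.resetW (Exec.rep_incW (Exec.seq ?_)))
  refine Exec.count
    (fun i u => u.w = b + g * i ∧ u.r = s.r ∧ u.x = Function.update s.x j i) ?_ ?_ ?_ ?_
  · rintro i u ⟨-, -, h3⟩
    simp [h3, hja, hk]
  · simp
  · rintro i u hi ⟨h1, h2, h3⟩
    refine Exec.rep_incW (Exec.skip ⟨by simp [h3], ?_, h2, ?_⟩)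
    · simp [h1]; ring
    · simp [h3]
  · rintro u ⟨h1, h2, h3⟩
    refine Exec.seq (Exec.resetR (Exec.rep_incR (Exec.copy ?_)))
    simp only [h3, h1, zero_add, Function.update_of_ne hj]
    exact h _ _

/-- A structured program that computes the right value in `x₀` within `T` steps gives a machine
with the same property. -/
theorem Exec.haltsWith {c : Cmd} {input : List ℝ} {T : ℕ} {a : ℝ}
    (h : Exec c ⟨0, 0, (init input).x⟩ T fun s => s.x 0 = a) :
    HaltsWith (c.code 0) input T a := by
  obtain ⟨t, ht, s', h1, h2⟩ := h
  refine ⟨t, ht, s'.cfg (0 + c.size), h1 (c.code 0) 0 ?_, ?_, h2⟩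
  · intro i hi
    simp
  · simp [Cmd.length_code, St.cfg]

end BSS

/-! ### Arithmetic expressions with bounded sums and matrix iterations -/

namespace BSS

/-- Whether an expression may refer to the current matrix of an iteration (`inner`), may contain
iterations (`outer`), or neither (`plain`). -/
inductive Mode where
  | plain
  | inner
  | outer

/-- Expressions in index variables `v₀, v₁, …`, which range over the numbers below the length of
the input, and in the entries of the input; `get a` is the entry in position `a`. -/
inductive Ex : Mode → Type where
  | const {m : Mode} (c : ℝ) : Ex m
  | idx {m : Mode} (v : ℕ) : Ex m
  | get {m : Mode} (a : Ex m) : Ex m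
  | mat (u v : ℕ) : Ex .inner
  | add {m : Mode} (a b : Ex m) : Ex m
  | mul {m : Mode} (a b : Ex m) : Ex m
  | div {m : Mode} (a b : Ex m) : Ex m
  | ite {m : Mode} (a b c : Ex m) : Ex m
  | sum {m : Mode} (v : ℕ) (a : Ex m) : Ex m
  | iter (init : Ex .plain) (body out : Ex .inner) : Ex .outer

open Classical in
/-- The value of an expression on an input `z` of length `N`, where `ρ` gives the values of the
index variables and `M` is the current matrix. An iteration computes matrices `M₀, …, M_N`, whose
entry in position `(v₁, v₂)` is given by `init` and then, for `v₀ = 0, 1, …, N - 1`, by `body`. -/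
noncomputable def Ex.eval (N : ℕ) (z : ℕ → ℝ) :
    {m : Mode} → Ex m → (ℕ → ℕ) → (ℕ → ℕ → ℝ) → ℝ
  | _, .const c, _, _ => c
  | _, .idx v, ρ, _ => ρ v
  | _, .get a, ρ, M => ∑ k ∈ Finset.range N, if a.eval N z ρ M = k then z k else 0
  | _, .mat u v, ρ, M => M (ρ u) (ρ v)
  | _, .add a b, ρ, M => a.eval N z ρ M + b.eval N z ρ M
  | _, .mul a b, ρ, M => a.eval N z ρ M * b.eval N z ρ M
  | _, .div a b, ρ, M => a.eval N z ρ M / b.eval N z ρ M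
  | _, .ite a b c, ρ, M => if 0 ≤ a.eval N z ρ M then b.eval N z ρ M else c.eval N z ρ M
  | _, .sum v a, ρ, M => ∑ k ∈ Finset.range N, a.eval N z (Function.update ρ v k) M
  | _, .iter init body out, ρ, M =>
      out.eval N z ρ (Nat.rec
        (fun i j => init.eval N z (Function.update (Function.update ρ 1 i) 2 j) M)
        (fun t A i j => body.eval N z
          (Function.update (Function.update (Function.update ρ 0 t) 1 i) 2 j) A) N)

/-- `x_{8k+6} := x_{8k+8}` for all `k < N²`, where `N = x₀`. -/
noncomputable def copyMat (k : ℕ) : Cmd :=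
  .seq (.set (8 * k + 4) (MvPolynomial.X 0 * MvPolynomial.X 0))
    (.count (8 * (k + 1) + 4) (8 * k + 4)
      (.seq (.fetch (8 * (k + 2) + 4) 8 8 (8 * (k + 1) + 4) (8 * (k + 3) + 4))
        (.store (8 * (k + 2) + 4) 6 8 (8 * (k + 1) + 4) (8 * (k + 3) + 4))))

/-- Replaces the current matrix by the one whose entries are computed by `a` into the `k`-th
scratch register. -/
noncomputable def fillMat (k : ℕ) (a : Cmd) : Cmd :=
  .seq (.count 10 0 (.count 18 0 (.seq a
    (.seq (.set (8 * (k + 1) + 4) (MvPolynomial.X 10 * MvPolynomial.X 0 + MvPolynomial.X 18))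
      (.store (8 * k + 4) 8 8 (8 * (k + 1) + 4) (8 * (k + 2) + 4))))))
    (.seq (copyMat k) (.seq (.set 10 0) (.set 18 0)))

/-- The program that evaluates an expression into the `d`-th scratch register. Register `0` holds
the length of the input, the index variables stand in the registers `8v + 2`, scratch registers
are `8k + 4`, and the current and the next matrix stand in `8k + 6` and `8k + 8`. -/
noncomputable def Ex.cmd : {m : Mode} → Ex m → ℕ → Cmd
  | _, .const c, d => .set (8 * d + 4) (MvPolynomial.C c)
  | _, .idx v, d => .set (8 * d + 4) (MvPolynomial.X (8 * v + 2))
  | _, .get a, d =>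
      .seq (a.cmd d) (.seq (.set (8 * (d + 1) + 4) 0) (.seq (.count (8 * (d + 2) + 4) 0
        (.ite (-((MvPolynomial.X (8 * d + 4) - MvPolynomial.X (8 * (d + 2) + 4)) *
            (MvPolynomial.X (8 * d + 4) - MvPolynomial.X (8 * (d + 2) + 4))))
          (.fetch (8 * (d + 1) + 4) 1 2 (8 * (d + 2) + 4) (8 * (d + 3) + 4)) (.skip 0)))
        (.set (8 * d + 4) (MvPolynomial.X (8 * (d + 1) + 4)))))
  | _, .mat u v, d =>
      .seq (.set (8 * (d + 1) + 4)
        (MvPolynomial.X (8 * u + 2) * MvPolynomial.X 0 + MvPolynomial.X (8 * v + 2)))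
        (.fetch (8 * d + 4) 6 8 (8 * (d + 1) + 4) (8 * (d + 2) + 4))
  | _, .add a b, d =>
      .seq (a.cmd d) (.seq (b.cmd (d + 1))
        (.set (8 * d + 4) (MvPolynomial.X (8 * d + 4) + MvPolynomial.X (8 * (d + 1) + 4))))
  | _, .mul a b, d =>
      .seq (a.cmd d) (.seq (b.cmd (d + 1))
        (.set (8 * d + 4) (MvPolynomial.X (8 * d + 4) * MvPolynomial.X (8 * (d + 1) + 4))))
  | _, .div a b, d =>
      .seq (a.cmd d) (.seq (b.cmd (d + 1))
        (.ite (-(MvPolynomial.X (8 * (d + 1) + 4) * MvPolynomial.X (8 * (d + 1) + 4)))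
          (.set (8 * d + 4) 0)
          (.prim (.comp (8 * d + 4) (MvPolynomial.X (8 * d + 4))
            (MvPolynomial.X (8 * (d + 1) + 4))))))
  | _, .ite a b c, d =>
      .seq (a.cmd d) (.ite (MvPolynomial.X (8 * d + 4)) (b.cmd d) (c.cmd d))
  | _, .sum v a, d =>
      .seq (.set (8 * d + 4) 0) (.seq (.set (8 * (d + 1) + 4) (MvPolynomial.X (8 * v + 2)))
        (.seq (.count (8 * v + 2) 0 (.seq (a.cmd (d + 2))
          (.set (8 * d + 4) (MvPolynomial.X (8 * d + 4) + MvPolynomial.X (8 * (d + 2) + 4)))))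
          (.set (8 * v + 2) (MvPolynomial.X (8 * (d + 1) + 4)))))
  | _, .iter init body out, d =>
      .seq (.set (8 * d + 4) (MvPolynomial.X 2)) (.seq (.set (8 * (d + 1) + 4) (MvPolynomial.X 10))
        (.seq (.set (8 * (d + 2) + 4) (MvPolynomial.X 18))
          (.seq (fillMat (d + 3) (init.cmd (d + 3)))
            (.seq (.count 2 0 (fillMat (d + 3) (body.cmd (d + 3))))
              (.seq (.set 2 (MvPolynomial.X (8 * d + 4)))
                (.seq (.set 10 (MvPolynomial.X (8 * (d + 1) + 4)))
                  (.seq (.set 18 (MvPolynomial.X (8 * (d + 2) + 4))) (out.cmd d))))))))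

/-- The registers `x` hold the given data. -/
structure Holds (m : Mode) (N : ℕ) (z : ℕ → ℝ) (ρ : ℕ → ℕ) (M : ℕ → ℕ → ℝ) (x : ℕ → ℝ) :
    Prop where
  len : x 0 = N
  inp : ∀ k, x (2 * k + 1) = z k
  var : ∀ v, x (8 * v + 2) = ρ v
  lt : ∀ v, ρ v < N
  mat : m = .inner → ∀ i < N, ∀ j < N, x (8 * (i * N + j) + 6) = M i j

/-- Nothing is changed except scratch registers from `d` on and, in mode `outer`, matrices. -/
def Keeps (m : Mode) (d : ℕ) (x x' : ℕ → ℝ) : Prop :=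
  ∀ a, (∀ k, d ≤ k → a ≠ 8 * k + 4) → (m = .outer → ∀ k, a ≠ 8 * k + 6 ∧ a ≠ 8 * k + 8) →
    x' a = x a

theorem Keeps.refl (m : Mode) (d : ℕ) (x : ℕ → ℝ) : Keeps m d x x := fun _ _ _ => rfl

theorem Keeps.trans {m : Mode} {d d' : ℕ} {x x' x'' : ℕ → ℝ} (h : Keeps m d x x')
    (h' : Keeps m d' x' x'') (hd : d ≤ d') : Keeps m d x x'' := fun a h1 h2 => by
  rw [h' a (fun k hk => h1 k (hd.trans hk)) h2, h a h1 h2]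

theorem Keeps.update {m : Mode} {d k : ℕ} {x x' : ℕ → ℝ} (h : Keeps m d x x') (hk : d ≤ k)
    (c : ℝ) : Keeps m d x (Function.update x' (8 * k + 4) c) := fun a h1 h2 => by
  rw [Function.update_of_ne (h1 k hk), h a h1 h2]

theorem Keeps.tmp {m : Mode} {d k : ℕ} {x x' : ℕ → ℝ} (h : Keeps m d x x') (hk : k < d) :
    x' (8 * k + 4) = x (8 * k + 4) := h _ (fun l hl => by omega) (fun _ l => by omega)

/-- Residues modulo 8 separate the kinds of registers: the input has odd indices, index variables
have residue 2, scratch registers 4, the two matrices 6 and 0. Register `0` is safe because the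
second matrix starts at `8`. In mode `inner` the matrices are kept as well, since only `outer` may
change them. -/
theorem Holds.keeps {m : Mode} {N d : ℕ} {z : ℕ → ℝ} {ρ : ℕ → ℕ} {M : ℕ → ℕ → ℝ} {x x' : ℕ → ℝ}
    (h : Holds m N z ρ M x) (hk : Keeps m d x x') : Holds m N z ρ M x' where
  len := by rw [hk 0 (fun k _ => by omega) (fun _ k => by omega), h.len]
  inp k := by rw [hk _ (fun k _ => by omega) (fun _ k => by omega), h.inp]
  var v := by rw [hk _ (fun k _ => by omega) (fun _ k => by omega), h.var]
  lt := h.lt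
  mat hm i hi j hj := by
    rw [hk _ (fun k _ => by omega) (fun h => by simp [hm] at h), h.mat hm i hi j hj]

theorem Holds.update_var {m : Mode} {N : ℕ} {z : ℕ → ℝ} {ρ : ℕ → ℕ} {M : ℕ → ℕ → ℝ}
    {x : ℕ → ℝ} (h : Holds m N z ρ M x) (v : ℕ) {k : ℕ} (hk : k < N) :
    Holds m N z (Function.update ρ v k) M (Function.update x (8 * v + 2) k) where
  len := by rw [Function.update_of_ne (by omega), h.len]
  inp k := by rw [Function.update_of_ne (by omega), h.inp]
  var u := by
    by_cases hu : u = v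
    · simp [hu]
    · rw [Function.update_of_ne (by omega), Function.update_of_ne hu, h.var]
  lt u := by
    by_cases hu : u = v
    · simpa [hu] using hk
    · rw [Function.update_of_ne hu]; exact h.lt u
  mat hm i hi j hj := by rw [Function.update_of_ne (by omega), h.mat hm i hi j hj]

/-- The program `a` computes the function `f` into the `d`-th scratch register, in time
polynomial in the length of the input. -/
def Evaluates (m : Mode) (d : ℕ) (a : Cmd)
    (f : ℕ → (ℕ → ℝ) → (ℕ → ℕ) → (ℕ → ℕ → ℝ) → ℝ) : Prop :=
  ∃ p : Polynomial ℕ, ∀ N z ρ M s, Holds m N z ρ M s.x →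
    Exec a s (p.eval N) fun s' => Keeps m d s.x s'.x ∧ s'.x (8 * d + 4) = f N z ρ M

/-- New entries go into a second matrix because later entries are still computed from the first one;
only the complete matrix is moved, by one loop over the flattened positions. -/
theorem exec_copyMat (k N : ℕ) (s : St) (hN : s.x 0 = N) :
    Exec (copyMat k) s (1 + (N * N * (((1 + (8 + ((N * N * (8 + 1 + 3) + 2) +
      (1 + ((8 * (k + 2) + 4) + 1))))) + (1 + (6 + ((N * N * (8 + 1 + 3) + 2) +
      (1 + ((8 * (k + 2) + 4) + 1)))))) + 3) + 2)) fun s' =>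
      (∀ c, (∀ l, k ≤ l → c ≠ 8 * l + 4) → (∀ l, c ≠ 8 * l + 6) → s'.x c = s.x c) ∧
      ∀ c < N * N, s'.x (8 * c + 6) = s.x (8 * c + 8) := by
  refine Exec.seq (Exec.set ?_)
  refine Exec.count (n := N * N) (fun c u =>
    u.x (8 * (k + 1) + 4) = c ∧ u.x (8 * k + 4) = ((N * N : ℕ) : ℝ) ∧
    (∀ c, (∀ l, k ≤ l → c ≠ 8 * l + 4) → (∀ l, c ≠ 8 * l + 6) → u.x c = s.x c) ∧
      ∀ c' < c, u.x (8 * c' + 6) = s.x (8 * c' + 8)) ?_ ?_ ?_ ?_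
  · rintro c u ⟨h1, h2, -, -⟩
    exact ⟨h1, h2⟩
  · refine ⟨by simp, ?_, ?_, by simp⟩
    · simp [hN]
    · intro c h1 h2
      simp only
      rw [Function.update_of_ne (h1 _ (by omega)), Function.update_of_ne (h1 _ (by omega))]
  · rintro c u hc ⟨h1, h2, h3, h4⟩
    refine Exec.seq (Exec.mono (Exec.fetch h1 (by omega) (by omega) (Q := fun v =>
      (∀ l, (∀ l', k + 2 ≤ l' → l ≠ 8 * l' + 4) → v.x l = u.x l) ∧
        v.x (8 * (k + 2) + 4) = u.x (8 * c + 8)) ?_) ?_ ?_)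
    · intro r w
      refine ⟨fun l hl => ?_, ?_⟩
      · simp only
        rw [Function.update_of_ne (hl _ (by omega)), Function.update_of_ne (hl _ (by omega))]
      · simp only [Function.update_self]
        congr 1
        ring
    · gcongr
    · rintro v ⟨h5, h6⟩
      have h7 : v.x (8 * (k + 1) + 4) = c := by rw [h5 _ (by omega), h1]
      refine Exec.mono (Exec.store h7 (by omega) (by omega) (Q := fun w =>
        (∀ l, (∀ l', k + 2 ≤ l' → l ≠ 8 * l' + 4) → l ≠ 8 * c + 6 → w.x l = u.x l) ∧
          w.x (8 * c + 6) = u.x (8 * c + 8)) ?_) (by gcongr) ?_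
      · intro r w
        refine ⟨fun l hl hl' => ?_, ?_⟩
        · simp only
          rw [Function.update_of_ne (by omega), Function.update_of_ne (hl _ (by omega)), h5 _ hl]
        · simp only
          rw [show 8 * c + 6 = 6 + 8 * c by ring, Function.update_self, h6]
      · rintro w ⟨h8, h9⟩
        refine ⟨by rw [h8 _ (by omega) (by omega), h1], by simp, ?_, ?_, ?_⟩
        · simp only
          rw [Function.update_of_ne (by omega), h8 _ (by omega) (by omega), h2]
        · intro l hl hl'
          simp only
          rw [Function.update_of_ne (hl _ (by omega)), h8 _ (fun _ _ => hl _ (by omega)) (hl' _),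
            h3 _ hl hl']
        · intro c' hc'
          simp only
          rw [Function.update_of_ne (by omega)]
          by_cases hcc : c' = c
          · rw [hcc, h9, h3 _ (by omega) (by omega)]
          · rw [h8 _ (by omega) (by omega), h4 _ (by omega)]
  · rintro u ⟨-, -, h3, h4⟩
    exact ⟨h3, h4⟩

theorem flat_inj {N i j i' j' : ℕ} (hj : j < N) (hj' : j' < N) (h : i * N + j = i' * N + j') :
    i = i' ∧ j = j' := by
  have h1 : i = i' := by
    have h2 : (i * N + j) / N = i := by
      rw [mul_comm, Nat.mul_add_div (by omega), Nat.div_eq_of_lt hj, add_zero]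
    have h3 : (i' * N + j') / N = i' := by
      rw [mul_comm, Nat.mul_add_div (by omega), Nat.div_eq_of_lt hj', add_zero]
    rw [← h2, ← h3, h]
  subst h1
  exact ⟨rfl, by omega⟩

theorem flat_lt {N i j : ℕ} (hi : i < N) (hj : j < N) : i * N + j < N * N := by nlinarith

/-- What `fillMat` leaves unchanged. -/
def FillKeeps (k : ℕ) (x x' : ℕ → ℝ) : Prop :=
  ∀ c, c ≠ 10 → c ≠ 18 → (∀ l, k ≤ l → c ≠ 8 * l + 4) → (∀ l, c ≠ 8 * l + 8) → x' c = x c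

/-- In a mode other than `outer` the program `a` leaves the matrix registers alone, so the entries
already stored survive the computation of the next ones, and the current matrix remains readable
throughout. -/
theorem exec_fillMat {m : Mode} (hm : m ≠ .outer) {k : ℕ} {a : Cmd}
    {f : ℕ → (ℕ → ℝ) → (ℕ → ℕ) → (ℕ → ℕ → ℝ) → ℝ} (ha : Evaluates m k a f) :
    ∃ p : Polynomial ℕ, ∀ N z ρ M s, Holds m N z ρ M s.x →
      Exec (fillMat k a) s (p.eval N) fun s' =>
        (∀ c, c ≠ 10 → c ≠ 18 → (∀ l, k ≤ l → c ≠ 8 * l + 4) →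
          (∀ l, c ≠ 8 * l + 6 ∧ c ≠ 8 * l + 8) → s'.x c = s.x c) ∧
        s'.x 10 = 0 ∧ s'.x 18 = 0 ∧
        ∀ i < N, ∀ j < N, s'.x (8 * (i * N + j) + 6) =
          f N z (Function.update (Function.update ρ 1 i) 2 j) M := by
  obtain ⟨p, hp⟩ := ha
  let S : Polynomial ℕ := (1 + (8 + ((Polynomial.X * Polynomial.X *
      ((8 + 1 + 3 : ℕ) : Polynomial ℕ) + 2) + (1 + (((8 * k + 4 : ℕ) : Polynomial ℕ) + 1)))))
  let C : Polynomial ℕ := (1 + (Polynomial.X * Polynomial.X *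
    (((1 + (8 + ((Polynomial.X * Polynomial.X * ((8 + 1 + 3 : ℕ) : Polynomial ℕ) + 2) +
      (1 + (((8 * (k + 2) + 4 : ℕ) : Polynomial ℕ) + 1))))) +
    (1 + (6 + ((Polynomial.X * Polynomial.X * ((8 + 1 + 3 : ℕ) : Polynomial ℕ) + 2) +
      (1 + (((8 * (k + 2) + 4 : ℕ) : Polynomial ℕ) + 1)))))) + 3) + 2))
  refine ⟨(Polynomial.X * ((Polynomial.X * ((p + (1 + S)) + 3) + 2) + 3) + 2) + (C + (1 + 1)),
    fun N z ρ M s hs => ?_⟩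
  have hN := hs.len
  have hSeval : S.eval N = (1 + (8 + ((N * N * (8 + 1 + 3) + 2) + (1 + ((8 * k + 4) + 1))))) := by
    simp [S]
  have hCeval : C.eval N = (1 + (N * N * (((1 + (8 + ((N * N * (8 + 1 + 3) + 2) +
      (1 + ((8 * (k + 2) + 4) + 1))))) + (1 + (6 + ((N * N * (8 + 1 + 3) + 2) +
      (1 + ((8 * (k + 2) + 4) + 1)))))) + 3) + 2)) := by
    simp [C]
  have htot : ((Polynomial.X * ((Polynomial.X * ((p + (1 + S)) + 3) + 2) + 3) + 2) +
      (C + (1 + 1)) : Polynomial ℕ).eval N =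
      (N * ((N * ((p.eval N + (1 + S.eval N)) + 3) + 2) + 3) + 2) + (C.eval N + (1 + 1)) := by
    simp
  rw [htot]
  set g : ℕ → ℕ → ℝ := fun i j => f N z (Function.update (Function.update ρ 1 i) 2 j) M with hg
  refine Exec.seq ?_
  refine Exec.count (fun i u => u.x 10 = i ∧ FillKeeps k s.x u.x ∧
    ∀ i' < i, ∀ j' < N, u.x (8 * (i' * N + j') + 8) = g i' j') ?_ ?_ ?_ ?_
  · rintro i u ⟨h1, h2, -⟩
    exact ⟨h1, by rw [h2 0 (by omega) (by omega) (by omega) (by omega), hN]⟩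
  · refine ⟨by simp, fun c h1 h2 h3 h4 => by simp [h1], by simp⟩
  · rintro i u hi ⟨h1, h2, h3⟩
    refine Exec.count (fun j v => v.x 18 = j ∧ v.x 10 = i ∧ FillKeeps k s.x v.x ∧
      (∀ i' < i, ∀ j' < N, v.x (8 * (i' * N + j') + 8) = g i' j') ∧
      ∀ j' < j, v.x (8 * (i * N + j') + 8) = g i j') ?_ ?_ ?_ ?_
    · rintro j v ⟨h4, -, h5, -⟩
      exact ⟨h4, by rw [h5 0 (by omega) (by omega) (by omega) (by omega), hN]⟩
    · refine ⟨by simp, by simp [h1], fun c k1 k2 k3 k4 => ?_, fun i' hi' j' hj' => ?_, by simp⟩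
      · simp [k2, h2 c k1 k2 k3 k4]
      · simp only
        rw [Function.update_of_ne (by omega), h3 i' hi' j' hj']
    · rintro j v hj ⟨h4, h5, h6, h7, h8⟩
      have hv : Holds m N z (Function.update (Function.update ρ 1 i) 2 j) M v.x := by
        have := (hs.update_var 1 hi).update_var 2 hj
        refine ⟨?_, ?_, ?_, this.lt, ?_⟩
        · rw [h6 0 (by omega) (by omega) (by omega) (by omega), hN]
        · intro l
          rw [h6 _ (by omega) (by omega) (by omega) (by omega), hs.inp]
        · intro l
          by_cases hl2 : l = 2
          · subst hl2; simp [h4]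
          · by_cases hl1 : l = 1
            · subst hl1; simp [h5]
            · rw [h6 _ (by omega) (by omega) (by omega) (by omega), hs.var]
              simp [hl1, hl2]
        · intro hmi i' hi' j' hj'
          rw [h6 _ (by omega) (by omega) (by omega) (by omega), hs.mat hmi i' hi' j' hj']
      refine Exec.seq (Exec.mono (hp _ _ _ _ _ hv) le_rfl ?_)
      rintro w ⟨h9, h10⟩
      have hw10 : w.x 10 = i := by
        rw [h9 10 (by omega) (by omega), h5]
      have hw18 : w.x 18 = j := by
        rw [h9 18 (by omega) (by omega), h4]
      have hw0 : w.x 0 = N := (hv.keeps h9).len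
      refine Exec.seq (Exec.set ?_)
      refine Exec.mono (Exec.store (k := i * N + j) (Q := fun w' =>
        (∀ c, (∀ l, k ≤ l → c ≠ 8 * l + 4) → c ≠ 8 * (i * N + j) + 8 → w'.x c = v.x c) ∧
        w'.x (8 * (i * N + j) + 8) = g i j) ?_ (by omega) (by omega) ?_) ?_ ?_
      · simp [hw10, hw18, hw0]
      · intro r' w'
        refine ⟨fun c k1 k2 => ?_, ?_⟩
        · simp only
          rw [Function.update_of_ne (by omega), Function.update_of_ne (k1 _ (by omega)),
            Function.update_of_ne (k1 _ (by omega)), h9 c k1 (fun h => absurd h hm)]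
        · simp only
          rw [show 8 * (i * N + j) + 8 = 8 + 8 * (i * N + j) by ring, Function.update_self,
            Function.update_of_ne (by omega), h10]
      · rw [hSeval]
        have := flat_lt hi hj
        gcongr
      · rintro w' ⟨h11, h12⟩
        refine ⟨by rw [h11 _ (by omega) (by omega), h4], by simp, ?_, ?_, ?_, ?_⟩
        · simp only
          rw [Function.update_of_ne (by omega), h11 _ (by omega) (by omega), h5]
        · intro c k1 k2 k3 k4
          simp only
          rw [Function.update_of_ne k2, h11 _ k3 (k4 _), h6 c k1 k2 k3 k4]
        · intro i' hi' j' hj'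
          simp only
          have hne : i' * N + j' ≠ i * N + j := fun h => by
            have := (flat_inj hj' hj h).1
            omega
          rw [Function.update_of_ne (by omega), h11 _ (by omega) (by omega), h7 i' hi' j' hj']
        · intro j' hj'
          simp only
          rw [Function.update_of_ne (by omega)]
          by_cases hjj : j' = j
          · rw [hjj, h12]
          · rw [h11 _ (by omega) (by omega), h8 j' (by omega)]
    · rintro v ⟨h4, h5, h6, h7, h8⟩
      refine ⟨h5, by simp, ?_, ?_⟩
      · intro c k1 k2 k3 k4
        simp only
        rw [Function.update_of_ne k1, h6 c k1 k2 k3 k4]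
      · intro i' hi' j' hj'
        simp only
        rw [Function.update_of_ne (by omega)]
        by_cases hii : i' = i
        · rw [hii, h8 j' hj']
        · exact h7 i' (by omega) j' hj'
  · rintro u ⟨h1, h2, h3⟩
    have hu0 : u.x 0 = N := by rw [h2 0 (by omega) (by omega) (by omega) (by omega), hN]
    refine Exec.seq (Exec.mono (exec_copyMat k N u hu0) hCeval.ge ?_)
    rintro v ⟨h4, h5⟩
    -- The counting loops leave `N` in the registers of `v₁` and `v₂`, which is not a legal index
    -- value; zero is.
    refine Exec.seq (Exec.set (Exec.set ⟨?_, by simp, by simp, ?_⟩))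
    · intro c k1 k2 k3 k4
      simp only
      rw [Function.update_of_ne k2, Function.update_of_ne k1, h4 c k3 (fun l => (k4 l).1),
        h2 c k1 k2 k3 (fun l => (k4 l).2)]
    · intro i hi j hj
      simp only
      rw [Function.update_of_ne (by omega), Function.update_of_ne (by omega),
        h5 _ (flat_lt hi hj), h3 i hi j hj]

end BSS

/-! ### Correctness and running time of the compiled expressions -/

namespace BSS

theorem Evaluates.set {m : Mode} {d : ℕ} {q : MvPolynomial ℕ ℝ}
    {f : ℕ → (ℕ → ℝ) → (ℕ → ℕ) → (ℕ → ℕ → ℝ) → ℝ}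
    (h : ∀ N z ρ M x, Holds m N z ρ M x → MvPolynomial.eval x q = f N z ρ M) :
    Evaluates m d (.set (8 * d + 4) q) f := by
  refine ⟨1, fun N z ρ M s hs => ?_⟩
  rw [Polynomial.eval_one]
  exact Exec.set ⟨(Keeps.refl _ _ _).update le_rfl _, by simp [h N z ρ M _ hs]⟩

/-- The two operands of a binary operation are computed into consecutive registers. -/
theorem Evaluates.binary {m : Mode} {d : ℕ} {a b c : Cmd}
    {f g h : ℕ → (ℕ → ℝ) → (ℕ → ℕ) → (ℕ → ℕ → ℝ) → ℝ} (ha : Evaluates m d a f)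
    (hb : Evaluates m (d + 1) b g) {T : ℕ}
    (hc : ∀ N z ρ M s, s.x (8 * d + 4) = f N z ρ M → s.x (8 * (d + 1) + 4) = g N z ρ M →
      Exec c s T fun s' => s'.x = Function.update s.x (8 * d + 4) (h N z ρ M)) :
    Evaluates m d (.seq a (.seq b c)) h := by
  obtain ⟨p, hp⟩ := ha
  obtain ⟨q, hq⟩ := hb
  refine ⟨p + (q + (T : Polynomial ℕ)), fun N z ρ M s hs => ?_⟩
  simp only [Polynomial.eval_add, Polynomial.eval_natCast]
  refine Exec.seq ((hp N z ρ M s hs).mono le_rfl ?_)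
  rintro u ⟨h1, h2⟩
  refine Exec.seq ((hq N z ρ M u (hs.keeps h1)).mono le_rfl ?_)
  rintro v ⟨h3, h4⟩
  refine (hc N z ρ M v (by rw [h3.tmp (by omega), h2]) h4).mono (by simp) ?_
  intro w hw
  rw [hw]
  exact ⟨(h1.trans h3 (by omega)).update le_rfl _, by simp⟩

theorem Evaluates.ite {m : Mode} {d : ℕ} {a b c : Cmd}
    {f g h k : ℕ → (ℕ → ℝ) → (ℕ → ℕ) → (ℕ → ℕ → ℝ) → ℝ} (ha : Evaluates m d a f)
    (hb : Evaluates m d b g) (hc : Evaluates m d c h)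
    (hpos : ∀ N z ρ M, 0 ≤ f N z ρ M → k N z ρ M = g N z ρ M)
    (hneg : ∀ N z ρ M, f N z ρ M < 0 → k N z ρ M = h N z ρ M) :
    Evaluates m d (.seq a (.ite (MvPolynomial.X (8 * d + 4)) b c)) k := by
  obtain ⟨p, hp⟩ := ha
  obtain ⟨q, hq⟩ := hb
  obtain ⟨q', hq'⟩ := hc
  refine ⟨p + ((q + q') + 2), fun N z ρ M s hs => ?_⟩
  rw [Polynomial.eval_add, Polynomial.eval_add (p := q + q'), Polynomial.eval_ofNat]
  refine Exec.seq ((hp N z ρ M s hs).mono le_rfl ?_)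
  rintro u ⟨h1, h2⟩
  refine Exec.ite (fun h3 => ?_) (fun h3 => ?_) <;>
    rw [MvPolynomial.eval_X, h2] at h3
  · refine (hq N z ρ M u (hs.keeps h1)).mono (by simp) ?_
    rintro v ⟨h4, h5⟩
    exact ⟨h1.trans h4 le_rfl, by rw [h5, hpos _ _ _ _ h3]⟩
  · refine (hq' N z ρ M u (hs.keeps h1)).mono (by simp) ?_
    rintro v ⟨h4, h5⟩
    exact ⟨h1.trans h4 le_rfl, by rw [h5, hneg _ _ _ _ h3]⟩

/-- Scratch register `d` accumulates the sum and register `d + 1` saves the old value of the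
summation variable, which the loop overwrites and which is restored at the end. The invariant
compares with the initial registers in which only that variable has been changed. -/
theorem Evaluates.sum {m : Mode} {d v : ℕ} {a : Cmd}
    {f : ℕ → (ℕ → ℝ) → (ℕ → ℕ) → (ℕ → ℕ → ℝ) → ℝ} (ha : Evaluates m (d + 2) a f) :
    Evaluates m d
      (.seq (.set (8 * d + 4) 0) (.seq (.set (8 * (d + 1) + 4) (MvPolynomial.X (8 * v + 2)))
        (.seq (.count (8 * v + 2) 0 (.seq a
          (.set (8 * d + 4) (MvPolynomial.X (8 * d + 4) + MvPolynomial.X (8 * (d + 2) + 4)))))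
          (.set (8 * v + 2) (MvPolynomial.X (8 * (d + 1) + 4))))))
      (fun N z ρ M => ∑ k ∈ Finset.range N, f N z (Function.update ρ v k) M) := by
  obtain ⟨p, hp⟩ := ha
  refine ⟨1 + (1 + ((Polynomial.X * ((p + 1) + 3) + 2) + 1)), fun N z ρ M s hs => ?_⟩
  have hev : (1 + (1 + ((Polynomial.X * ((p + 1) + 3) + 2) + 1)) : Polynomial ℕ).eval N =
      1 + (1 + ((N * ((p.eval N + 1) + 3) + 2) + 1)) := by simp
  rw [hev]
  have hvar := hs.var v
  refine Exec.seq (Exec.set (Exec.seq (Exec.set (Exec.seq ?_))))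
  refine Exec.count (fun k u => Keeps m d (Function.update s.x (8 * v + 2) k) u.x ∧
    u.x (8 * d + 4) = ∑ k ∈ Finset.range k, f N z (Function.update ρ v k) M ∧
    u.x (8 * (d + 1) + 4) = ρ v) ?_ ?_ ?_ ?_
  · rintro k u ⟨h1, -, -⟩
    refine ⟨?_, ?_⟩
    · rw [h1 _ (by omega) (by omega), Function.update_self]
    · rw [h1 _ (by omega) (by omega), Function.update_of_ne (by omega), hs.len]
  · refine ⟨?_, ?_, ?_⟩
    · intro c h1 h2
      by_cases hc : c = 8 * v + 2
      · simp [hc]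
      · simp [hc, h1 d le_rfl, h1 (d + 1) (by omega)]
    · simp only [Finset.range_zero, Finset.sum_empty]
      rw [Function.update_of_ne (by omega), Function.update_of_ne (by omega)]
      simp
    · simp only
      rw [Function.update_of_ne (by omega), Function.update_self, MvPolynomial.eval_X,
        Function.update_of_ne (by omega), hvar]
  · rintro k u hk ⟨h1, h2, h3⟩
    refine Exec.seq ((hp N z _ M u ((hs.update_var v hk).keeps h1)).mono le_rfl ?_)
    rintro w ⟨h4, h5⟩
    have h6 := h1.trans h4 (by omega)
    refine Exec.set ⟨?_, ?_, ?_, ?_⟩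
    · simp only
      rw [Function.update_of_ne (by omega), h6 _ (by omega) (by omega), Function.update_self]
    · intro c h7 h8
      by_cases hc : c = 8 * v + 2
      · simp [hc]
      · simp only
        rw [Function.update_of_ne hc, Function.update_of_ne (h7 d le_rfl), h6 c h7 h8,
          Function.update_of_ne hc, Function.update_of_ne hc]
    · simp only
      rw [Function.update_of_ne (by omega), Function.update_self, map_add, MvPolynomial.eval_X,
        MvPolynomial.eval_X, h5, h4.tmp (by omega), h2, Finset.sum_range_succ]
    · simp only
      rw [Function.update_of_ne (by omega), Function.update_of_ne (by omega), h4.tmp (by omega),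
        h3]
  · rintro u ⟨h1, h2, h3⟩
    refine Exec.set ⟨?_, ?_⟩
    · intro c h4 h5
      by_cases hc : c = 8 * v + 2
      · simp [hc, h3, hvar]
      · simp only
        rw [Function.update_of_ne hc, h1 c h4 h5, Function.update_of_ne hc]
    · simp only
      rw [Function.update_of_ne (by omega), h2]

/-- The iteration uses `v₀`, `v₁`, `v₂` as its own loop variables. Their values are saved in three
scratch registers and restored before `out` is evaluated. The invariant says that the current matrix
after `t` passes is `A t`. -/
theorem Evaluates.iter {d : ℕ} {a b c : Cmd}
    {f g h : ℕ → (ℕ → ℝ) → (ℕ → ℕ) → (ℕ → ℕ → ℝ) → ℝ}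
    (ha : Evaluates .plain (d + 3) a f) (hb : Evaluates .inner (d + 3) b g)
    (hc : Evaluates .inner d c h) :
    Evaluates .outer d
      (.seq (.set (8 * d + 4) (MvPolynomial.X 2)) (.seq (.set (8 * (d + 1) + 4) (MvPolynomial.X 10))
        (.seq (.set (8 * (d + 2) + 4) (MvPolynomial.X 18))
          (.seq (fillMat (d + 3) a)
            (.seq (.count 2 0 (fillMat (d + 3) b))
              (.seq (.set 2 (MvPolynomial.X (8 * d + 4)))
                (.seq (.set 10 (MvPolynomial.X (8 * (d + 1) + 4)))
                  (.seq (.set 18 (MvPolynomial.X (8 * (d + 2) + 4))) c))))))))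
      (fun N z ρ M => h N z ρ (Nat.rec
        (fun i j => f N z (Function.update (Function.update ρ 1 i) 2 j) M)
        (fun t A i j => g N z
          (Function.update (Function.update (Function.update ρ 0 t) 1 i) 2 j) A) N)) := by
  obtain ⟨p, hp⟩ := exec_fillMat (by simp) ha
  obtain ⟨q, hq⟩ := exec_fillMat (by simp) hb
  obtain ⟨p', hp'⟩ := hc
  refine ⟨1 + (1 + (1 + (p + ((Polynomial.X * (q + 3) + 2) + (1 + (1 + (1 + p'))))))),
    fun N z ρ M s hs => ?_⟩
  have hev : (1 + (1 + (1 + (p + ((Polynomial.X * (q + 3) + 2) + (1 + (1 + (1 + p'))))))) :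
      Polynomial ℕ).eval N =
      1 + (1 + (1 + (p.eval N + ((N * (q.eval N + 3) + 2) + (1 + (1 + (1 + p'.eval N)))))))  := by
    simp
  rw [hev]
  have hN := hs.len
  have hpos : 0 < N := (Nat.zero_le _).trans_lt (hs.lt 0)
  set A : ℕ → ℕ → ℕ → ℝ := fun t => Nat.rec
    (fun i j => f N z (Function.update (Function.update ρ 1 i) 2 j) M)
    (fun t A i j => g N z
      (Function.update (Function.update (Function.update ρ 0 t) 1 i) 2 j) A) t with hA
  refine Exec.seq (Exec.set (Exec.seq (Exec.set (Exec.seq (Exec.set (Exec.seq ?_))))))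
  set x₁ := Function.update s.x (8 * d + 4) (MvPolynomial.eval s.x (MvPolynomial.X 2)) with hx₁
  set x₂ := Function.update x₁ (8 * (d + 1) + 4) (MvPolynomial.eval x₁ (MvPolynomial.X 10))
    with hx₂
  set x₃ := Function.update x₂ (8 * (d + 2) + 4) (MvPolynomial.eval x₂ (MvPolynomial.X 18))
    with hx₃
  have hk₃ : Keeps .plain d s.x x₃ :=
    (((Keeps.refl _ _ _).update le_rfl _).update (by omega) _).update (by omega) _
  have ht0 : x₃ (8 * d + 4) = ρ 0 := by
    rw [hx₃, Function.update_of_ne (by omega), hx₂, Function.update_of_ne (by omega), hx₁,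
      Function.update_self, MvPolynomial.eval_X]
    exact hs.var 0
  have ht1 : x₃ (8 * (d + 1) + 4) = ρ 1 := by
    rw [hx₃, Function.update_of_ne (by omega), hx₂, Function.update_self, MvPolynomial.eval_X,
      hx₁, Function.update_of_ne (by omega)]
    exact hs.var 1
  have ht2 : x₃ (8 * (d + 2) + 4) = ρ 2 := by
    rw [hx₃, Function.update_self, MvPolynomial.eval_X, hx₂, Function.update_of_ne (by omega),
      hx₁, Function.update_of_ne (by omega)]
    exact hs.var 2
  have hs₃ : Holds .plain N z ρ M x₃ :=
    Holds.keeps ⟨hs.len, hs.inp, hs.var, hs.lt, by simp⟩ hk₃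
  refine (hp N z ρ M ⟨s.r, s.w, x₃⟩ hs₃).mono le_rfl ?_
  rintro u ⟨h1, h2, h3, h4⟩
  refine Exec.seq ?_
  refine Exec.count (fun t w => w.x 2 = t ∧ w.x 10 = 0 ∧ w.x 18 = 0 ∧
    (∀ c, c ≠ 2 → c ≠ 10 → c ≠ 18 → (∀ l, d + 3 ≤ l → c ≠ 8 * l + 4) →
          (∀ l, c ≠ 8 * l + 6 ∧ c ≠ 8 * l + 8) → w.x c = x₃ c) ∧
    ∀ i < N, ∀ j < N, w.x (8 * (i * N + j) + 6) = A t i j) ?_ ?_ ?_ ?_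
  · rintro t w ⟨h5, -, -, h6, -⟩
    exact ⟨h5, by rw [h6 0 (by omega) (by omega) (by omega) (by omega) (by omega), hs₃.len]⟩
  · refine ⟨by simp, by simp [h2], by simp [h3], ?_, ?_⟩
    · intro c k0 k1 k2 k3 k4
      simp only
      rw [Function.update_of_ne k0, h1 c k1 k2 k3 k4]
    · intro i hi j hj
      simp only
      rw [Function.update_of_ne (by omega)]
      exact h4 i hi j hj
  · rintro t w ht ⟨h5, h6, h7, h8, h9⟩
    have hw : Holds .inner N z
        (Function.update (Function.update (Function.update ρ 0 t) 1 0) 2 0) (A t) w.x := by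
      refine ⟨?_, ?_, ?_, ?_, fun _ => h9⟩
      · rw [h8 0 (by omega) (by omega) (by omega) (by omega) (by omega), hs₃.len]
      · intro l
        rw [h8 _ (by omega) (by omega) (by omega) (by omega) (by omega), hs₃.inp]
      · intro l
        by_cases hl0 : l = 0
        · subst hl0; simp [h5]
        by_cases hl1 : l = 1
        · subst hl1; simp [h6]
        by_cases hl2 : l = 2
        · subst hl2; simp [h7]
        rw [h8 _ (by omega) (by omega) (by omega) (by omega) (by omega), hs₃.var]
        simp [hl0, hl1, hl2]
      · exact (((hs₃.update_var 0 ht).update_var 1 hpos).update_var 2 hpos).lt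
    refine (hq N z _ (A t) w hw).mono le_rfl ?_
    rintro w' ⟨k1, k2, k3, k4⟩
    refine ⟨by rw [k1 2 (by omega) (by omega) (by omega) (by omega), h5], by simp, by simp [k2],
      by simp [k3], ?_, ?_⟩
    · intro c l0 l1 l2 l3 l4
      simp only
      rw [Function.update_of_ne l0, k1 c l1 l2 l3 l4, h8 c l0 l1 l2 l3 l4]
    · intro i hi j hj
      simp only
      rw [Function.update_of_ne (by omega), k4 i hi j hj]
      -- At the start of a pass `v₁` and `v₂` are zero rather than `ρ 1` and `ρ 2`; this does not
      -- matter because both are overwritten.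
      change _ = g N z (Function.update (Function.update (Function.update ρ 0 t) 1 i) 2 j) (A t)
      congr 1
      funext l
      by_cases hl2 : l = 2
      · simp [hl2]
      by_cases hl1 : l = 1
      · simp [hl1]
      simp [hl1, hl2]
  · rintro w ⟨h5, h6, h7, h8, h9⟩
    refine Exec.seq (Exec.set (Exec.seq (Exec.set (Exec.seq (Exec.set ?_)))))
    simp only [MvPolynomial.eval_X]
    rw [Function.update_of_ne (show 8 * (d + 1) + 4 ≠ 2 by omega),
      Function.update_of_ne (show 8 * (d + 2) + 4 ≠ 10 by omega),
      Function.update_of_ne (show 8 * (d + 2) + 4 ≠ 2 by omega),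
      h8 (8 * d + 4) (by omega) (by omega) (by omega) (by omega) (by omega),
      h8 (8 * (d + 1) + 4) (by omega) (by omega) (by omega) (by omega) (by omega),
      h8 (8 * (d + 2) + 4) (by omega) (by omega) (by omega) (by omega) (by omega), ht0, ht1, ht2]
    set y := Function.update (Function.update (Function.update w.x 2 (ρ 0)) 10 (ρ 1)) 18
      ((ρ 2 : ℕ) : ℝ) with hy
    have hsy : Keeps .outer d s.x y := by
      intro c l1 l2
      by_cases hc2 : c = 18
      · subst hc2; simpa [hy] using (hs.var 2).symm
      by_cases hc1 : c = 10
      · subst hc1; simpa [hy] using (hs.var 1).symm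
      by_cases hc0 : c = 2
      · subst hc0; simpa [hy] using (hs.var 0).symm
      rw [hy, Function.update_of_ne hc2, Function.update_of_ne hc1, Function.update_of_ne hc0,
        h8 c hc0 hc1 hc2 (fun l _ => l1 l (by omega)) (l2 rfl), hk₃ c l1 (by simp)]
    have hys := hs.keeps hsy
    have hyi : Holds .inner N z ρ (A N) y := by
      refine ⟨hys.len, hys.inp, hys.var, hys.lt, fun _ i hi j hj => ?_⟩
      rw [hy, Function.update_of_ne (by omega), Function.update_of_ne (by omega),
        Function.update_of_ne (by omega), h9 i hi j hj]
    refine (hp' N z ρ (A N) ⟨w.r, w.w, y⟩ hyi).mono le_rfl ?_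
    rintro v ⟨k1, k2⟩
    refine ⟨fun c l1 l2 => ?_, k2⟩
    exact (k1 c l1 (by simp)).trans (hsy c l1 l2)

/-- A position is given as a real number and cannot be used as an address, so it is compared with
`0, 1, …, N - 1`. Equality is the single test `-(a - k)² ≥ 0`. It succeeds for at most one `k`; if
it never succeeds, the register keeps its initial value zero. -/
theorem Evaluates.get {m : Mode} {d : ℕ} {a : Cmd}
    {f : ℕ → (ℕ → ℝ) → (ℕ → ℕ) → (ℕ → ℕ → ℝ) → ℝ} (ha : Evaluates m d a f) :
    Evaluates m d
      (.seq a (.seq (.set (8 * (d + 1) + 4) 0) (.seq (.count (8 * (d + 2) + 4) 0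
        (.ite (-((MvPolynomial.X (8 * d + 4) - MvPolynomial.X (8 * (d + 2) + 4)) *
            (MvPolynomial.X (8 * d + 4) - MvPolynomial.X (8 * (d + 2) + 4))))
          (.fetch (8 * (d + 1) + 4) 1 2 (8 * (d + 2) + 4) (8 * (d + 3) + 4)) (.skip 0)))
        (.set (8 * d + 4) (MvPolynomial.X (8 * (d + 1) + 4))))))
      (fun N z ρ M => ∑ k ∈ Finset.range N, open Classical in
        if f N z ρ M = k then z k else 0) := by
  classical
  obtain ⟨p, hp⟩ := ha
  let F : Polynomial ℕ := 1 + (1 + ((Polynomial.X * ((2 + 1 + 3 : ℕ) : Polynomial ℕ) + 2) +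
      (1 + (((8 * (d + 1) + 4 : ℕ) : Polynomial ℕ) + 1))))
  refine ⟨p + (1 + ((Polynomial.X * ((F + 2) + 3) + 2) + 1)), fun N z ρ M s hs => ?_⟩
  have hF : F.eval N = 1 + (1 + ((N * (2 + 1 + 3) + 2) + (1 + ((8 * (d + 1) + 4) + 1)))) := by
    simp [F]
  have hev : (p + (1 + ((Polynomial.X * ((F + 2) + 3) + 2) + 1)) : Polynomial ℕ).eval N =
      p.eval N + (1 + ((N * ((F.eval N + 2) + 3) + 2) + 1)) := by simp
  rw [hev]
  refine Exec.seq ((hp N z ρ M s hs).mono le_rfl ?_)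
  rintro u ⟨h1, h2⟩
  refine Exec.seq (Exec.set (Exec.seq ?_))
  refine Exec.count (fun k w => Keeps m d s.x w.x ∧ w.x (8 * d + 4) = f N z ρ M ∧
    w.x (8 * (d + 1) + 4) = (∑ i ∈ Finset.range k, if f N z ρ M = i then z i else 0) ∧
    w.x (8 * (d + 2) + 4) = k) ?_ ?_ ?_ ?_
  · rintro k w ⟨h3, -, -, h4⟩
    exact ⟨h4, (hs.keeps h3).len⟩
  · refine ⟨(h1.update (by omega) _).update (by omega) _, ?_, ?_, by simp⟩
    · simp only
      rw [Function.update_of_ne (by omega), Function.update_of_ne (by omega), h2]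
    · simp only
      rw [Function.update_of_ne (by omega), Function.update_self]
      simp
  · rintro k w hk ⟨h3, h4, h5, h6⟩
    have hw := hs.keeps h3
    have hev : MvPolynomial.eval w.x
        (-((MvPolynomial.X (8 * d + 4) - MvPolynomial.X (8 * (d + 2) + 4)) *
          (MvPolynomial.X (8 * d + 4) - MvPolynomial.X (8 * (d + 2) + 4)))) =
        -((f N z ρ M - k) * (f N z ρ M - k)) := by simp [h4, h6]
    refine Exec.ite (fun h7 => ?_) (fun h7 => ?_) <;> rw [hev] at h7
    · have h8 : f N z ρ M = k :=
        sub_eq_zero.mp (mul_self_eq_zero.mp (le_antisymm (by linarith) (mul_self_nonneg _)))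
      refine (Exec.fetch h6 (by omega) (by omega) ?_).mono
        (T := 1 + (1 + ((k * (2 + 1 + 3) + 2) + (1 + ((8 * (d + 1) + 4) + 1))))) ?_ (fun _ h => h)
      · intro r' w'
        refine ⟨?_, ((h3.update (by omega) _).update (by omega) _).update (by omega) _, ?_, ?_,
          by simp⟩
        · simp only
          rw [Function.update_of_ne (by omega), Function.update_of_ne (by omega), h6]
        · simp only
          rw [Function.update_of_ne (by omega), Function.update_of_ne (by omega),
            Function.update_of_ne (by omega), h4]
        · simp only
          rw [Function.update_of_ne (by omega), Function.update_self, Finset.sum_range_succ,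
            if_pos h8, Finset.sum_eq_zero, zero_add, ← hw.inp, add_comm]
          intro i hi
          rw [Finset.mem_range] at hi
          rw [if_neg]
          rw [h8]
          exact_mod_cast hi.ne'
      · rw [hF]
        gcongr
    · have h8 : f N z ρ M ≠ k := by
        rintro h8
        simp [h8] at h7
      refine (Exec.skip ?_).mono (T := 1) (by rw [hF]; omega) (fun _ h => h)
      refine ⟨h6, h3.update (by omega) _, ?_, ?_, by simp⟩
      · simp only
        rw [Function.update_of_ne (by omega), h4]
      · simp only
        rw [Function.update_of_ne (by omega), h5, Finset.sum_range_succ, if_neg h8, add_zero]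
  · rintro w ⟨h3, h4, h5, h6⟩
    refine Exec.set ⟨h3.update le_rfl _, ?_⟩
    simp only [MvPolynomial.eval_X, Function.update_self]
    rw [h5]

/-- Structural induction. Sums and iterations repeat a program polynomially often in `N`, and the
expression is fixed, so the time bounds combine to one polynomial. -/
theorem Ex.evaluates {m : Mode} (e : Ex m) (d : ℕ) :
    Evaluates m d (e.cmd d) fun N z ρ M => e.eval N z ρ M := by
  induction e generalizing d with
  | const c => exact Evaluates.set fun N z ρ M x h => by simp [Ex.eval]
  | idx v => exact Evaluates.set fun N z ρ M x h => by simp [Ex.eval, h.var]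
  | get a iha => exact (iha d).get
  | mat u v =>
    refine ⟨1 + (1 + (6 + ((Polynomial.X * Polynomial.X * ((8 + 1 + 3 : ℕ) : Polynomial ℕ) + 2) +
      (1 + (((8 * d + 4 : ℕ) : Polynomial ℕ) + 1))))), fun N z ρ M s hs => ?_⟩
    rw [Polynomial.eval_add, Polynomial.eval_one]
    refine Exec.seq (Exec.set ?_)
    refine (Exec.fetch (k := ρ u * N + ρ v) ?_ (by omega) (by omega) ?_).mono
      (T := 1 + (6 + (((ρ u * N + ρ v) * (8 + 1 + 3) + 2) + (1 + ((8 * d + 4) + 1))))) ?_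
      (fun _ h => h)
    · simp [hs.var, hs.len]
    · intro r w
      refine ⟨(((Keeps.refl _ _ _).update (by omega) _).update (by omega) _).update le_rfl _, ?_⟩
      simp only [Function.update_self, Ex.eval]
      rw [Function.update_of_ne (by omega), ← hs.mat rfl _ (hs.lt u) _ (hs.lt v), add_comm]
    · have := (flat_lt (hs.lt u) (hs.lt v)).le
      simp only [Polynomial.eval_add, Polynomial.eval_mul, Polynomial.eval_one,
        Polynomial.eval_natCast, Polynomial.eval_X, Polynomial.eval_ofNat, Nat.cast_id]
      gcongr
  | add a b iha ihb =>
    refine (iha d).binary (ihb (d + 1)) (T := 1) fun N z ρ M s h1 h2 => Exec.set ?_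
    simp only [map_add, MvPolynomial.eval_X, h1, h2, Ex.eval]
  | mul a b iha ihb =>
    refine (iha d).binary (ihb (d + 1)) (T := 1) fun N z ρ M s h1 h2 => Exec.set ?_
    simp only [map_mul, MvPolynomial.eval_X, h1, h2, Ex.eval]
  -- The machine gets stuck on a division by zero, whereas the value of the expression is then zero.
  -- The test `-(b * b) ≥ 0` detects this case.
  | div a b iha ihb =>
    refine (iha d).binary (ihb (d + 1)) (T := 1 + 2) fun N z ρ M s h1 h2 => Exec.ite ?_ ?_
    · intro h
      simp only [map_neg, map_mul, MvPolynomial.eval_X, h2] at h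
      have h0 : b.eval N z ρ M = 0 := mul_self_eq_zero.mp (le_antisymm (by linarith)
        (mul_self_nonneg _))
      refine Exec.set ?_
      simp only [map_zero, Ex.eval, h0, div_zero]
    · intro h
      simp only [map_neg, map_mul, MvPolynomial.eval_X, h2] at h
      have h0 : b.eval N z ρ M ≠ 0 := by
        rintro h0
        simp [h0] at h
      refine Exec.comp (by rwa [MvPolynomial.eval_X, h2]) ?_
      simp only [MvPolynomial.eval_X, Ex.eval, h1, h2]
  | ite a b c iha ihb ihc =>
    exact (iha d).ite (ihb d) (ihc d) (fun N z ρ M h => by simp [Ex.eval, h])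
      (fun N z ρ M h => by simp [Ex.eval, not_le.mpr h])
  | sum v a iha => exact (iha (d + 2)).sum
  | iter init body out ih1 ih2 ih3 => exact (ih1 (d + 3)).iter (ih2 (d + 3)) (ih3 d)

/-- A decision problem whose yes-instances are those on which an expression is nonnegative is
solvable in polynomial time. -/
theorem InP.of_ex (e : Ex .outer) {X Yes : Set (List ℝ)} (hX : ∀ x ∈ X, x ≠ [])
    (h : ∀ x ∈ X, (x ∈ Yes ↔ 0 ≤ e.eval x.length (fun k => x.getD k 0) 0 0)) : InP X Yes := by
  obtain ⟨p, hp⟩ := (Ex.ite e (.const 1) (.const 0)).evaluates 0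
  -- Register `4` is scratch register `0`, where the answer `1` or `0` of the expression is left.
  refine ⟨(Cmd.seq ((Ex.ite e (.const 1) (.const 0)).cmd 0) (.set 0 (MvPolynomial.X 4))).code 0,
    p + 1, fun x hx => ?_⟩
  have key : ∀ a : ℝ, (if 0 ≤ e.eval x.length (fun k => x.getD k 0) 0 0 then (1 : ℝ) else 0) = a →
      HaltsWith ((Cmd.seq ((Ex.ite e (.const 1) (.const 0)).cmd 0)
        (.set 0 (MvPolynomial.X 4))).code 0) x ((p + 1).eval x.length) a := by
    intro a ha
    refine Exec.haltsWith ?_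
    rw [Polynomial.eval_add, Polynomial.eval_one]
    refine Exec.seq ((hp x.length (fun k => x.getD k 0) 0 0 _ ?_).mono le_rfl ?_)
    · refine ⟨by simp [init], ?_, ?_, ?_, by simp⟩
      · intro k
        have h1 : (2 * k + 1) % 2 = 1 := by omega
        have h2 : (2 * k + 1) / 2 = k := by omega
        simp [init, h2]
      · intro v
        have h1 : (8 * v + 2) % 2 = 0 := by omega
        simp [init, h1]
      -- All index variables start at zero, which is a legal value because the input is not empty.
      · intro v
        exact List.length_pos_iff.mpr (hX x hx)
    · rintro s ⟨-, h2⟩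
      refine Exec.set ?_
      simp only [MvPolynomial.eval_X, Function.update_self]
      simp only [Ex.eval] at h2
      simpa using h2.trans (by convert ha)
  constructor
  · intro hy
    exact key 1 (if_pos ((h x hx).mp hy))
  · intro hy
    exact key 0 (if_neg fun h' => hy ((h x hx).mpr h'))

end BSS

/-! ### Symmetric elimination -/

namespace SDFP

/-- The value at `x` of the quadratic form with matrix `(M i j)`, where `i, j < d`. -/
def qf (d : ℕ) (M : ℕ → ℕ → ℝ) (x : ℕ → ℝ) : ℝ :=
  ∑ i ∈ Finset.range d, ∑ j ∈ Finset.range d, M i j * x i * x j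

/-- The Schur complement of the entry in position `(0, 0)`. -/
noncomputable def schur (M : ℕ → ℕ → ℝ) (i j : ℕ) : ℝ :=
  M (i + 1) (j + 1) - M (i + 1) 0 * M 0 (j + 1) / M 0 0

def SymmOn (d : ℕ) (M : ℕ → ℕ → ℝ) : Prop := ∀ i < d, ∀ j < d, M i j = M j i

/-- The vector with first entry `s` followed by `y`. -/
def consVec (s : ℝ) (y : ℕ → ℝ) : ℕ → ℝ
  | 0 => s
  | i + 1 => y i

theorem SymmOn.schur {d : ℕ} {M : ℕ → ℕ → ℝ} (h : SymmOn (d + 1) M) : SymmOn d (schur M) := by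
  intro i hi j hj
  unfold SDFP.schur
  rw [h (i + 1) (by omega) (j + 1) (by omega), h (i + 1) (by omega) 0 (by omega),
    h 0 (by omega) (j + 1) (by omega), mul_comm (M 0 (i + 1))]

theorem qf_succ {d : ℕ} {M : ℕ → ℕ → ℝ} (h : SymmOn (d + 1) M) (x : ℕ → ℝ) :
    qf (d + 1) M x = M 0 0 * x 0 ^ 2 +
      2 * x 0 * ∑ j ∈ Finset.range d, M 0 (j + 1) * x (j + 1) +
      qf d (fun i j => M (i + 1) (j + 1)) fun i => x (i + 1) := by
  unfold qf
  rw [Finset.sum_range_succ']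
  simp only [Finset.sum_range_succ' _ d, Finset.sum_add_distrib]
  have h1 : ∑ i ∈ Finset.range d, M (i + 1) 0 * x (i + 1) * x 0 =
      x 0 * ∑ j ∈ Finset.range d, M 0 (j + 1) * x (j + 1) := by
    rw [Finset.mul_sum]
    refine Finset.sum_congr rfl fun i hi => ?_
    rw [Finset.mem_range] at hi
    rw [h (i + 1) (by omega) 0 (by omega)]
    ring
  have h2 : ∑ j ∈ Finset.range d, M 0 (j + 1) * x 0 * x (j + 1) =
      x 0 * ∑ j ∈ Finset.range d, M 0 (j + 1) * x (j + 1) := by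
    rw [Finset.mul_sum]
    exact Finset.sum_congr rfl fun i _ => by ring
  rw [h1, h2]
  ring

theorem qf_schur {d : ℕ} {M : ℕ → ℕ → ℝ} (h : SymmOn (d + 1) M) (y : ℕ → ℝ) :
    qf d (schur M) y = qf d (fun i j => M (i + 1) (j + 1)) y -
      (∑ j ∈ Finset.range d, M 0 (j + 1) * y j) ^ 2 / M 0 0 := by
  unfold qf schur
  rw [sq, Finset.sum_mul_sum, Finset.sum_div, ← Finset.sum_sub_distrib]
  refine Finset.sum_congr rfl fun i hi => ?_
  rw [Finset.sum_div, ← Finset.sum_sub_distrib]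
  refine Finset.sum_congr rfl fun j _ => ?_
  rw [Finset.mem_range] at hi
  rw [h (i + 1) (by omega) 0 (by omega)]
  ring

/-- Completion of the square in the first variable. -/
theorem qf_eq_schur {d : ℕ} {M : ℕ → ℕ → ℝ} (h : SymmOn (d + 1) M) (h0 : M 0 0 ≠ 0)
    (x : ℕ → ℝ) : qf (d + 1) M x =
      M 0 0 * (x 0 + (∑ j ∈ Finset.range d, M 0 (j + 1) * x (j + 1)) / M 0 0) ^ 2 +
      qf d (schur M) fun i => x (i + 1) := by
  rw [qf_succ h, qf_schur h]
  field_simp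
  ring

/-- Division by the zero pivot yields zero, so the Schur complement is the trailing block, and the
first variable does not occur in the form. -/
theorem qf_eq_schur_of_zero {d : ℕ} {M : ℕ → ℕ → ℝ} (h : SymmOn (d + 1) M) (h0 : M 0 0 = 0)
    (hr : ∀ j < d + 1, M 0 j = 0) (x : ℕ → ℝ) :
    qf (d + 1) M x = qf d (schur M) fun i => x (i + 1) := by
  have : ∀ y : ℕ → ℝ, ∑ j ∈ Finset.range d, M 0 (j + 1) * y j = 0 := fun y =>
    Finset.sum_eq_zero fun j hj => by
      rw [Finset.mem_range] at hj
      rw [hr _ (by omega), zero_mul]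
  rw [qf_succ h, qf_schur h, this (fun j => x (j + 1)), h0]
  simp

def QfNonneg (d : ℕ) (M : ℕ → ℕ → ℝ) : Prop := ∀ x, 0 ≤ qf d M x

def QfPos (d : ℕ) (M : ℕ → ℕ → ℝ) : Prop := ∀ x, (∃ i < d, x i ≠ 0) → 0 < qf d M x

/-- With a positive pivot, the first variable can be chosen to make the completed square vanish, so
only the Schur complement matters. With a zero pivot the form is affine in the first variable, so
its first row must vanish. This row condition replaces pivoting and cannot be dropped: for the rows
`(0, 1)`, `(1, 0)` both pivots are zero, yet the form is indefinite. -/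
theorem qfNonneg_succ {d : ℕ} {M : ℕ → ℕ → ℝ} (h : SymmOn (d + 1) M) :
    QfNonneg (d + 1) M ↔
      (0 ≤ M 0 0 ∧ (M 0 0 = 0 → ∀ j < d + 1, M 0 j = 0)) ∧ QfNonneg d (schur M) := by
  constructor
  · intro hM
    have h0 : 0 ≤ M 0 0 := by
      have := hM (consVec 1 0)
      rw [qf_succ h] at this
      simpa [consVec, qf] using this
    have hr : M 0 0 = 0 → ∀ j < d + 1, M 0 j = 0 := by
      intro hz j hj
      cases j with
      | zero => exact hz
      | succ j =>
        by_contra hne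
        set q := qf d (fun i j => M (i + 1) (j + 1)) (Pi.single j 1) with hq
        -- With first coordinate `s` the form is `2 s M 0 (j + 1) + q`; this `s` makes it `-1`.
        have := hM (consVec (-(q + 1) / (2 * M 0 (j + 1))) (Pi.single j 1))
        rw [qf_succ h] at this
        have hs : ∑ i ∈ Finset.range d, M 0 (i + 1) * (Pi.single j 1 : ℕ → ℝ) i = M 0 (j + 1) := by
          rw [Finset.sum_eq_single j]
          · simp
          · intro b _ hb
            simp [hb]
          · intro hj'
            simp at hj'
            omega
        simp only [consVec, hz, hs, ← hq] at this
        have h2 : 2 * (-(q + 1) / (2 * M 0 (j + 1))) * M 0 (j + 1) = -(q + 1) := by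
          field_simp
        rw [h2] at this
        linarith
    refine ⟨⟨h0, hr⟩, fun y => ?_⟩
    by_cases hz : M 0 0 = 0
    · have := hM (consVec 0 y)
      rwa [qf_eq_schur_of_zero h hz (hr hz)] at this
    -- The first coordinate annihilates the completed square.
    · have := hM (consVec (-((∑ j ∈ Finset.range d, M 0 (j + 1) * y j) / M 0 0)) y)
      rw [qf_eq_schur h hz] at this
      simpa [consVec] using this
  · rintro ⟨⟨h0, hr⟩, hS⟩ x
    by_cases hz : M 0 0 = 0
    · rw [qf_eq_schur_of_zero h hz (hr hz)]
      exact hS _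
    · rw [qf_eq_schur h hz]
      have := hS fun i => x (i + 1)
      positivity

theorem qfPos_succ {d : ℕ} {M : ℕ → ℕ → ℝ} (h : SymmOn (d + 1) M) :
    QfPos (d + 1) M ↔ 0 < M 0 0 ∧ QfPos d (schur M) := by
  constructor
  · intro hM
    have h0 : 0 < M 0 0 := by
      have := hM (consVec 1 0) ⟨0, by omega, by simp [consVec]⟩
      rw [qf_succ h] at this
      simpa [consVec, qf] using this
    refine ⟨h0, fun y ⟨i, hi, hy⟩ => ?_⟩
    have := hM (consVec (-((∑ j ∈ Finset.range d, M 0 (j + 1) * y j) / M 0 0)) y)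
      ⟨i + 1, by omega, hy⟩
    rw [qf_eq_schur h h0.ne'] at this
    simpa [consVec] using this
  · rintro ⟨h0, hS⟩ x ⟨i, hi, hx⟩
    rw [qf_eq_schur h h0.ne']
    by_cases ht : ∃ i < d, x (i + 1) ≠ 0
    · have := hS (fun i => x (i + 1)) ht
      positivity
    · push Not at ht
      have hs : ∑ j ∈ Finset.range d, M 0 (j + 1) * x (j + 1) = 0 :=
        Finset.sum_eq_zero fun j hj => by rw [ht j (Finset.mem_range.mp hj), mul_zero]
      have hq : qf d (schur M) (fun i => x (i + 1)) = 0 :=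
        Finset.sum_eq_zero fun j hj => Finset.sum_eq_zero fun j' _ => by
          simp only [ht j (Finset.mem_range.mp hj)]; ring
      have hx0 : x 0 ≠ 0 := by
        cases i with
        | zero => exact hx
        | succ i => exact absurd (ht i (by omega)) hx
      rw [hs, hq]
      simp only [zero_div, add_zero]
      positivity

theorem qfNonneg_iff_pivots {d : ℕ} {M : ℕ → ℕ → ℝ} (h : SymmOn d M) :
    QfNonneg d M ↔ ∀ t < d, 0 ≤ (schur^[t] M) 0 0 ∧
      ((schur^[t] M) 0 0 = 0 → ∀ j < d - t, (schur^[t] M) 0 j = 0) := by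
  induction d generalizing M with
  | zero => simp [QfNonneg, qf]
  | succ d ih =>
    rw [qfNonneg_succ h, ih h.schur, Nat.forall_lt_succ_left (p := fun t =>
      0 ≤ (schur^[t] M) 0 0 ∧ ((schur^[t] M) 0 0 = 0 → ∀ j < d + 1 - t, (schur^[t] M) 0 j = 0))]
    simp only [Function.iterate_zero, id, Function.iterate_succ, Function.comp, Nat.sub_zero,
      Nat.add_sub_add_right]

theorem qfPos_iff_pivots {d : ℕ} {M : ℕ → ℕ → ℝ} (h : SymmOn d M) :
    QfPos d M ↔ ∀ t < d, 0 < (schur^[t] M) 0 0 := by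
  induction d generalizing M with
  | zero => simp [QfPos]
  | succ d ih =>
    rw [qfPos_succ h, ih h.schur, Nat.forall_lt_succ_left]
    simp only [Function.iterate_zero, id, Function.iterate_succ, Function.comp]

/-- Each elimination step splits off a nonnegative square that a suitable first coordinate makes
zero, so a zero of the form with last coordinate `1` survives every step in both directions. What
remains is the last pivot times `1`. -/
theorem exists_qf_eq_zero_iff {d : ℕ} {M : ℕ → ℕ → ℝ} (h : SymmOn (d + 1) M)
    (hM : QfNonneg (d + 1) M) :
    (∃ x : ℕ → ℝ, x d = 1 ∧ qf (d + 1) M x = 0) ↔ (schur^[d] M) 0 0 = 0 := by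
  induction d generalizing M with
  | zero =>
    constructor
    · rintro ⟨x, hx, hq⟩
      simpa [qf, hx] using hq
    · intro h0
      exact ⟨fun _ => 1, rfl, by simpa [qf] using h0⟩
  | succ d ih =>
    obtain ⟨⟨h0, hr⟩, hS⟩ := (qfNonneg_succ h).mp hM
    rw [Function.iterate_succ, Function.comp, ← ih h.schur hS]
    by_cases hz : M 0 0 = 0
    · constructor
      · rintro ⟨x, hx, hq⟩
        exact ⟨fun i => x (i + 1), hx, by rwa [qf_eq_schur_of_zero h hz (hr hz)] at hq⟩
      · rintro ⟨y, hy, hq⟩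
        exact ⟨consVec 0 y, hy, by rwa [qf_eq_schur_of_zero h hz (hr hz)]⟩
    · constructor
      · rintro ⟨x, hx, hq⟩
        refine ⟨fun i => x (i + 1), hx, ?_⟩
        rw [qf_eq_schur h hz] at hq
        have h1 := hS fun i => x (i + 1)
        refine le_antisymm ?_ h1
        have : 0 ≤ M 0 0 *
          (x 0 + (∑ j ∈ Finset.range (d + 1), M 0 (j + 1) * x (j + 1)) / M 0 0) ^ 2 := by
          positivity
        linarith
      · rintro ⟨y, hy, hq⟩
        refine ⟨consVec (-((∑ j ∈ Finset.range (d + 1), M 0 (j + 1) * y j) / M 0 0)) y, hy, ?_⟩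
        rw [qf_eq_schur h hz]
        simpa [consVec] using hq

/-- The matrix after `t` steps of symmetric elimination in place. -/
noncomputable def elim (M : ℕ → ℕ → ℝ) : ℕ → ℕ → ℕ → ℝ
  | 0 => M
  | t + 1 => fun i j => if t < i ∧ t < j then
      elim M t i j - elim M t i t * elim M t t j / elim M t t t else elim M t i j

theorem elim_eq_schur (M : ℕ → ℕ → ℝ) (t i j : ℕ) :
    elim M t (t + i) (t + j) = (schur^[t] M) i j := by
  induction t generalizing i j with
  | zero => simp [elim]
  | succ t ih =>
    simp only [elim]
    rw [if_pos (by omega), Function.iterate_succ', Function.comp, schur, ← ih, ← ih, ← ih,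
      ← ih]
    simp only [add_zero, add_comm, add_left_comm]

/-- From step `i` on, row `i` is never modified again. All pivots and pivot rows can therefore be
read off the upper triangle of the final matrix, and running `N` steps instead of `d` does no harm.
-/
theorem elim_of_le (M : ℕ → ℕ → ℝ) {i j N : ℕ} (hij : i ≤ j) (hi : i ≤ N) :
    elim M N i j = (schur^[i] M) 0 (j - i) := by
  induction N, hi using Nat.le_induction with
  | base =>
    rw [← elim_eq_schur, add_zero, Nat.add_sub_cancel' hij]
  | succ N hN ih =>
    simp only [elim]
    rw [if_neg (by omega), ih]

theorem qfNonneg_iff_elim {d N : ℕ} {M : ℕ → ℕ → ℝ} (h : SymmOn d M) (hd : d ≤ N) :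
    QfNonneg d M ↔ ∀ t < d, ∀ j < d, t ≤ j → 0 ≤ elim M N t t ∧
      (elim M N t t = 0 → elim M N t j = 0) := by
  rw [qfNonneg_iff_pivots h]
  refine forall₂_congr fun t ht => ?_
  rw [elim_of_le M le_rfl (by omega), Nat.sub_self]
  constructor
  · intro h1 j hj htj
    rw [elim_of_le M htj (by omega)]
    exact ⟨h1.1, fun h2 => h1.2 h2 _ (by omega)⟩
  · intro h1
    refine ⟨(h1 t ht le_rfl).1, fun h2 j hj => ?_⟩
    have := (h1 (t + j) (by omega) (by omega)).2 h2
    rwa [elim_of_le M (by omega) (by omega), Nat.add_sub_cancel_left] at this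

theorem qfPos_iff_elim {d N : ℕ} {M : ℕ → ℕ → ℝ} (h : SymmOn d M) (hd : d ≤ N) :
    QfPos d M ↔ ∀ t < d, 0 < elim M N t t := by
  rw [qfPos_iff_pivots h]
  refine forall₂_congr fun t ht => ?_
  rw [elim_of_le M le_rfl (by omega), Nat.sub_self]

/-- The matrix of inner products of vectors `f 0, f 1, …` with coordinates in a finite set. -/
def gram {ι : Type*} (s : Finset ι) (f : ℕ → ι → ℝ) (k l : ℕ) : ℝ := ∑ c ∈ s, f k c * f l c

/-- The form of a Gram matrix is a squared norm, so it is nonnegative and its zeros are exactly the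
linear relations between the vectors. -/
theorem qf_gram {ι : Type*} (s : Finset ι) (f : ℕ → ι → ℝ) (d : ℕ) (x : ℕ → ℝ) :
    qf d (gram s f) x = ∑ c ∈ s, (∑ k ∈ Finset.range d, x k * f k c) ^ 2 := by
  have h1 : ∀ c ∈ s, (∑ k ∈ Finset.range d, x k * f k c) ^ 2 =
      ∑ i ∈ Finset.range d, ∑ j ∈ Finset.range d, f i c * f j c * x i * x j := by
    intro c _
    rw [sq, Finset.sum_mul_sum]
    exact Finset.sum_congr rfl fun i _ => Finset.sum_congr rfl fun j _ => by ring
  rw [Finset.sum_congr rfl h1, Finset.sum_comm]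
  refine Finset.sum_congr rfl fun i _ => ?_
  rw [Finset.sum_comm]
  refine Finset.sum_congr rfl fun j _ => ?_
  simp only [gram, Finset.sum_mul]

/-- Elimination decides whether the last of `d + 1` vectors is a combination of the others. -/
theorem elim_gram_eq_zero_iff {ι : Type*} (s : Finset ι) (f : ℕ → ι → ℝ) {d N : ℕ} (hd : d ≤ N)
    {M : ℕ → ℕ → ℝ} (hM : ∀ i ≤ d, ∀ j ≤ d, M i j = gram s f i j) :
    elim M N d d = 0 ↔ ∃ u : ℕ → ℝ, ∀ c ∈ s, ∑ k ∈ Finset.range d, u k * f k c = f d c := by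
  have hq : ∀ x, qf (d + 1) M x = ∑ c ∈ s, (∑ k ∈ Finset.range (d + 1), x k * f k c) ^ 2 := by
    intro x
    rw [← qf_gram]
    refine Finset.sum_congr rfl fun i hi => Finset.sum_congr rfl fun j hj => ?_
    rw [Finset.mem_range] at hi hj
    rw [hM i (by omega) j (by omega)]
  have hsymm : SymmOn (d + 1) M := fun i hi j hj => by
    rw [hM i (by omega) j (by omega), hM j (by omega) i (by omega)]
    exact Finset.sum_congr rfl fun c _ => mul_comm _ _
  have hnn : QfNonneg (d + 1) M := fun x => by
    rw [hq]
    exact Finset.sum_nonneg fun c _ => sq_nonneg _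
  rw [elim_of_le M le_rfl hd, Nat.sub_self, ← exists_qf_eq_zero_iff hsymm hnn]
  constructor
  · rintro ⟨x, hx, h0⟩
    rw [hq, Finset.sum_eq_zero_iff_of_nonneg fun c _ => sq_nonneg _] at h0
    refine ⟨fun k => -x k, fun c hc => ?_⟩
    have := h0 c hc
    rw [sq_eq_zero_iff, Finset.sum_range_succ, hx, one_mul] at this
    simp only [neg_mul, Finset.sum_neg_distrib]
    linarith
  · rintro ⟨u, hu⟩
    refine ⟨fun k => if k = d then 1 else -u k, by simp, ?_⟩
    rw [hq]
    refine Finset.sum_eq_zero fun c hc => ?_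
    rw [sq_eq_zero_iff, Finset.sum_range_succ, ← hu c hc]
    simp only [if_true, one_mul]
    rw [← Finset.sum_add_distrib]
    refine Finset.sum_eq_zero fun k hk => ?_
    rw [Finset.mem_range] at hk
    rw [if_neg (by omega)]
    ring

end SDFP

/-! ### The cone of positive semidefinite matrices -/

namespace SDFP

theorem Sym.transpose_val {n : ℕ} (x : Sym n) : (x.1)ᵀ = x.1 := x.2

theorem Sym.apply_comm {n : ℕ} (x : Sym n) (i j : Fin n) : x.1 i j = x.1 j i :=
  (congrFun (congrFun x.transpose_val j) i)

theorem Sym.isHermitian {n : ℕ} (x : Sym n) : x.1.IsHermitian := by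
  rw [Matrix.IsHermitian, Matrix.conjTranspose_eq_transpose_of_trivial, x.transpose_val]

theorem Sym.posDef_iff {n : ℕ} (x : Sym n) :
    x.1.PosDef ↔ ∀ v : Fin n → ℝ, v ≠ 0 → 0 < v ⬝ᵥ x.1 *ᵥ v := by
  rw [Matrix.posDef_iff_dotProduct_mulVec]
  simp only [star_trivial]
  exact ⟨fun h => fun v hv => h.2 hv, fun h => ⟨x.isHermitian, fun v hv => h v hv⟩⟩

theorem Sym.posSemidef_iff {n : ℕ} (x : Sym n) :
    x.1.PosSemidef ↔ ∀ v : Fin n → ℝ, 0 ≤ v ⬝ᵥ x.1 *ᵥ v := by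
  rw [Matrix.posSemidef_iff_dotProduct_mulVec]
  simp only [star_trivial]
  exact ⟨fun h => h.2, fun h => ⟨x.isHermitian, h⟩⟩

/-- The identity matrix. -/
def Sym.one (n : ℕ) : Sym n := ⟨1, Matrix.isSymm_one⟩

/-- The matrix `v vᵀ`. -/
def Sym.outer {n : ℕ} (v : Fin n → ℝ) : Sym n :=
  ⟨Matrix.vecMulVec v v, by
    change (Matrix.vecMulVec v v)ᵀ = _
    rw [Matrix.transpose_vecMulVec]⟩

theorem ip_eq_sum {n : ℕ} (x y : Sym n) : ip x y = ∑ i, ∑ j, x.1 i j * y.1 i j := by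
  unfold ip
  simp only [Matrix.trace, Matrix.diag, Matrix.mul_apply]
  exact Finset.sum_congr rfl fun i _ => Finset.sum_congr rfl fun j _ => by rw [y.apply_comm]

theorem ip_comm {n : ℕ} (x y : Sym n) : ip x y = ip y x := Matrix.trace_mul_comm _ _

/-- The trace inner product with `y`, as a linear functional. -/
def ipL {n : ℕ} (y : Sym n) : Sym n →ₗ[ℝ] ℝ where
  toFun x := ip y x
  map_add' a b := by simp [ip, Matrix.mul_add]
  map_smul' r a := by simp [ip]

theorem ip_add {n : ℕ} (y a b : Sym n) : ip y (a + b) = ip y a + ip y b := (ipL y).map_add a b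

theorem ip_smul {n : ℕ} (y : Sym n) (r : ℝ) (a : Sym n) : ip y (r • a) = r * ip y a :=
  (ipL y).map_smul r a

theorem ip_smul_left {n : ℕ} (y : Sym n) (r : ℝ) (a : Sym n) : ip (r • y) a = r * ip y a := by
  rw [ip_comm, ip_smul, ip_comm]

theorem ip_zero {n : ℕ} (y : Sym n) : ip y 0 = 0 := (ipL y).map_zero

theorem ip_one {n : ℕ} (y : Sym n) : ip y (Sym.one n) = y.1.trace := by
  simp [ip, Sym.one]

theorem dotProduct_mulVec_eq_sum {n : ℕ} (M : Matrix (Fin n) (Fin n) ℝ) (v : Fin n → ℝ) :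
    v ⬝ᵥ M *ᵥ v = ∑ i, ∑ j, M i j * (v i * v j) := by
  simp only [dotProduct, Matrix.mulVec, Finset.mul_sum]
  exact Finset.sum_congr rfl fun i _ => Finset.sum_congr rfl fun j _ => by ring

theorem ip_outer {n : ℕ} (y : Sym n) (v : Fin n → ℝ) : ip y (Sym.outer v) = v ⬝ᵥ y.1 *ᵥ v := by
  rw [ip_eq_sum, dotProduct_mulVec_eq_sum]
  rfl

theorem ip_self_nonneg {n : ℕ} (x : Sym n) : 0 ≤ ip x x := by
  rw [ip_eq_sum]
  exact Finset.sum_nonneg fun i _ => Finset.sum_nonneg fun j _ => mul_self_nonneg _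

/-- Cauchy–Schwarz for the entries of `x` and of `v vᵀ`. -/
theorem abs_dotProduct_mulVec_le {n : ℕ} (x : Sym n) (v : Fin n → ℝ) :
    |v ⬝ᵥ x.1 *ᵥ v| ≤ Real.sqrt (ip x x) * (v ⬝ᵥ v) := by
  have h0 : 0 ≤ v ⬝ᵥ v := Finset.sum_nonneg fun i _ => mul_self_nonneg _
  have h1 : (v ⬝ᵥ x.1 *ᵥ v) ^ 2 ≤ ip x x * (v ⬝ᵥ v) ^ 2 := by
    have := Finset.sum_mul_sq_le_sq_mul_sq (Finset.univ ×ˢ Finset.univ)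
      (fun p : Fin n × Fin n => x.1 p.1 p.2) (fun p => v p.1 * v p.2)
    rw [Finset.sum_product, Finset.sum_product, Finset.sum_product] at this
    have e1 : ip x x = ∑ i, ∑ j, x.1 i j ^ 2 := by
      rw [ip_eq_sum]
      exact Finset.sum_congr rfl fun i _ => Finset.sum_congr rfl fun j _ => (sq _).symm
    have e2 : (v ⬝ᵥ v) ^ 2 = ∑ i, ∑ j, (v i * v j) ^ 2 := by
      rw [sq, dotProduct, Finset.sum_mul_sum]
      exact Finset.sum_congr rfl fun i _ => Finset.sum_congr rfl fun j _ => by ring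
    rw [dotProduct_mulVec_eq_sum, e1, e2]
    exact this
  rw [← Real.sqrt_sq h0, ← Real.sqrt_mul (ip_self_nonneg x)]
  exact Real.abs_le_sqrt h1

theorem dotProduct_self_pos {n : ℕ} {v : Fin n → ℝ} (hv : v ≠ 0) : 0 < v ⬝ᵥ v := by
  have := dotProduct_self_eq_zero (v := v)
  exact lt_of_le_of_ne (Finset.sum_nonneg fun i _ => mul_self_nonneg _)
    (fun h => hv (this.mp h.symm))

/-- The sphere is Euclidean while the function space carries the supremum norm, so closedness and
boundedness are checked by hand. -/
theorem isCompact_unitSphere (n : ℕ) : IsCompact {v : Fin n → ℝ | v ⬝ᵥ v = 1} := by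
  refine Metric.isCompact_of_isClosed_isBounded
    (isClosed_eq (by unfold dotProduct; fun_prop) continuous_const) ?_
  refine (Metric.isBounded_closedBall (x := (0 : Fin n → ℝ)) (r := 1)).subset fun v hv => ?_
  rw [mem_closedBall_zero_iff, pi_norm_le_iff_of_nonneg zero_le_one]
  intro i
  have h1 : v i * v i ≤ 1 := by
    rw [← show v ⬝ᵥ v = 1 from hv]
    exact Finset.single_le_sum (f := fun i => v i * v i) (fun i _ => mul_self_nonneg _)
      (Finset.mem_univ i)
  rw [Real.norm_eq_abs]
  exact abs_le_one_iff_mul_self_le_one.mpr h1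

theorem continuous_quadForm {n : ℕ} (M : Matrix (Fin n) (Fin n) ℝ) :
    Continuous fun v : Fin n → ℝ => v ⬝ᵥ M *ᵥ v := by
  simp only [dotProduct_mulVec_eq_sum]
  fun_prop

theorem quadForm_smul {n : ℕ} (M : Matrix (Fin n) (Fin n) ℝ) (r : ℝ) (v : Fin n → ℝ) :
    (r • v) ⬝ᵥ M *ᵥ (r • v) = r ^ 2 * (v ⬝ᵥ M *ᵥ v) := by
  rw [Matrix.mulVec_smul, dotProduct_smul, smul_dotProduct, smul_eq_mul, smul_eq_mul]
  ring

/-- A bound for a quadratic form on the unit sphere holds, scaled, everywhere. -/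
theorem quadForm_ge_of_unit {n : ℕ} {M : Matrix (Fin n) (Fin n) ℝ} {δ : ℝ}
    (h : ∀ v : Fin n → ℝ, v ⬝ᵥ v = 1 → δ ≤ v ⬝ᵥ M *ᵥ v) (v : Fin n → ℝ) :
    δ * (v ⬝ᵥ v) ≤ v ⬝ᵥ M *ᵥ v := by
  by_cases hv : v = 0
  · simp [hv]
  have hp := dotProduct_self_pos hv
  set s := Real.sqrt (v ⬝ᵥ v) with hs
  have hs2 : s ^ 2 = v ⬝ᵥ v := Real.sq_sqrt hp.le
  have hs0 : 0 < s := Real.sqrt_pos.mpr hp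
  have h1 : (s⁻¹ • v) ⬝ᵥ (s⁻¹ • v) = 1 := by
    rw [dotProduct_smul, smul_dotProduct, smul_eq_mul, smul_eq_mul, ← hs2]
    field_simp
  have h2 := h _ h1
  rw [quadForm_smul] at h2
  rw [← hs2]
  calc δ * s ^ 2 ≤ (s⁻¹ ^ 2 * (v ⬝ᵥ M *ᵥ v)) * s ^ 2 := by gcongr
    _ = v ⬝ᵥ M *ᵥ v := by field_simp

/-- The bound `δ` is the minimum of the form on the unit sphere. The sphere is empty when `n = 0`,
and then any positive `δ` will do. -/
theorem PosDef_exists_lower_bound {n : ℕ} {x : Sym n} (hx : x.1.PosDef) :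
    ∃ δ > 0, ∀ v : Fin n → ℝ, δ * (v ⬝ᵥ v) ≤ v ⬝ᵥ x.1 *ᵥ v := by
  rw [Sym.posDef_iff] at hx
  by_cases hne : {v : Fin n → ℝ | v ⬝ᵥ v = 1}.Nonempty
  · obtain ⟨u, hu, hmin⟩ := (isCompact_unitSphere n).exists_isMinOn hne
      (continuous_quadForm x.1).continuousOn
    refine ⟨u ⬝ᵥ x.1 *ᵥ u, hx u ?_, quadForm_ge_of_unit fun v hv => hmin hv⟩
    rintro rfl
    simp at hu
  · exact ⟨1, one_pos, quadForm_ge_of_unit fun v hv => absurd ⟨v, hv⟩ hne⟩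

theorem quadForm_add {n : ℕ} (M M' : Matrix (Fin n) (Fin n) ℝ) (v : Fin n → ℝ) :
    v ⬝ᵥ (M + M') *ᵥ v = v ⬝ᵥ M *ᵥ v + v ⬝ᵥ M' *ᵥ v := by
  rw [Matrix.add_mulVec, dotProduct_add]

theorem quadForm_sub {n : ℕ} (M M' : Matrix (Fin n) (Fin n) ℝ) (v : Fin n → ℝ) :
    v ⬝ᵥ (M - M') *ᵥ v = v ⬝ᵥ M *ᵥ v - v ⬝ᵥ M' *ᵥ v := by
  rw [Matrix.sub_mulVec, dotProduct_sub]

theorem quadForm_smul_left {n : ℕ} (r : ℝ) (M : Matrix (Fin n) (Fin n) ℝ) (v : Fin n → ℝ) :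
    v ⬝ᵥ (r • M) *ᵥ v = r * (v ⬝ᵥ M *ᵥ v) := by
  rw [Matrix.smul_mulVec, dotProduct_smul, smul_eq_mul]

theorem quadForm_one {n : ℕ} (v : Fin n → ℝ) :
    v ⬝ᵥ (1 : Matrix (Fin n) (Fin n) ℝ) *ᵥ v = v ⬝ᵥ v := by
  rw [Matrix.one_mulVec]

/-- A matrix close to one that is bounded below by `δ` is positive definite. -/
theorem posDef_of_close {n : ℕ} {x y : Sym n} {δ : ℝ}
    (hx : ∀ v : Fin n → ℝ, δ * (v ⬝ᵥ v) ≤ v ⬝ᵥ x.1 *ᵥ v)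
    (hxy : Real.sqrt (ip (x - y) (x - y)) < δ) : y.1.PosDef := by
  rw [Sym.posDef_iff]
  intro v hv
  have h1 := (abs_le.mp (abs_dotProduct_mulVec_le (x - y) v)).2
  have h2 : v ⬝ᵥ (x - y).1 *ᵥ v = v ⬝ᵥ x.1 *ᵥ v - v ⬝ᵥ y.1 *ᵥ v := quadForm_sub _ _ _
  have h3 := hx v
  have h4 := mul_lt_mul_of_pos_right hxy (dotProduct_self_pos hv)
  linarith

theorem continuous_ip {n : ℕ} {X : Type*} [TopologicalSpace X] {f g : X → Sym n}
    (hf : Continuous f) (hg : Continuous g) : Continuous fun t => ip (f t) (g t) := by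
  simp only [ip_eq_sum]
  refine continuous_finsetSum _ fun i _ => continuous_finsetSum _ fun j _ => ?_
  exact ((continuous_subtype_val.comp hf).matrix_elem i j).mul
    ((continuous_subtype_val.comp hg).matrix_elem i j)

theorem isOpen_posDef (n : ℕ) : IsOpen {x : Sym n | x.1.PosDef} := by
  rw [isOpen_iff_mem_nhds]
  intro x hx
  obtain ⟨δ, hδ, hb⟩ := PosDef_exists_lower_bound hx
  have hc : Continuous fun y : Sym n => Real.sqrt (ip (x - y) (x - y)) :=
    (continuous_ip (continuous_const.sub continuous_id)
      (continuous_const.sub continuous_id)).sqrt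
  have h0 : Real.sqrt (ip (x - x) (x - x)) < δ := by simpa [ip] using hδ
  filter_upwards [hc.continuousAt.eventually_lt continuousAt_const h0] with y hy
  exact posDef_of_close hb hy

/-- Positive definiteness is an open condition by the lower bound on the form. Conversely, an
interior point stays semidefinite after a small positive multiple of the identity is subtracted,
which leaves room for strict positivity. -/
theorem interior_K (n : ℕ) : interior (K n) = {x | x.1.PosDef} := by
  refine Set.Subset.antisymm (fun x hx => ?_)
    (interior_maximal (fun x hx => Matrix.PosDef.posSemidef hx) (isOpen_posDef n))
  have hc : Continuous fun t : ℝ => x - t • Sym.one n := by fun_prop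
  have h0 : ∀ᶠ t in nhds (0 : ℝ), x - t • Sym.one n ∈ K n := by
    refine hc.continuousAt.eventually ?_
    simpa using mem_interior_iff_mem_nhds.mp hx
  obtain ⟨t, ht, h1⟩ := (Metric.eventually_nhds_iff.mp h0)
  have h2 := h1 (y := t / 2) (by
    rw [Real.dist_eq, sub_zero, abs_of_pos (by linarith)]
    linarith)
  have h3 := (Sym.posSemidef_iff _).mp h2
  refine (Sym.posDef_iff x).mpr fun v hv => ?_
  have h4 := h3 v
  have h5 : v ⬝ᵥ (x - (t / 2) • Sym.one n).1 *ᵥ v = v ⬝ᵥ x.1 *ᵥ v - t / 2 * (v ⬝ᵥ v) := by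
    have : (x - (t / 2) • Sym.one n).1 = x.1 - (t / 2) • (1 : Matrix (Fin n) (Fin n) ℝ) := rfl
    rw [this, quadForm_sub, quadForm_smul_left, quadForm_one]
  have := dotProduct_self_pos hv
  have h6 : 0 < t / 2 * (v ⬝ᵥ v) := by positivity
  linarith

theorem mem_interior_K {n : ℕ} {x : Sym n} : x ∈ interior (K n) ↔ x.1.PosDef := by
  rw [interior_K]; rfl

/-! ### Feasibility after arbitrarily small perturbation -/

theorem stronglyFeasible_iff {n : ℕ} {L : Submodule ℝ (Sym n)} {c : Sym n} :
    StronglyFeasible L c ↔ ∃ l ∈ L, (l + c).1.PosDef := by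
  constructor
  · rintro ⟨x, ⟨l, hl, rfl⟩, hx⟩
    exact ⟨l, hl, mem_interior_K.mp hx⟩
  · rintro ⟨l, hl, h⟩
    exact ⟨_, ⟨l, hl, rfl⟩, mem_interior_K.mpr h⟩

/-- Every perturbation of `c` by a positive multiple of the identity is strongly feasible. -/
def AlmostFeasible {n : ℕ} (L : Submodule ℝ (Sym n)) (c : Sym n) : Prop :=
  ∀ ε : ℝ, 0 < ε → StronglyFeasible L (c + ε • Sym.one n)

theorem almostFeasible_of_feasible {n : ℕ} {L : Submodule ℝ (Sym n)} {c : Sym n}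
    (h : (aff L c ∩ K n).Nonempty) : AlmostFeasible L c := by
  obtain ⟨x, ⟨l, hl, rfl⟩, hx⟩ := h
  intro ε hε
  refine stronglyFeasible_iff.mpr ⟨l, hl, ?_⟩
  rw [← add_assoc]
  exact Matrix.PosDef.posSemidef_add hx (Matrix.PosDef.one.smul hε)

theorem setDist_nonneg {n : ℕ} (C D : Set (Sym n)) : 0 ≤ setDist C D :=
  Real.sInf_nonneg (by rintro r ⟨x, -, y, -, rfl⟩; exact Real.sqrt_nonneg _)

theorem ip_one_self {n : ℕ} : ip (Sym.one n) (Sym.one n) = n := by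
  rw [ip_one]; simp [Sym.one]

/-- A matrix closer than `ε` to a semidefinite one becomes positive definite when `ε I` is added. In
the other direction, a positive definite point of `L + c + ε I` is semidefinite and has distance `ε
√n` from the corresponding point of `L + c`. -/
theorem setDist_eq_zero_iff {n : ℕ} {L : Submodule ℝ (Sym n)} {c : Sym n} :
    setDist (K n) (aff L c) = 0 ↔ AlmostFeasible L c := by
  constructor
  · intro h ε hε
    have hne : {r | ∃ x ∈ K n, ∃ y ∈ aff L c, r = Real.sqrt (ip (x - y) (x - y))}.Nonempty :=
      ⟨_, 0, Matrix.PosSemidef.zero, c, ⟨0, L.zero_mem, by simp⟩, rfl⟩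
    obtain ⟨r, ⟨x, hx, y, ⟨l, hl, rfl⟩, rfl⟩, hr⟩ :=
      Real.lt_sInf_add_pos hne hε
    change _ < setDist (K n) (aff L c) + ε at hr
    rw [h, zero_add] at hr
    refine stronglyFeasible_iff.mpr ⟨l, hl, ?_⟩
    refine posDef_of_close (x := x + ε • Sym.one n) (δ := ε) (fun v => ?_) ?_
    · have h1 := (Sym.posSemidef_iff x).mp hx v
      have h2 : (x + ε • Sym.one n).1 = x.1 + ε • (1 : Matrix (Fin n) (Fin n) ℝ) := rfl
      rw [h2, quadForm_add, quadForm_smul_left, quadForm_one]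
      linarith
    · have h3 : x + ε • Sym.one n - (l + (c + ε • Sym.one n)) = x - (l + c) := by abel
      rwa [h3]
  · intro h
    refine le_antisymm (le_of_forall_pos_le_add fun ε hε => ?_) (setDist_nonneg _ _)
    -- The norm of the identity is `√n ≤ n + 1`, so this multiple of it has norm at most `ε`.
    have hpos : 0 < ε / (n + 1) := by positivity
    obtain ⟨l, hl, hpd⟩ := stronglyFeasible_iff.mp (h (ε / (n + 1)) hpos)
    have hmem : Real.sqrt (ip ((l + (c + (ε / (n + 1)) • Sym.one n)) - (l + c))
        ((l + (c + (ε / (n + 1)) • Sym.one n)) - (l + c))) ∈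
        {r | ∃ x ∈ K n, ∃ y ∈ aff L c, r = Real.sqrt (ip (x - y) (x - y))} :=
      ⟨_, hpd.posSemidef, _, ⟨l, hl, rfl⟩, rfl⟩
    have hle := csInf_le ⟨0, by rintro r ⟨x, -, y, -, rfl⟩; exact Real.sqrt_nonneg _⟩ hmem
    refine (show setDist (K n) (aff L c) ≤ _ from hle).trans ?_
    have h3 : (l + (c + (ε / (n + 1)) • Sym.one n)) - (l + c) = (ε / (n + 1)) • Sym.one n := by
      abel
    rw [h3, ip_smul, ip_smul_left, ip_one_self, zero_add]
    refine Real.sqrt_le_iff.mpr ⟨hε.le, ?_⟩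
    have : ε / (n + 1) * (ε / (n + 1) * n) = ε ^ 2 * (n / (n + 1) ^ 2) := by
      field_simp
    rw [this]
    refine mul_le_of_le_one_right (by positivity) ?_
    rw [div_le_one (by positivity)]
    nlinarith [(Nat.cast_nonneg n : (0 : ℝ) ≤ n)]

/-- Both conditions concern strong feasibility only, of the given problem or of its perturbations.
It therefore suffices to follow strong feasibility through the forward procedure. -/
theorem weakStatus_iff {n : ℕ} {L : Submodule ℝ (Sym n)} {c : Sym n} :
    WeakStatus L c ↔ AlmostFeasible L c ∧ ¬ StronglyFeasible L c := by
  constructor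
  · rintro (⟨h1, h2⟩ | ⟨h1, h2⟩)
    · exact ⟨almostFeasible_of_feasible h2, fun h => h.ne_empty h1⟩
    · refine ⟨setDist_eq_zero_iff.mp h2, fun ⟨x, hx, hx'⟩ => ?_⟩
      exact (Set.mem_empty_iff_false x).mp (h1 ▸ ⟨hx, interior_subset hx'⟩)
  · rintro ⟨h1, h2⟩
    by_cases h : (aff L c ∩ K n).Nonempty
    · exact Or.inl ⟨Set.not_nonempty_iff_eq_empty.mp h2, h⟩
    · exact Or.inr ⟨Set.not_nonempty_iff_eq_empty.mp h, setDist_eq_zero_iff.mpr h1⟩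

end SDFP

/-! ### Duality -/

namespace SDFP

theorem ip_self_eq_zero {n : ℕ} {x : Sym n} (h : ip x x = 0) : x = 0 := by
  rw [ip_eq_sum] at h
  apply Subtype.ext
  ext i j
  have h1 := (Finset.sum_eq_zero_iff_of_nonneg
    (fun i _ => Finset.sum_nonneg fun j _ => mul_self_nonneg _)).mp h i (Finset.mem_univ i)
  have h2 := (Finset.sum_eq_zero_iff_of_nonneg
    (fun j _ => mul_self_nonneg _)).mp h1 j (Finset.mem_univ j)
  exact mul_self_eq_zero.mp h2

/-- The trace inner product embeds the space into its dual, which has the same finite dimension. -/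
theorem exists_ip_eq {n : ℕ} (f : Sym n →ₗ[ℝ] ℝ) : ∃ y : Sym n, ∀ x, ip y x = f x := by
  let F : Sym n →ₗ[ℝ] Module.Dual ℝ (Sym n) :=
    { toFun := ipL
      map_add' := fun a b => by
        ext x
        change ip (a + b) x = ip a x + ip b x
        rw [ip_comm, ip_add, ip_comm, ip_comm x b]
      map_smul' := fun r a => by
        ext x
        exact ip_smul_left a r x }
  have hinj : Function.Injective F := by
    rw [injective_iff_map_eq_zero]
    intro y hy
    exact ip_self_eq_zero (show F y y = 0 by rw [hy]; rfl)
  obtain ⟨y, hy⟩ := (LinearMap.injective_iff_surjective_of_finrank_eq_finrank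
    Subspace.dual_finrank_eq.symm).mp hinj f
  exact ⟨y, fun x => by rw [← hy]; rfl⟩

theorem mem_of_perp {n : ℕ} {L : Submodule ℝ (Sym n)} {x : Sym n}
    (h : ∀ y ∈ perp L, ip y x = 0) : x ∈ L := by
  by_contra hx
  obtain ⟨f, hf, hL⟩ := Submodule.exists_le_ker_of_notMem hx
  obtain ⟨y, hy⟩ := exists_ip_eq f
  exact hf (by rw [← hy]; exact h y fun l hl => by rw [hy]; exact hL hl)

theorem exists_eq_conjTranspose_mul_self {n : ℕ} {y : Sym n} (hy : y ∈ K n) :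
    ∃ C : Matrix (Fin n) (Fin n) ℝ, y.1 = Cᴴ * C := by
  open scoped MatrixOrder Matrix.Norms.L2Operator in
  exact CStarAlgebra.nonneg_iff_eq_star_mul_self.mp (Matrix.PosSemidef.nonneg hy)

/-- With `y = Cᴴ C` the inner product is the trace of the semidefinite matrix `C x Cᴴ`. -/
theorem ip_nonneg {n : ℕ} {x y : Sym n} (hx : x ∈ K n) (hy : y ∈ K n) : 0 ≤ ip x y := by
  obtain ⟨C, hC⟩ := exists_eq_conjTranspose_mul_self hy
  unfold ip
  rw [hC, ← Matrix.mul_assoc, Matrix.trace_mul_comm, ← Matrix.mul_assoc]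
  exact (Matrix.PosSemidef.mul_mul_conjTranspose_same hx C).trace_nonneg

theorem trace_pos_of_ne_zero {n : ℕ} {y : Sym n} (hy : y ∈ K n) (h0 : y ≠ 0) :
    0 < y.1.trace := by
  refine lt_of_le_of_ne (Matrix.PosSemidef.trace_nonneg hy) fun h => h0 ?_
  obtain ⟨C, hC⟩ := exists_eq_conjTranspose_mul_self hy
  apply Subtype.ext
  rw [hC] at h ⊢
  rw [Matrix.trace_conjTranspose_mul_self_eq_zero_iff.mp h.symm]
  simp

theorem ip_ge_of_lower_bound {n : ℕ} {x y : Sym n} {δ : ℝ}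
    (hx : ∀ v : Fin n → ℝ, δ * (v ⬝ᵥ v) ≤ v ⬝ᵥ x.1 *ᵥ v) (hy : y ∈ K n) :
    δ * y.1.trace ≤ ip x y := by
  have h1 : x - δ • Sym.one n ∈ K n := by
    refine (Sym.posSemidef_iff _).mpr fun v => ?_
    have : (x - δ • Sym.one n).1 = x.1 - δ • (1 : Matrix (Fin n) (Fin n) ℝ) := rfl
    rw [this, quadForm_sub, quadForm_smul_left, quadForm_one]
    linarith [hx v]
  have h2 := ip_nonneg hy h1
  rw [sub_eq_add_neg, ← neg_smul δ (Sym.one n), ip_add, ip_smul, ip_one] at h2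
  rw [ip_comm]
  linarith

theorem ip_pos {n : ℕ} {x y : Sym n} (hx : x.1.PosDef) (hy : y ∈ K n) (h0 : y ≠ 0) :
    0 < ip x y := by
  obtain ⟨δ, hδ, hb⟩ := PosDef_exists_lower_bound hx
  exact (mul_pos hδ (trace_pos_of_ne_zero hy h0)).trans_le (ip_ge_of_lower_bound hb hy)

/-- If `L + c` contains no positive definite matrix, then it is separated from the cone. -/
theorem exists_separating {n : ℕ} {L : Submodule ℝ (Sym n)} {c : Sym n}
    (h : ¬ StronglyFeasible L c) : ∃ y ∈ K n, y ∈ perp L ∧ y ≠ 0 ∧ ip y c ≤ 0 := by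
  have hconv : Convex ℝ {x : Sym n | x.1.PosDef} := by
    intro x hx y hy a b ha hb hab
    rcases ha.eq_or_lt with rfl | ha
    · simp only [zero_add] at hab
      simpa [hab] using hy
    · exact (Matrix.PosDef.smul hx ha).add_posSemidef (Matrix.PosSemidef.smul hy.posSemidef hb)
  have hconv' : Convex ℝ (aff L c) := by
    rintro _ ⟨l, hl, rfl⟩ _ ⟨l', hl', rfl⟩ a b ha hb hab
    refine ⟨a • l + b • l', L.add_mem (L.smul_mem _ hl) (L.smul_mem _ hl'), ?_⟩
    rw [smul_add, smul_add, add_add_add_comm, ← add_smul, hab, one_smul]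
  have hdisj : Disjoint {x : Sym n | x.1.PosDef} (aff L c) := by
    rw [Set.disjoint_left]
    intro x hx hxa
    exact h ⟨x, hxa, mem_interior_K.mpr hx⟩
  obtain ⟨f, u, hfs, hft⟩ := geometric_hahn_banach_open hconv (isOpen_posDef n) hconv' hdisj
  obtain ⟨y, hy⟩ := exists_ip_eq (-(f : Sym n →ₗ[ℝ] ℝ))
  have hy' : ∀ x, ip y x = -f x := hy
  -- If `f` were positive at a positive definite matrix, scaling up that matrix would push `f` above
  -- the bound `u`.
  have hpd : ∀ x : Sym n, x.1.PosDef → 0 ≤ ip y x := by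
    intro x hx
    by_contra hneg
    push Not at hneg
    have hfx : 0 < f x := by linarith [hy' x]
    have h1 := hfs ((|u| / f x + 1) • x) (Matrix.PosDef.smul hx (by positivity))
    rw [map_smul, smul_eq_mul, add_mul, div_mul_cancel₀ _ hfx.ne'] at h1
    linarith [le_abs_self u]
  -- If `u` were negative, the identity could be scaled down until `f` takes the value `u / 2 > u`.
  have hu : 0 ≤ u := by
    by_contra hneg
    push Not at hneg
    have h1 := hfs (Sym.one n) Matrix.PosDef.one
    have hf1 : f (Sym.one n) < 0 := by linarith
    have h2 := hfs ((u / (2 * f (Sym.one n))) • Sym.one n)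
      (Matrix.PosDef.smul Matrix.PosDef.one (div_pos_of_neg_of_neg hneg (by linarith)))
    rw [map_smul, smul_eq_mul] at h2
    have h3 : u / (2 * f (Sym.one n)) * f (Sym.one n) = u / 2 := by
      have := hf1.ne
      field_simp
    linarith
  -- On `L + c` the functional is bounded below by `u`, so its linear part vanishes: the chosen
  -- multiple of `l` would give the value `u - 1`.
  have hLz : ∀ l ∈ L, f l = 0 := by
    intro l hl
    by_contra hne
    have h1 := hft (((u - f c - 1) / f l) • l + c) ⟨_, L.smul_mem _ hl, rfl⟩
    rw [map_add, map_smul, smul_eq_mul, div_mul_cancel₀ _ hne] at h1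
    linarith
  have hfc : u ≤ f c := by
    have := hft (0 + c) ⟨0, L.zero_mem, rfl⟩
    rwa [zero_add] at this
  refine ⟨y, ?_, fun l hl => by rw [hy', hLz l hl, neg_zero], ?_, by rw [hy']; linarith⟩
  -- The matrix `v vᵀ` is only semidefinite, so it is perturbed by a multiple of the identity whose
  -- contribution is at most `ε`.
  · refine (Sym.posSemidef_iff y).mpr fun v => ?_
    refine le_of_forall_pos_le_add fun ε hε => ?_
    have hT := hpd (Sym.one n) Matrix.PosDef.one
    have hpos : 0 < ε / (ip y (Sym.one n) + 1) := by positivity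
    have h1 := hpd (Sym.outer v + (ε / (ip y (Sym.one n) + 1)) • Sym.one n) (by
      refine Matrix.PosDef.posSemidef_add ?_ (Matrix.PosDef.smul Matrix.PosDef.one hpos)
      exact Matrix.posSemidef_vecMulVec_self_star v)
    rw [ip_add, ip_smul, ip_outer] at h1
    have h2 : ε / (ip y (Sym.one n) + 1) * ip y (Sym.one n) ≤ ε := by
      rw [div_mul_eq_mul_div, div_le_iff₀ (by positivity)]
      nlinarith
    linarith
  -- For `y = 0` the functional vanishes, against `f I < u ≤ f c`.
  · rintro rfl
    have h1 := hfs (Sym.one n) Matrix.PosDef.one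
    have h2 := hy' (Sym.one n)
    have h3 := hy' c
    rw [ip_comm, ip_zero] at h2 h3
    linarith

/-- The orthogonal complement as a subspace. -/
def perpSubmodule {n : ℕ} (L : Submodule ℝ (Sym n)) : Submodule ℝ (Sym n) where
  carrier := perp L
  add_mem' {a b} ha hb x hx := by rw [ip_comm, ip_add, ip_comm x, ip_comm x, ha x hx, hb x hx,
    add_zero]
  zero_mem' x _ := by rw [ip_comm, ip_zero]
  smul_mem' r a ha x hx := by rw [ip_smul_left, ha x hx, mul_zero]

/-- Either `L` contains a nonzero positive semidefinite matrix, or its orthogonal complement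
contains a positive definite one. -/
theorem exists_psd_or_perp_posDef {n : ℕ} (L : Submodule ℝ (Sym n)) :
    (∃ A ∈ L, A ∈ K n ∧ A ≠ 0) ∨ ∃ B ∈ perp L, B.1.PosDef := by
  -- Separation is applied to the problem with linear part `L^⊥` and displacement zero; a separating
  -- matrix then lies in `L^⊥⊥ = L`.
  by_cases h : StronglyFeasible (perpSubmodule L) 0
  · obtain ⟨B, hB, hpd⟩ := stronglyFeasible_iff.mp h
    rw [add_zero] at hpd
    exact Or.inr ⟨B, hB, hpd⟩
  · obtain ⟨y, hy, hyp, h0, -⟩ := exists_separating h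
    exact Or.inl ⟨y, mem_of_perp fun z hz => by rw [ip_comm]; exact hyp z hz, hy, h0⟩

/-- Some `L + c + ε I` is separated from the cone by a matrix `y`. Hence `⟨y, c⟩ ≤ -ε tr y < 0`, and
`y` can be normalised. -/
theorem exists_strongInfeasCert {n : ℕ} {L : Submodule ℝ (Sym n)} {c : Sym n}
    (h : ¬ AlmostFeasible L c) : ∃ s, StrongInfeasCert L c s := by
  unfold AlmostFeasible at h
  push Not at h
  obtain ⟨ε, hε, h⟩ := h
  obtain ⟨y, hy, hyp, h0, hle⟩ := exists_separating h
  rw [ip_add, ip_smul, ip_one] at hle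
  have hneg : ip y c < 0 := by
    have := mul_pos hε (trace_pos_of_ne_zero hy h0)
    linarith
  refine ⟨(-(ip y c)⁻¹) • y, ?_, fun x hx => by rw [ip_smul_left, hyp x hx, mul_zero], ?_⟩
  · exact Matrix.PosSemidef.smul hy (neg_nonneg.mpr (inv_nonpos.mpr hneg.le))
  · rw [ip_smul_left, neg_mul, inv_mul_cancel₀ hneg.ne]

/-- On `L + c + ε I` the inner product with `s` equals `-1 + ε tr s`, which is negative for `ε = 1 /
(tr s + 1)`, whereas it is nonnegative on the cone. -/
theorem not_almostFeasible_of_strongInfeasCert {n : ℕ} {L : Submodule ℝ (Sym n)} {c s : Sym n}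
    (h : StrongInfeasCert L c s) : ¬ AlmostFeasible L c := by
  obtain ⟨hK, hp, h1⟩ := h
  intro hA
  have hT := Matrix.PosSemidef.trace_nonneg hK
  obtain ⟨l, hl, hpd⟩ := stronglyFeasible_iff.mp (hA (1 / (s.1.trace + 1)) (by positivity))
  have h2 := ip_nonneg hK hpd.posSemidef
  rw [ip_add, ip_add, ip_smul, ip_one, hp l hl, h1] at h2
  have h3 : 1 / (s.1.trace + 1) * s.1.trace < 1 := by
    rw [div_mul_eq_mul_div, div_lt_one (by positivity)]
    linarith
  linarith

/-- The vectors `eᵢ ± eⱼ` give `2 |xᵢⱼ| ≤ xᵢᵢ + xⱼⱼ`, and every diagonal entry is at most the trace.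
-/
theorem abs_apply_le_trace {n : ℕ} {x : Sym n} (hx : x ∈ K n) (i j : Fin n) :
    |x.1 i j| ≤ x.1.trace := by
  have hd : ∀ i, 0 ≤ x.1 i i := fun i => Matrix.PosSemidef.diag_nonneg hx
  have hle : ∀ i, x.1 i i ≤ x.1.trace := fun i =>
    Finset.single_le_sum (f := fun i => x.1 i i) (fun i _ => hd i) (Finset.mem_univ i)
  have hq : ∀ s : ℝ, (Pi.single i 1 + s • Pi.single j 1 : Fin n → ℝ) ⬝ᵥ x.1 *ᵥ
      (Pi.single i 1 + s • Pi.single j 1) =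
      x.1 i i + s * x.1 i j + s * x.1 j i + s ^ 2 * x.1 j j := by
    intro s
    simp only [Matrix.mulVec_add, Matrix.mulVec_smul, dotProduct_add, add_dotProduct,
      smul_dotProduct, dotProduct_smul, single_one_dotProduct, Matrix.mulVec_single_one,
      Matrix.col_apply, smul_eq_mul]
    ring
  have h1 := (Sym.posSemidef_iff x).mp hx (Pi.single i 1 + (1 : ℝ) • Pi.single j 1)
  have h2 := (Sym.posSemidef_iff x).mp hx (Pi.single i 1 + (-1 : ℝ) • Pi.single j 1)
  rw [hq, x.apply_comm j i] at h1 h2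
  rw [abs_le]
  constructor <;> linarith [hle i, hle j]

theorem isClosed_K (n : ℕ) : IsClosed (K n) := by
  have : K n = ⋂ v : Fin n → ℝ, {x | 0 ≤ ip x (Sym.outer v)} := by
    ext x
    simp only [Set.mem_iInter, Set.mem_ofPred_eq, ip_outer]
    exact Sym.posSemidef_iff x
  rw [this]
  exact isClosed_iInter fun v =>
    isClosed_le continuous_const (continuous_ip continuous_id continuous_const)

theorem isCompact_trace_le {n : ℕ} (r : ℝ) : IsCompact {x : Sym n | x ∈ K n ∧ x.1.trace ≤ r} := by
  have hemb : Topology.IsClosedEmbedding (Subtype.val : Sym n → Matrix (Fin n) (Fin n) ℝ) := by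
    refine IsClosed.isClosedEmbedding_subtypeVal ?_
    exact isClosed_eq continuous_id.matrix_transpose continuous_id
  have hbox : IsCompact (X := Matrix (Fin n) (Fin n) ℝ)
      (Set.univ.pi fun _ : Fin n => Set.univ.pi fun _ : Fin n => Set.Icc (-r) r) :=
    isCompact_univ_pi fun _ => isCompact_univ_pi fun _ => isCompact_Icc
  refine (hemb.isCompact_preimage hbox).of_isClosed_subset ?_ ?_
  · have h1 : IsClosed {x : Sym n | x.1.trace ≤ r} :=
      isClosed_le continuous_subtype_val.matrix_trace continuous_const
    exact (isClosed_K n).inter h1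
  · rintro x ⟨hx, hr⟩ i - j -
    have := abs_le.mp ((abs_apply_le_trace hx i j).trans hr)
    exact this

/-- If the orthogonal complement of `L` contains a positive definite matrix, then a problem that
becomes feasible by arbitrarily small perturbations is feasible. -/
theorem AlmostFeasible.feasible {n : ℕ} {L : Submodule ℝ (Sym n)} {c B : Sym n}
    (h : AlmostFeasible L c) (hB : B ∈ perp L) (hpd : B.1.PosDef) :
    (aff L c ∩ K n).Nonempty := by
  obtain ⟨δ, hδ, hb⟩ := PosDef_exists_lower_bound hpd
  choose l hl hx using fun k : ℕ =>
    stronglyFeasible_iff.mp (h (1 / ((k : ℝ) + 1)) Nat.one_div_pos_of_nat)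
  have hBt := Matrix.PosSemidef.trace_nonneg hpd.posSemidef
  -- The inner product with `B` is at least `δ` times the trace and equals `⟨B, c⟩ + tr B / (k +
  -- 1)`. This bounds the trace independently of `k`.
  have hmem : ∀ k, l k + (c + (1 / ((k : ℝ) + 1)) • Sym.one n) ∈
      {x : Sym n | x ∈ K n ∧ x.1.trace ≤ (ip B c + B.1.trace) / δ} := by
    intro k
    refine ⟨(hx k).posSemidef, ?_⟩
    have h1 := ip_ge_of_lower_bound hb (hx k).posSemidef
    rw [ip_add, ip_add, ip_smul, ip_one, hB _ (hl k), zero_add] at h1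
    rw [le_div_iff₀ hδ, mul_comm]
    have h2 : 1 / ((k : ℝ) + 1) ≤ 1 := by
      rw [div_le_one (by positivity)]
      linarith [(Nat.cast_nonneg k : (0 : ℝ) ≤ k)]
    nlinarith
  have : FirstCountableTopology (Matrix (Fin n) (Fin n) ℝ) :=
    inferInstanceAs (FirstCountableTopology (Fin n → Fin n → ℝ))
  have : FirstCountableTopology (Sym n) :=
    Topology.IsInducing.subtypeVal.firstCountableTopology
  obtain ⟨x, hxK, φ, hφ, hlim⟩ := (isCompact_trace_le _).tendsto_subseq hmem
  have hε : Filter.Tendsto (fun k => (1 / ((φ k : ℝ) + 1)) • Sym.one n) Filter.atTop (nhds 0) := by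
    have h1 := (tendsto_one_div_add_atTop_nhds_zero_nat (𝕜 := ℝ)).comp hφ.tendsto_atTop
    simpa using h1.smul_const (Sym.one n)
  have hl' : Filter.Tendsto (fun k => l (φ k)) Filter.atTop (nhds (x - c)) := by
    have := (hlim.sub_const c).sub hε
    rw [sub_zero] at this
    refine this.congr fun k => ?_
    simp only [Function.comp]
    abel
  -- A limit point minus `c` still lies in `L`, because a finite-dimensional subspace is closed.
  have hclosed : IsClosed (L : Set (Sym n)) := Submodule.closed_of_finiteDimensional L
  exact ⟨x, ⟨x - c, hclosed.mem_of_tendsto hl' (Filter.Eventually.of_forall fun k => hl _),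
    by abel⟩, hxK.1⟩

/-- Weak status under the assumption that there is no nonzero hyper feasible direction. -/
theorem almostFeasible_and_not_stronglyFeasible_iff {n : ℕ} {L : Submodule ℝ (Sym n)}
    {c B : Sym n} (hB : B ∈ perp L) (hpd : B.1.PosDef) :
    (AlmostFeasible L c ∧ ¬ StronglyFeasible L c) ↔ ∃ x y, WeakFeasCert L c x y := by
  constructor
  · rintro ⟨h1, h2⟩
    obtain ⟨x, hx, hxK⟩ := h1.feasible hB hpd
    obtain ⟨y, hy, hyp, h0, hle⟩ := exists_separating h2
    -- Separation gives `⟨y, c⟩ ≤ 0`. The feasible point gives the opposite inequality, since `⟨y,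
    -- c⟩ = ⟨y, x⟩ ≥ 0`.
    refine ⟨x, y, ⟨hx, hxK⟩, hyp, hy, h0, le_antisymm hle ?_⟩
    obtain ⟨l, hl, rfl⟩ := hx
    have := ip_nonneg hy hxK
    rwa [ip_add, hyp l hl, zero_add] at this
  · rintro ⟨x, y, ⟨hx, hxK⟩, hyp, hy, h0, hc⟩
    refine ⟨almostFeasible_of_feasible ⟨x, hx, hxK⟩, fun h => ?_⟩
    obtain ⟨l, hl, hp⟩ := stronglyFeasible_iff.mp h
    have := ip_pos hp hy h0
    rw [ip_comm, ip_add, hyp l hl, hc, add_zero] at this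
    exact lt_irrefl _ this

end SDFP

/-! ### Congruences and reduction to principal blocks -/

namespace SDFP

theorem posDef_cong_iff {n : ℕ} {P : Matrix (Fin n) (Fin n) ℝ} (hP : IsUnit P.det) (x : Sym n) :
    (cong P x).1.PosDef ↔ x.1.PosDef := by
  have := Matrix.IsUnit.posDef_star_left_conjugate_iff (x := x.1)
    ((Matrix.isUnit_iff_isUnit_det P).mpr hP)
  rwa [Matrix.star_eq_conjTranspose, Matrix.conjTranspose_eq_transpose_of_trivial] at this

theorem cong_mul {n : ℕ} (P M : Matrix (Fin n) (Fin n) ℝ) (x : Sym n) :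
    cong (P * M) x = cong M (cong P x) := by
  apply Subtype.ext
  change (P * M)ᵀ * x.1 * (P * M) = Mᵀ * (Pᵀ * x.1 * P) * M
  simp only [Matrix.transpose_mul, Matrix.mul_assoc]

theorem stronglyFeasible_cong_iff {n : ℕ} {P : Matrix (Fin n) (Fin n) ℝ} (hP : IsUnit P.det)
    {L : Submodule ℝ (Sym n)} {c : Sym n} :
    StronglyFeasible (L.map (cong P)) (cong P c) ↔ StronglyFeasible L c := by
  rw [stronglyFeasible_iff, stronglyFeasible_iff]
  constructor
  · rintro ⟨_, ⟨l, hl, rfl⟩, h⟩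
    rw [← map_add, posDef_cong_iff hP] at h
    exact ⟨l, hl, h⟩
  · rintro ⟨l, hl, h⟩
    exact ⟨_, ⟨l, hl, rfl⟩, by rwa [← map_add, posDef_cong_iff hP]⟩

/-- If `δ F` is dominated by `E`, perturbations by `F` may be replaced by perturbations by `E`. -/
theorem stronglyFeasible_of_le {n : ℕ} {L : Submodule ℝ (Sym n)} {c E F : Sym n} {δ : ℝ}
    (hδ : 0 < δ) (hEF : ∀ v : Fin n → ℝ, δ * (v ⬝ᵥ F.1 *ᵥ v) ≤ v ⬝ᵥ E.1 *ᵥ v)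
    (h : ∀ ε : ℝ, 0 < ε → StronglyFeasible L (c + ε • F)) (ε : ℝ) (hε : 0 < ε) :
    StronglyFeasible L (c + ε • E) := by
  obtain ⟨l, hl, hpd⟩ := stronglyFeasible_iff.mp (h (ε * δ) (by positivity))
  refine stronglyFeasible_iff.mpr ⟨l, hl, ?_⟩
  rw [Sym.posDef_iff] at hpd ⊢
  intro v hv
  have h1 := hpd v hv
  have e1 : ∀ (r : ℝ) (G : Sym n), v ⬝ᵥ (l + (c + r • G)).1 *ᵥ v =
      v ⬝ᵥ l.1 *ᵥ v + (v ⬝ᵥ c.1 *ᵥ v + r * (v ⬝ᵥ G.1 *ᵥ v)) := by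
    intro r G
    have : (l + (c + r • G)).1 = l.1 + (c.1 + r • G.1) := rfl
    rw [this, quadForm_add, quadForm_add, quadForm_smul_left]
  rw [e1] at h1 ⊢
  nlinarith [hEF v]

/-- Any two positive definite matrices dominate positive multiples of each other. The freedom is
needed because the congruence by `P` turns the perturbation `I` into `Pᵀ P`. -/
theorem almostFeasible_iff_of_posDef {n : ℕ} {L : Submodule ℝ (Sym n)} {c E : Sym n}
    (hE : E.1.PosDef) :
    AlmostFeasible L c ↔ ∀ ε : ℝ, 0 < ε → StronglyFeasible L (c + ε • E) := by
  constructor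
  · intro h
    obtain ⟨δ, hδ, hb⟩ := PosDef_exists_lower_bound hE
    refine stronglyFeasible_of_le hδ (fun v => ?_) h
    have : v ⬝ᵥ (Sym.one n).1 *ᵥ v = v ⬝ᵥ v := quadForm_one v
    rw [this]
    exact hb v
  · intro h
    have h0 := Real.sqrt_nonneg (ip E E)
    -- The form of `E` is at most the Frobenius norm of `E` times that of the identity; the summand
    -- `1` keeps the factor invertible.
    refine stronglyFeasible_of_le (δ := (Real.sqrt (ip E E) + 1)⁻¹) (by positivity)
      (fun v => ?_) h
    have h1 := (abs_le.mp (abs_dotProduct_mulVec_le E v)).2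
    have h2 : 0 ≤ v ⬝ᵥ v := Finset.sum_nonneg fun i _ => mul_self_nonneg _
    have h3 : v ⬝ᵥ (Sym.one n).1 *ᵥ v = v ⬝ᵥ v := quadForm_one v
    rw [h3, inv_mul_le_iff₀ (by positivity)]
    linarith

theorem almostFeasible_cong_iff {n : ℕ} {P : Matrix (Fin n) (Fin n) ℝ} (hP : IsUnit P.det)
    {L : Submodule ℝ (Sym n)} {c : Sym n} :
    AlmostFeasible (L.map (cong P)) (cong P c) ↔ AlmostFeasible L c := by
  rw [almostFeasible_iff_of_posDef ((posDef_cong_iff hP (Sym.one n)).mpr Matrix.PosDef.one)]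
  refine forall₂_congr fun ε _ => ?_
  rw [← map_smul, ← map_add, stronglyFeasible_cong_iff hP]

theorem tailIdx_injective {d n : ℕ} (h : d ≤ n) : Function.Injective (tailIdx h) := by
  intro i j hij
  have : n - d + (i : ℕ) = n - d + j := congrArg Fin.val hij
  exact Fin.ext (by omega)

theorem lowerRight_trans {d D n : ℕ} (h : d ≤ D) (h' : D ≤ n) (x : Sym n) :
    lowerRight h (lowerRight h' x) = lowerRight (h.trans h') x := by
  have : ∀ i, tailIdx h' (tailIdx h i) = tailIdx (h.trans h') i := fun i => Fin.ext (by
    simp only [tailIdx]; omega)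
  apply Subtype.ext
  ext i j
  change x.1 (tailIdx h' (tailIdx h i)) (tailIdx h' (tailIdx h j)) = x.1 _ _
  rw [this, this]

theorem lowerRight_self {n : ℕ} (h : n ≤ n) (x : Sym n) : lowerRight h x = x := by
  have : ∀ i, tailIdx h i = i := fun i => Fin.ext (by simp [tailIdx])
  apply Subtype.ext
  ext i j
  change x.1 (tailIdx h i) (tailIdx h j) = x.1 i j
  rw [this, this]

theorem lowerRight_one {d n : ℕ} (h : d ≤ n) : lowerRight h (Sym.one n) = Sym.one d := by
  apply Subtype.ext
  exact Matrix.submatrix_one _ (tailIdx_injective h)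

/-- The hypothesis `h` covers the two situations that occur: the matrix vanishes outside the block,
or the vector does. -/
theorem quadForm_comp {d D : ℕ} {e : Fin d → Fin D} (he : Function.Injective e)
    (M : Matrix (Fin D) (Fin D) ℝ) (v : Fin D → ℝ)
    (h : ∀ i j, i ∉ Set.range e ∨ j ∉ Set.range e → M i j * (v i * v j) = 0) :
    v ⬝ᵥ M *ᵥ v = (v ∘ e) ⬝ᵥ M.submatrix e e *ᵥ (v ∘ e) := by
  rw [dotProduct_mulVec_eq_sum, dotProduct_mulVec_eq_sum]
  symm
  refine Fintype.sum_of_injective e he _ _ (fun i hi => ?_) fun i => ?_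
  · exact Finset.sum_eq_zero fun j _ => h i j (Or.inl hi)
  · exact Fintype.sum_of_injective e he _ _ (fun j hj => h _ _ (Or.inr hj)) fun j => rfl

/-- If `A = Â ⊕ 0` with `Â` positive definite and the complementary block of `x` is positive
definite, then so is `x + t A` for large `t`. -/
theorem exists_posDef_add_smul {d k D : ℕ} (h : d ≤ D) (hk : d + k = D) {x A : Sym D}
    {Ah : Matrix (Fin k) (Fin k) ℝ} (hAh : Ah.PosDef) (hA : A.1 = pad D Ah)
    (hx : (lowerRight h x).1.PosDef) : ∃ t : ℝ, (x + t • A).1.PosDef := by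
  have hkD : k ≤ D := by omega
  have he : Function.Injective (Fin.castLE hkD) := Fin.castLE_injective hkD
  have hqA : ∀ v : Fin D → ℝ, v ⬝ᵥ A.1 *ᵥ v =
      (v ∘ Fin.castLE hkD) ⬝ᵥ Ah *ᵥ (v ∘ Fin.castLE hkD) := by
    intro v
    rw [quadForm_comp he]
    · congr 2
      rw [hA]
      ext i j
      simp [pad]
    · intro i j hij
      rw [hA, pad, dif_neg, zero_mul]
      rintro ⟨hi, hj⟩
      rcases hij with hij | hij
      · exact hij ⟨⟨i, hi⟩, rfl⟩
      · exact hij ⟨⟨j, hj⟩, rfl⟩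
  have hA0 : ∀ v : Fin D → ℝ, 0 ≤ v ⬝ᵥ A.1 *ᵥ v := by
    intro v
    rw [hqA]
    simpa using hAh.posSemidef.dotProduct_mulVec_nonneg (v ∘ Fin.castLE hkD)
  -- If the form of `A` vanishes at `v`, then the first `k` coordinates of `v` are zero; so `v`
  -- lives on the lower right block, where the form of `x` is positive.
  have hpos : ∀ v : Fin D → ℝ, v ≠ 0 → v ⬝ᵥ x.1 *ᵥ v ≤ 0 → 0 < v ⬝ᵥ A.1 *ᵥ v := by
    intro v hv hvx
    rw [hqA]
    by_contra hcon
    have hz : v ∘ Fin.castLE hkD = 0 := by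
      by_contra hne
      exact hcon (by simpa using hAh.dotProduct_mulVec_pos hne)
    have hz' : ∀ i, i ∉ Set.range (tailIdx h) → v i = 0 := by
      intro i hi
      by_cases hik : (i : ℕ) < k
      · exact congrFun hz ⟨i, hik⟩
      · exact absurd ⟨⟨i - k, by omega⟩, Fin.ext (by simp only [tailIdx]; omega)⟩ hi
    have h1 : v ⬝ᵥ x.1 *ᵥ v = _ := quadForm_comp (tailIdx_injective h) x.1 v (by
      rintro i j (hi | hj)
      · rw [hz' i hi]; ring
      · rw [hz' j hj]; ring)
    have h2 : v ∘ tailIdx h ≠ 0 := by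
      intro h3
      apply hv
      ext i
      by_cases hi : i ∈ Set.range (tailIdx h)
      · obtain ⟨j, rfl⟩ := hi
        exact congrFun h3 j
      · exact hz' i hi
    have h3 := (Sym.posDef_iff _).mp hx _ h2
    rw [h1] at hvx
    exact absurd hvx (not_le.mpr h3)
  -- Only unit vectors at which the form of `x` is not positive need help from `A`. They form a
  -- compact set on which the form of `A` has a positive minimum.
  have hcomp : IsCompact ({v : Fin D → ℝ | v ⬝ᵥ v = 1} ∩ {v | v ⬝ᵥ x.1 *ᵥ v ≤ 0}) :=
    (isCompact_unitSphere D).inter_right (isClosed_le (continuous_quadForm x.1) continuous_const)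
  have key : ∃ t : ℝ, 0 ≤ t ∧ ∀ v : Fin D → ℝ, v ⬝ᵥ v = 1 →
      0 < v ⬝ᵥ x.1 *ᵥ v + t * (v ⬝ᵥ A.1 *ᵥ v) := by
    by_cases hne : ({v : Fin D → ℝ | v ⬝ᵥ v = 1} ∩ {v | v ⬝ᵥ x.1 *ᵥ v ≤ 0}).Nonempty
    · obtain ⟨u, ⟨hu1, hu2⟩, humin⟩ := hcomp.exists_isMinOn hne (continuous_quadForm A.1).continuousOn
      have hu0 : u ≠ 0 := by
        rintro rfl
        simp at hu1
      have hup := hpos u hu0 hu2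
      set m := u ⬝ᵥ A.1 *ᵥ u
      set b := Real.sqrt (ip x x)
      have hb : 0 ≤ b := Real.sqrt_nonneg _
      -- On the unit sphere the form of `x` is at least `-b`, while on the critical set this
      -- multiple of `A` contributes at least `b + 1`.
      refine ⟨(b + 1) / m, by positivity, fun v hv => ?_⟩
      by_cases hvx : v ⬝ᵥ x.1 *ᵥ v ≤ 0
      · have h1 : m ≤ v ⬝ᵥ A.1 *ᵥ v := humin ⟨hv, hvx⟩
        have h2 := (abs_le.mp (abs_dotProduct_mulVec_le x v)).1
        rw [hv, mul_one] at h2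
        have h3 : b + 1 ≤ (b + 1) / m * (v ⬝ᵥ A.1 *ᵥ v) := by
          rw [div_mul_eq_mul_div, le_div_iff₀ hup]
          gcongr
        linarith
      · have h1 := hA0 v
        have h2 : 0 ≤ (b + 1) / m * (v ⬝ᵥ A.1 *ᵥ v) := by positivity
        linarith
    · refine ⟨0, le_rfl, fun v hv => ?_⟩
      rw [zero_mul, add_zero]
      by_contra hcon
      exact hne ⟨v, hv, not_lt.mp hcon⟩
  obtain ⟨t, -, ht⟩ := key
  refine ⟨t, (Sym.posDef_iff _).mpr fun v hv => ?_⟩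
  have hM : (x + t • A).1 = x.1 + t • A.1 := rfl
  have hp := dotProduct_self_pos hv
  set s := Real.sqrt (v ⬝ᵥ v) with hs
  have hs2 : s ^ 2 = v ⬝ᵥ v := Real.sq_sqrt hp.le
  have hs0 : 0 < s := Real.sqrt_pos.mpr hp
  have h1 : (s⁻¹ • v) ⬝ᵥ (s⁻¹ • v) = 1 := by
    rw [dotProduct_smul, smul_dotProduct, smul_eq_mul, smul_eq_mul, ← hs2]
    field_simp
  have h2 := ht _ h1
  rw [← quadForm_smul_left, ← quadForm_add, ← hM, quadForm_smul] at h2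
  exact pos_of_mul_pos_right h2 (by positivity)

theorem posDef_lowerRight {d n : ℕ} (h : d ≤ n) {x : Sym n} (hx : x.1.PosDef) :
    (lowerRight h x).1.PosDef := Matrix.PosDef.submatrix hx (tailIdx_injective h)

/-- Blocks of positive definite matrices are positive definite. Conversely, a multiple of `A`
repairs the rest of the matrix, and adding it stays within `L + c`. -/
theorem stronglyFeasible_lowerRight_iff {d k D : ℕ} (h : d ≤ D) (hk : d + k = D)
    {L : Submodule ℝ (Sym D)} {A : Sym D} (hAL : A ∈ L)
    {Ah : Matrix (Fin k) (Fin k) ℝ} (hAh : Ah.PosDef) (hA : A.1 = pad D Ah) (c : Sym D) :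
    StronglyFeasible L c ↔ StronglyFeasible (L.map (lowerRight h)) (lowerRight h c) := by
  rw [stronglyFeasible_iff, stronglyFeasible_iff]
  constructor
  · rintro ⟨l, hl, hpd⟩
    exact ⟨_, ⟨l, hl, rfl⟩, by rw [← map_add]; exact posDef_lowerRight h hpd⟩
  · rintro ⟨_, ⟨l, hl, rfl⟩, hpd⟩
    rw [← map_add] at hpd
    obtain ⟨t, ht⟩ := exists_posDef_add_smul h hk hAh hA hpd
    refine ⟨l + t • A, L.add_mem hl (L.smul_mem _ hAL), ?_⟩
    rwa [add_right_comm]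

/-! ### Directions -/

/-- The requirement on one of the pairs `(kᵢ, Aᵢ)`, where `o = k₁ + ⋯ + kᵢ₋₁`. -/
def DirOK {n : ℕ} (L : Submodule ℝ (Sym n)) (P : Matrix (Fin n) (Fin n) ℝ) (o : ℕ)
    (a : ℕ × Sym n) : Prop :=
  0 < a.1 ∧ a.2 ∈ L.map (cong P) ∧ ∃ Ah : Matrix (Fin a.1) (Fin a.1) ℝ, Ah.PosDef ∧
    (lowerRight (Nat.sub_le n o) a.2).1 = pad (n - o) Ah

/-- The requirement on a list of pairs `(kᵢ, Aᵢ)`. -/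
def DirsOK {n : ℕ} (L : Submodule ℝ (Sym n)) (P : Matrix (Fin n) (Fin n) ℝ) :
    ℕ → List (ℕ × Sym n) → Prop
  | _, [] => True
  | o, a :: l => DirOK L P o a ∧ DirsOK L P (o + a.1) l

/-- The recursive form with a running offset suits induction along the list; the indexed form is the
one in the specification and in the code of a certificate. -/
theorem dirsOK_iff {n : ℕ} (L : Submodule ℝ (Sym n)) (P : Matrix (Fin n) (Fin n) ℝ) (o : ℕ)
    (l : List (ℕ × Sym n)) : DirsOK L P o l ↔
      ∀ i : Fin l.length, DirOK L P (o + ((l.take i).map Prod.fst).sum) (l.get i) := by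
  induction l generalizing o with
  | nil => simp [DirsOK]
  | cons a l ih =>
    rw [DirsOK, ih]
    constructor
    · rintro ⟨h1, h2⟩ i
      refine Fin.cases ?_ (fun j => ?_) i
      · simpa using h1
      · have := h2 j
        simpa [add_assoc] using this
    · intro h
      refine ⟨by simpa using h ⟨0, by simp⟩, fun i => ?_⟩
      have := h i.succ
      simpa [add_assoc] using this

theorem dirsOK_append {n : ℕ} (L : Submodule ℝ (Sym n)) (P : Matrix (Fin n) (Fin n) ℝ) (o : ℕ)
    (l l' : List (ℕ × Sym n)) : DirsOK L P o (l ++ l') ↔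
      DirsOK L P o l ∧ DirsOK L P (o + (l.map Prod.fst).sum) l' := by
  induction l generalizing o with
  | nil => simp [DirsOK]
  | cons a l ih => simp [DirsOK, ih, and_assoc, add_assoc]

theorem meetsSpec_iff {n : ℕ} {O : FPOutput n} {L : Submodule ℝ (Sym n)} :
    O.MeetsSpec L ↔ IsUnit O.P.det ∧ DirsOK L O.P 0 O.dirs ∧
      (O.B ∈ perp (O.lastL L) ∧ O.B ∈ interior (K O.d) ∧ O.B.1.trace = 1) := by
  rw [dirsOK_iff]
  simp only [zero_add]
  rfl

/-- The directions are used from the first to the last; each one cuts its own block off the current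
subproblem of size `D`. -/
theorem stronglyFeasible_iff_of_dirsOK {n : ℕ} {L : Submodule ℝ (Sym n)}
    {P : Matrix (Fin n) (Fin n) ℝ} (c : Sym n) (l : List (ℕ × Sym n)) {D d : ℕ} (hD : D ≤ n)
    (hd : d ≤ n) (hl : DirsOK L P (n - D) l) (hsum : (l.map Prod.fst).sum + d = D) :
    StronglyFeasible ((L.map (cong P)).map (lowerRight hD)) (lowerRight hD c) ↔
      StronglyFeasible ((L.map (cong P)).map (lowerRight hd)) (lowerRight hd c) := by
  induction l generalizing D with
  | nil =>
    simp only [List.map_nil, List.sum_nil, zero_add] at hsum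
    subst hsum
    rfl
  | cons a l ih =>
    obtain ⟨⟨h1, h2, Ah, h3, h4⟩, h5⟩ := hl
    simp only [List.map_cons, List.sum_cons] at hsum
    have hDa : D - a.1 ≤ D := Nat.sub_le _ _
    have hDn : n - (n - D) = D := by omega
    have h6 : (lowerRight hD a.2).1 = pad D Ah := by
      have : ∀ E (hE : E ≤ n), E = D → (lowerRight hE a.2).1 = pad E Ah →
          (lowerRight hD a.2).1 = pad D Ah := by
        rintro E hE rfl h
        exact h
      exact this _ _ hDn h4
    rw [stronglyFeasible_lowerRight_iff hDa (by omega) (Submodule.mem_map_of_mem h2) h3 h6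
      (lowerRight hD c),
      lowerRight_trans, ← Submodule.map_comp]
    have h7 : (lowerRight hDa).comp (lowerRight hD) = lowerRight (hDa.trans hD) :=
      LinearMap.ext fun x => lowerRight_trans _ _ x
    rw [h7]
    refine ih (hDa.trans hD) ?_ (by omega)
    rwa [show n - (D - a.1) = n - D + a.1 by omega]

theorem stronglyFeasible_last_iff {n : ℕ} {L : Submodule ℝ (Sym n)}
    {P : Matrix (Fin n) (Fin n) ℝ} (hP : IsUnit P.det) (c : Sym n) {l : List (ℕ × Sym n)} {d : ℕ}
    (hd : d ≤ n) (hl : DirsOK L P 0 l) (hsum : (l.map Prod.fst).sum + d = n) :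
    StronglyFeasible L c ↔
      StronglyFeasible ((L.map (cong P)).map (lowerRight hd)) (lowerRight hd (cong P c)) := by
  rw [← stronglyFeasible_iff_of_dirsOK (cong P c) l le_rfl hd (by simpa using hl) hsum,
    lowerRight_self, ← stronglyFeasible_cong_iff hP]
  have : lowerRight (le_refl n) = LinearMap.id := LinearMap.ext fun x => lowerRight_self _ x
  rw [this, Submodule.map_id]

/-- After the congruence, the reduction of strong feasibility is applied to each perturbed problem;
the lower right block of the identity is again the identity. -/
theorem almostFeasible_last_iff {n : ℕ} {L : Submodule ℝ (Sym n)}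
    {P : Matrix (Fin n) (Fin n) ℝ} (hP : IsUnit P.det) (c : Sym n) {l : List (ℕ × Sym n)} {d : ℕ}
    (hd : d ≤ n) (hl : DirsOK L P 0 l) (hsum : (l.map Prod.fst).sum + d = n) :
    AlmostFeasible L c ↔
      AlmostFeasible ((L.map (cong P)).map (lowerRight hd)) (lowerRight hd (cong P c)) := by
  rw [← almostFeasible_cong_iff hP]
  refine forall₂_congr fun ε _ => ?_
  rw [← lowerRight_one hd, ← map_smul, ← map_add,
    ← stronglyFeasible_iff_of_dirsOK _ l le_rfl hd (by simpa using hl) hsum, lowerRight_self]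
  have : lowerRight (le_refl n) = LinearMap.id := LinearMap.ext fun x => lowerRight_self _ x
  rw [this, Submodule.map_id]

/-- Weak status is attested by certificates of weak feasibility of the last subproblem. -/
theorem weakStatus_iff_of_meetsSpec {n : ℕ} {O : FPOutput n} {L : Submodule ℝ (Sym n)}
    (h : O.MeetsSpec L) (c : Sym n) :
    WeakStatus L c ↔ ∃ x y : Sym O.d, WeakFeasCert (O.lastL L) (O.lastC c) x y := by
  obtain ⟨hP, hl, hB, hpd, -⟩ := meetsSpec_iff.mp h
  rw [weakStatus_iff, stronglyFeasible_last_iff hP c O.d_le hl O.size_eq,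
    almostFeasible_last_iff hP c O.d_le hl O.size_eq]
  exact almostFeasible_and_not_stronglyFeasible_iff hB (mem_interior_K.mp hpd)

end SDFP

/-! ### The forward procedure -/

namespace SDFP

/-- The splitting of the index set into the first `n - d` and the last `d` elements. -/
def splitIdx {d n : ℕ} (h : d ≤ n) : Fin (n - d) ⊕ Fin d ≃ Fin n :=
  finSumFinEquiv.trans (finCongr (by omega))

theorem splitIdx_inl {d n : ℕ} (h : d ≤ n) (i : Fin (n - d)) :
    (splitIdx h (Sum.inl i) : ℕ) = i := by simp [splitIdx]

theorem splitIdx_inr {d n : ℕ} (h : d ≤ n) (i : Fin d) :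
    splitIdx h (Sum.inr i) = tailIdx h i := Fin.ext (by simp [splitIdx, tailIdx])

theorem blockM_submatrix {d n : ℕ} (h : d ≤ n) (Q : Matrix (Fin d) (Fin d) ℝ) :
    (blockM h Q).submatrix (splitIdx h) (splitIdx h) = Matrix.fromBlocks 1 0 0 Q := by
  ext (i | i) (j | j)
  · have hi := splitIdx_inl h i
    have hj := splitIdx_inl h j
    simp only [Matrix.submatrix_apply, blockM, Matrix.fromBlocks_apply₁₁, Matrix.one_apply]
    rw [dif_neg (by omega)]
    simp
  · have hi := splitIdx_inl h i
    simp only [Matrix.submatrix_apply, blockM, Matrix.fromBlocks_apply₁₂]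
    rw [dif_neg (by omega), if_neg (by simp)]
    rfl
  · have hj := splitIdx_inl h j
    simp only [Matrix.submatrix_apply, blockM, Matrix.fromBlocks_apply₂₁]
    rw [dif_neg (by omega), if_neg (by simp)]
    rfl
  · simp only [Matrix.submatrix_apply, blockM, Matrix.fromBlocks_apply₂₂, splitIdx_inr, tailIdx]
    rw [dif_pos (by simp)]
    congr 1 <;> exact Fin.ext (by simp)

theorem det_blockM {d n : ℕ} (h : d ≤ n) (Q : Matrix (Fin d) (Fin d) ℝ) :
    (blockM h Q).det = Q.det := by
  rw [← Matrix.det_submatrix_equiv_self (splitIdx h), blockM_submatrix,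
    Matrix.det_fromBlocks_zero₁₂, Matrix.det_one, one_mul]

theorem cong_blockM_submatrix {d n : ℕ} (h : d ≤ n) (Q : Matrix (Fin d) (Fin d) ℝ) (x : Sym n) :
    (cong (blockM h Q) x).1.submatrix (splitIdx h) (splitIdx h) =
      (Matrix.fromBlocks 1 0 0 Q)ᵀ * x.1.submatrix (splitIdx h) (splitIdx h) *
        Matrix.fromBlocks 1 0 0 Q := by
  rw [← blockM_submatrix h, Matrix.transpose_submatrix, Matrix.submatrix_mul_equiv,
    Matrix.submatrix_mul_equiv]
  rfl

theorem lowerRight_val {d n : ℕ} (h : d ≤ n) (x : Sym n) :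
    (lowerRight h x).1 = (x.1.submatrix (splitIdx h) (splitIdx h)).toBlocks₂₂ := by
  ext i j
  simp only [Matrix.toBlocks₂₂, Matrix.of_apply, Matrix.submatrix_apply, splitIdx_inr]
  rfl

theorem lowerRight_cong_blockM {d n : ℕ} (h : d ≤ n) (Q : Matrix (Fin d) (Fin d) ℝ) (x : Sym n) :
    lowerRight h (cong (blockM h Q) x) = cong Q (lowerRight h x) := by
  apply Subtype.ext
  change _ = Qᵀ * (lowerRight h x).1 * Q
  rw [lowerRight_val, lowerRight_val, cong_blockM_submatrix,
    ← Matrix.fromBlocks_toBlocks (x.1.submatrix (splitIdx h) (splitIdx h)),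
    Matrix.fromBlocks_transpose, Matrix.fromBlocks_multiply, Matrix.fromBlocks_multiply]
  simp

theorem blockM_blockM {d D n : ℕ} (h : d ≤ D) (h' : D ≤ n) (Q : Matrix (Fin d) (Fin d) ℝ) :
    blockM h' (blockM h Q) = blockM (h.trans h') Q := by
  ext i j
  unfold blockM
  by_cases hi : n - D ≤ (i : ℕ) ∧ n - D ≤ (j : ℕ)
  · rw [dif_pos hi]
    by_cases hj : n - d ≤ (i : ℕ) ∧ n - d ≤ (j : ℕ)
    · rw [dif_pos hj, dif_pos (by simp only; omega)]
      congr 1 <;> exact Fin.ext (by simp only; omega)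
    · rw [dif_neg hj, dif_neg (by simp only; omega)]
      simp only [Fin.ext_iff]
      congr 1
      exact propext (by omega)
  · rw [dif_neg hi, dif_neg (by omega)]

theorem pad_submatrix {d k D : ℕ} (h : d ≤ D) (hk : k + d ≤ D) (Ah : Matrix (Fin k) (Fin k) ℝ) :
    (pad D Ah).submatrix (splitIdx h) (splitIdx h) =
      Matrix.fromBlocks (pad (D - d) Ah) 0 0 0 := by
  ext (i | i) (j | j)
  · simp [pad, splitIdx_inl]
  · simp only [Matrix.submatrix_apply, pad, splitIdx_inr, tailIdx, Matrix.fromBlocks_apply₁₂]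
    rw [dif_neg (by omega)]
    rfl
  · simp only [Matrix.submatrix_apply, pad, splitIdx_inr, tailIdx, Matrix.fromBlocks_apply₂₁]
    rw [dif_neg (by omega)]
    rfl
  · simp only [Matrix.submatrix_apply, pad, splitIdx_inr, tailIdx, Matrix.fromBlocks_apply₂₂]
    rw [dif_neg (by omega)]
    rfl

/-- The block `Â` lies where `I ⊕ Q` is the identity, and `Q` acts on zeros only. -/
theorem cong_blockM_pad {d k D : ℕ} (h : d ≤ D) (hk : k + d ≤ D) (Q : Matrix (Fin d) (Fin d) ℝ)
    {Ah : Matrix (Fin k) (Fin k) ℝ} {x : Sym D} (hx : x.1 = pad D Ah) :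
    (cong (blockM h Q) x).1 = pad D Ah := by
  have h1 := cong_blockM_submatrix h Q x
  rw [hx, pad_submatrix h hk, Matrix.fromBlocks_transpose, Matrix.fromBlocks_multiply,
    Matrix.fromBlocks_multiply] at h1
  have h2 : (cong (blockM h Q) x).1.submatrix (splitIdx h) (splitIdx h) =
      (pad D Ah).submatrix (splitIdx h) (splitIdx h) := by
    rw [h1, pad_submatrix h hk]
    simp
  ext i j
  have := congrFun (congrFun h2 ((splitIdx h).symm i)) ((splitIdx h).symm j)
  simpa using this

/-- Congruences chosen later act on the last `d` coordinates, beyond the blocks of all directions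
found so far, so they do not spoil these directions. -/
theorem DirsOK.cong_blockM {n d : ℕ} {L : Submodule ℝ (Sym n)} {P : Matrix (Fin n) (Fin n) ℝ}
    (hd : d ≤ n) (Q : Matrix (Fin d) (Fin d) ℝ) {o : ℕ} {l : List (ℕ × Sym n)}
    (hl : DirsOK L P o l) (hsum : o + (l.map Prod.fst).sum + d = n) :
    DirsOK L (P * blockM hd Q) o (l.map fun a => (a.1, cong (blockM hd Q) a.2)) := by
  induction l generalizing o with
  | nil => trivial
  | cons a l ih =>
    obtain ⟨⟨h1, ⟨x, hx, h2⟩, Ah, h3, h4⟩, h5⟩ := hl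
    simp only [List.map_cons, List.sum_cons] at hsum
    refine ⟨⟨h1, ⟨x, hx, ?_⟩, Ah, h3, ?_⟩, ih (o := o + a.1) h5 (by omega)⟩
    · rw [cong_mul, h2]
    · have hdo : d ≤ n - o := by omega
      simp only
      rw [← blockM_blockM hdo (Nat.sub_le n o), lowerRight_cong_blockM]
      exact cong_blockM_pad (k := a.1) hdo (by omega) Q h4

theorem eq_zero_of_rank_eq_zero {d : ℕ} {A : Matrix (Fin d) (Fin d) ℝ} (h : A.rank = 0) :
    A = 0 := by
  have h1 : LinearMap.range A.mulVecLin = ⊥ := Submodule.finrank_eq_zero.mp h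
  rw [LinearMap.range_eq_bot] at h1
  ext i j
  have h2 := congrFun (LinearMap.congr_fun h1 (Pi.single j 1)) i
  simpa using h2

/-- What holds in every state that the forward procedure reaches. -/
structure FPState.Good {n : ℕ} (L : Submodule ℝ (Sym n)) (s : FPState n) : Prop where
  det : IsUnit s.P.det
  lin : s.Lt = (L.map (cong s.P)).map (lowerRight s.d_le)
  dirs : DirsOK L s.P 0 s.dirs

theorem FPState.good_init {n : ℕ} (L : Submodule ℝ (Sym n)) (c : Sym n) :
    (FPState.init L c).Good L where
  det := by simp [FPState.init]
  lin := by
    have h1 : lowerRight (FPState.init L c).d_le = LinearMap.id :=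
      LinearMap.ext fun x => lowerRight_self _ x
    have h2 : cong (FPState.init L c).P = LinearMap.id :=
      LinearMap.ext fun x => Subtype.ext (by
        change (1 : Matrix (Fin n) (Fin n) ℝ)ᵀ * x.1 * 1 = x.1
        simp)
    rw [h1, h2]
    erw [Submodule.map_id, Submodule.map_id]
    rfl
  dirs := trivial

/-- Two reductions in succession amount to one with the product congruence, because `I ⊕ Q` acts on
the lower right block as `Q`. The new block is nonempty since a matrix of trace one has positive
rank. -/
theorem FPStep.good {n : ℕ} {L : Submodule ℝ (Sym n)} {s s' : FPState n} (h : FPStep L s s')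
    (hs : s.Good L) : s'.Good L := by
  obtain ⟨At, Q, Ah, A, hd, ⟨hAt, hAtK, htr⟩, ⟨hQ, hAh, hpad⟩, hP, ⟨hA, hlow⟩, hdirs, hrank, hLt,
    hct⟩ := h
  have hsum := s.size_eq
  refine ⟨?_, ?_, ?_⟩
  · rw [hP, Matrix.det_mul, det_blockM]
    exact hs.det.mul hQ
  · rw [hLt, hs.lin, hP, ← Submodule.map_comp, ← Submodule.map_comp, ← Submodule.map_comp,
      ← Submodule.map_comp]
    congr 1
    refine LinearMap.ext fun x => ?_
    change lowerRight hd (cong Q (lowerRight s.d_le (cong s.P x))) =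
      lowerRight s'.d_le (cong (s.P * blockM s.d_le Q) x)
    rw [cong_mul, ← lowerRight_cong_blockM, lowerRight_trans]
  · rw [hdirs, dirsOK_append, hP]
    refine ⟨hs.dirs.cong_blockM s.d_le Q (by omega), ⟨?_, hP ▸ hA, Ah, hAh, ?_⟩, trivial⟩
    · rw [Nat.pos_iff_ne_zero]
      intro h0
      have h1 : At.1 = 0 := eq_zero_of_rank_eq_zero h0
      rw [h1, Matrix.trace_zero] at htr
      exact zero_ne_one htr
    · have : ∀ E (hE : E ≤ n), E = s.d → (lowerRight s.d_le A).1 = pad s.d Ah →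
          (lowerRight hE A).1 = pad E Ah := by
        rintro E hE rfl h
        exact h
      refine this _ _ ?_ ?_
      · simp only [List.map_map, zero_add]
        have : (Prod.fst ∘ fun kA : ℕ × Sym n => (kA.1, cong (blockM s.d_le Q) kA.2)) = Prod.fst :=
          rfl
        rw [this]
        omega
      · rw [hlow]
        exact hpad

theorem FPState.good_of_reach {n : ℕ} {L : Submodule ℝ (Sym n)} {c : Sym n} {s : FPState n}
    (h : Relation.ReflTransGen (FPStep L) (FPState.init L c) s) : s.Good L := by
  induction h with
  | refl => exact FPState.good_init L c
  | tail _ h2 ih => exact h2.good ih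

theorem IsFPOutput.meetsSpec {n : ℕ} {L : Submodule ℝ (Sym n)} {c : Sym n} {O : FPOutput n}
    (h : IsFPOutput L c O) : O.MeetsSpec L := by
  obtain ⟨s, B, hreach, hB⟩ := h
  have hs := FPState.good_of_reach hreach
  refine meetsSpec_iff.mpr ⟨hs.det, hs.dirs, ?_, hB.2⟩
  have := hB.1
  rw [hs.lin] at this
  exact this

/-- Orthogonal diagonalisation, followed by a permutation that moves the nonzero eigenvalues to the
front; these are positive, and their number is the rank. -/
theorem exists_congruence {d : ℕ} {A : Sym d} (hA : A ∈ K d) :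
    ∃ Q : Matrix (Fin d) (Fin d) ℝ, IsUnit Q.det ∧
      ∃ Ah : Matrix (Fin A.1.rank) (Fin A.1.rank) ℝ, Ah.PosDef ∧
        Qᵀ * A.1 * Q = pad d Ah := by
  have hH := A.isHermitian
  have hk : A.1.rank ≤ d := by simpa using A.1.rank_le_width
  have hcard : Fintype.card {i : Fin d // (i : ℕ) < A.1.rank} =
      Fintype.card {i // hH.eigenvalues i ≠ 0} := by
    rw [← hH.rank_eq_card_non_zero_eigs]
    have e : {i : Fin d // (i : ℕ) < A.1.rank} ≃ Fin A.1.rank :=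
      { toFun := fun i => ⟨i.1, i.2⟩
        invFun := fun i => ⟨⟨i, by omega⟩, i.2⟩
        left_inv := fun i => rfl
        right_inv := fun i => rfl }
    rw [Fintype.card_congr e, Fintype.card_fin]
  let e := Fintype.equivOfCardEq hcard
  -- A bijection between the first `rank` positions and the positions of the nonzero eigenvalues,
  -- extended to a permutation of all positions.
  let σ : Equiv.Perm (Fin d) := e.extendSubtype
  let U : Matrix (Fin d) (Fin d) ℝ := hH.eigenvectorUnitary
  have hUU : Uᵀ * U = 1 := by
    have := Unitary.coe_star_mul_self hH.eigenvectorUnitary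
    rwa [Matrix.star_eq_conjTranspose, Matrix.conjTranspose_eq_transpose_of_trivial] at this
  have hdiag : Uᵀ * A.1 * U = Matrix.diagonal hH.eigenvalues := by
    have := hH.conjStarAlgAut_star_eigenvectorUnitary
    rw [Unitary.conjStarAlgAut_star_apply, Matrix.star_eq_conjTranspose,
      Matrix.conjTranspose_eq_transpose_of_trivial] at this
    exact this
  have hQ : (U.submatrix id σ)ᵀ * A.1 * U.submatrix id σ =
      Matrix.diagonal (hH.eigenvalues ∘ σ) := by
    have h2 := congrArg (fun M => M.submatrix σ σ) hdiag
    simp only [Matrix.submatrix_diagonal_equiv] at h2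
    rw [← h2]
    rfl
  refine ⟨U.submatrix id σ, ?_, Matrix.diagonal fun i : Fin A.1.rank =>
    hH.eigenvalues (σ ⟨i, by omega⟩), ?_, ?_⟩
  · rw [Matrix.det_permute', IsUnit.mul_iff]
    refine ⟨?_, ?_⟩
    · exact (Int.isUnit_iff.mp (Equiv.Perm.sign σ).isUnit).elim (fun h => by simp [h])
        (fun h => by simp [h])
    · have := congrArg Matrix.det hUU
      rw [Matrix.det_mul, Matrix.det_one] at this
      exact IsUnit.of_mul_eq_one _ ((mul_comm _ _).trans this)
  · rw [Matrix.posDef_diagonal_iff]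
    intro i
    refine lt_of_le_of_ne (Matrix.PosSemidef.eigenvalues_nonneg hA _) (Ne.symm ?_)
    exact e.extendSubtype_mem ⟨(i : ℕ), by omega⟩ i.2
  · rw [hQ]
    ext i j
    simp only [Matrix.diagonal_apply, pad, Function.comp]
    by_cases hij : i = j
    · subst hij
      rw [if_pos rfl]
      by_cases hi : (i : ℕ) < A.1.rank
      · rw [dif_pos ⟨hi, hi⟩, if_pos rfl]
      · rw [dif_neg (by omega)]
        have := e.extendSubtype_not_mem i hi
        simpa using this
    · rw [if_neg hij]
      split_ifs with h1 h2
      · exact absurd (Fin.ext (by simpa using h2)) hij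
      · rfl
      · rfl

/-- Induction on a bound for the size of the current subproblem, which every direction lowers. At
size zero the empty matrix is positive definite, so the subproblem, and with it the original
problem, would be strongly feasible. -/
theorem exists_fpOutput_of_reach {n : ℕ} {L : Submodule ℝ (Sym n)} {c : Sym n}
    (hSF : ¬ StronglyFeasible L c) (k : ℕ) (s : FPState n) (hk : s.d ≤ k)
    (h : Relation.ReflTransGen (FPStep L) (FPState.init L c) s) :
    ∃ O : FPOutput n, IsFPOutput L c O := by
  induction k generalizing s with
  | zero =>
    exfalso
    have hs := FPState.good_of_reach h
    apply hSF
    rw [stronglyFeasible_last_iff hs.det c s.d_le hs.dirs s.size_eq, stronglyFeasible_iff]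
    refine ⟨0, Submodule.zero_mem _, (Sym.posDef_iff _).mpr fun v hv => absurd ?_ hv⟩
    ext i
    have := i.2
    omega
  | succ k ih =>
    have hs := FPState.good_of_reach h
    by_cases hd : s.d = 0
    · exact ih s (by omega) h
    rcases exists_psd_or_perp_posDef s.Lt with ⟨A₀, hA₀, hK₀, hne⟩ | ⟨B, hB, hpd⟩
    · have htr := trace_pos_of_ne_zero hK₀ hne
      let At : Sym s.d := (A₀.1.trace)⁻¹ • A₀
      have hAt : At ∈ s.Lt := s.Lt.smul_mem _ hA₀
      have hAtK : At ∈ K s.d := Matrix.PosSemidef.smul hK₀ (inv_nonneg.mpr htr.le)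
      have hAttr : At.1.trace = 1 := by
        change ((A₀.1.trace)⁻¹ • A₀.1).trace = 1
        rw [Matrix.trace_smul, smul_eq_mul, inv_mul_cancel₀ htr.ne']
      obtain ⟨Q, hQ, Ah, hAh, hpad⟩ := exists_congruence hAtK
      have hrank : At.1.rank ≤ s.d := by simpa using At.1.rank_le_width
      have hrpos : 0 < At.1.rank := by
        rw [Nat.pos_iff_ne_zero]
        intro h0
        have h1 : At.1 = 0 := eq_zero_of_rank_eq_zero h0
        rw [h1, Matrix.trace_zero] at hAttr
        exact zero_ne_one hAttr
      -- The current subspace is an image of `L`, so the direction lifts to an element `l` of `L`.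
      obtain ⟨_, ⟨l, hl, rfl⟩, hlow⟩ := hs.lin ▸ hAt
      have hle : s.d - At.1.rank ≤ s.d := Nat.sub_le _ _
      let s' : FPState n :=
        { dirs := s.dirs.map (fun kA => (kA.1, cong (blockM s.d_le Q) kA.2)) ++
            [(At.1.rank, cong (s.P * blockM s.d_le Q) l)]
          d := s.d - At.1.rank
          size_eq := by
            have := s.size_eq
            have h2 : (Prod.fst ∘ fun kA : ℕ × Sym n => (kA.1, cong (blockM s.d_le Q) kA.2)) =
              Prod.fst := rfl
            simp only [List.map_append, List.map_map, List.sum_append, h2, List.map_cons,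
              List.map_nil, List.sum_cons, List.sum_nil]
            omega
          P := s.P * blockM s.d_le Q
          Lt := (s.Lt.map (cong Q)).map (lowerRight hle)
          ct := lowerRight hle (cong Q s.ct) }
      refine ih s' (show s.d - At.1.rank ≤ k by omega) (h.tail ?_)
      refine ⟨At, Q, Ah, cong (s.P * blockM s.d_le Q) l, hle, ⟨hAt, hAtK, hAttr⟩,
        ⟨hQ, hAh, hpad⟩, rfl, ⟨⟨l, hl, rfl⟩, ?_⟩, rfl, ?_, rfl, rfl⟩
      · rw [cong_mul, lowerRight_cong_blockM, hlow]
      · change s.d - At.1.rank + At.1.rank = s.d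
        omega
    · have : Nonempty (Fin s.d) := ⟨⟨0, by omega⟩⟩
      have htr : 0 < B.1.trace := hpd.trace_pos
      refine ⟨_, IsFPOutput.final s ((B.1.trace)⁻¹ • B) h ⟨?_, ?_, ?_⟩⟩
      · intro x hx
        rw [ip_smul_left, hB x hx, mul_zero]
      · exact mem_interior_K.mpr (Matrix.PosDef.smul hpd (inv_pos.mpr htr))
      · change ((B.1.trace)⁻¹ • B.1).trace = 1
        rw [Matrix.trace_smul, smul_eq_mul, inv_mul_cancel₀ htr.ne']

theorem exists_fpOutput {n : ℕ} {L : Submodule ℝ (Sym n)} {c : Sym n} (h : WeakStatus L c) :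
    ∃ O : FPOutput n, IsFPOutput L c O :=
  exists_fpOutput_of_reach (weakStatus_iff.mp h).2 n (FPState.init L c) le_rfl .refl

theorem weakStatus_iff_cert {n : ℕ} {L : Submodule ℝ (Sym n)} {c : Sym n} :
    WeakStatus L c ↔ ∃ D : WeakCert n, D.IsValid L c := by
  constructor
  · intro h
    obtain ⟨O, hO⟩ := exists_fpOutput h
    obtain ⟨x, y, hxy⟩ := (weakStatus_iff_of_meetsSpec hO.meetsSpec c).mp h
    exact ⟨⟨O, x, y⟩, hO.meetsSpec, hxy⟩
  · rintro ⟨D, hD, hxy⟩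
    exact (weakStatus_iff_of_meetsSpec hD c).mpr ⟨_, _, hxy⟩

/-- This supplies the short certificates for the complement: one symmetric matrix in either case. -/
theorem not_weakStatus_iff {n : ℕ} {L : Submodule ℝ (Sym n)} {c : Sym n} :
    ¬ WeakStatus L c ↔
      (∃ x : Sym n, StrongFeasCert L c x) ∨ ∃ s : Sym n, StrongInfeasCert L c s := by
  rw [weakStatus_iff]
  constructor
  · intro h
    by_cases hA : AlmostFeasible L c
    · obtain ⟨l, hl, hpd⟩ := stronglyFeasible_iff.mp (not_not.mp fun hS => h ⟨hA, hS⟩)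
      exact Or.inl ⟨l + c, ⟨l, hl, rfl⟩, hpd⟩
    · exact Or.inr (exists_strongInfeasCert hA)
  · rintro (⟨x, hx, hpd⟩ | ⟨s, hs⟩) ⟨h1, h2⟩
    · exact h2 ⟨x, hx, mem_interior_K.mpr hpd⟩
    · exact not_almostFeasible_of_strongInfeasCert hs h1

theorem strong_of_not_weakStatus {n : ℕ} {L : Submodule ℝ (Sym n)} {c : Sym n}
    (h : ¬ WeakStatus L c) :
    (StronglyFeasible L c ∧ ∃ x : Sym n, StrongFeasCert L c x) ∨
      (StronglyInfeasible L c ∧ ∃ s : Sym n, StrongInfeasCert L c s) := by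
  rcases not_weakStatus_iff.mp h with ⟨x, hx, hpd⟩ | ⟨s, hs⟩
  · exact Or.inl ⟨⟨x, hx, mem_interior_K.mpr hpd⟩, x, hx, hpd⟩
  · have hA := not_almostFeasible_of_strongInfeasCert hs
    refine Or.inr ⟨⟨?_, ?_⟩, s, hs⟩
    · rw [← Set.not_nonempty_iff_eq_empty]
      exact fun hne => hA (almostFeasible_of_feasible hne)
    · refine lt_of_le_of_ne (setDist_nonneg _ _) fun h0 => hA ?_
      exact setDist_eq_zero_iff.mp h0.symm

end SDFP

/-! ### Formulas -/

namespace BSS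

namespace Ex

variable {m : Mode}

noncomputable def neg (a : Ex m) : Ex m := .mul (.const (-1)) a

noncomputable def sub (a b : Ex m) : Ex m := .add a (neg b)

/-- An expression is true if its value is nonnegative. -/
def Sat (N : ℕ) (z : ℕ → ℝ) (ρ : ℕ → ℕ) (M : ℕ → ℕ → ℝ) (a : Ex m) : Prop := 0 ≤ a.eval N z ρ M

def conj (a b : Ex m) : Ex m := .ite a b a

def disj (a b : Ex m) : Ex m := .ite a a b

noncomputable def nt (a : Ex m) : Ex m := .ite a (.const (-1)) (.const 0)

noncomputable def imp (a b : Ex m) : Ex m := disj (nt a) b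

noncomputable def le (a b : Ex m) : Ex m := sub b a

noncomputable def lt (a b : Ex m) : Ex m := nt (le b a)

noncomputable def eq (a b : Ex m) : Ex m := neg (.mul (sub a b) (sub a b))

/-- The sum counts the counterexamples; its negative is nonnegative only if there are none. -/
noncomputable def all (v : ℕ) (a : Ex m) : Ex m := neg (.sum v (.ite a (.const 0) (.const 1)))

noncomputable def ex (v : ℕ) (a : Ex m) : Ex m := nt (all v (nt a))

/-- Sum over `v < b`. -/
noncomputable def sumTo (v : ℕ) (b a : Ex m) : Ex m :=
  .sum v (.ite (lt (.idx v) b) a (.const 0))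

/-- Universal quantification over `v < b`. -/
noncomputable def allTo (v : ℕ) (b a : Ex m) : Ex m := all v (imp (lt (.idx v) b) a)

variable {N : ℕ} {z : ℕ → ℝ} {ρ : ℕ → ℕ} {M : ℕ → ℕ → ℝ} {a b c : Ex m} {v : ℕ}

theorem eval_const (r : ℝ) : (const r : Ex m).eval N z ρ M = r := by rw [eval]

theorem eval_idx : (idx v : Ex m).eval N z ρ M = ρ v := by rw [eval]

theorem eval_mat (u v : ℕ) : (mat u v).eval N z ρ M = M (ρ u) (ρ v) := by rw [eval]

theorem eval_add : (add a b).eval N z ρ M = a.eval N z ρ M + b.eval N z ρ M := by rw [eval]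

theorem eval_mul : (mul a b).eval N z ρ M = a.eval N z ρ M * b.eval N z ρ M := by rw [eval]

theorem eval_div : (div a b).eval N z ρ M = a.eval N z ρ M / b.eval N z ρ M := by rw [eval]

open Classical in
theorem eval_ite : (ite a b c).eval N z ρ M =
    if Sat N z ρ M a then b.eval N z ρ M else c.eval N z ρ M := by rw [eval]; rfl

theorem eval_sum : (sum v a).eval N z ρ M =
    ∑ k ∈ Finset.range N, a.eval N z (Function.update ρ v k) M := by rw [eval]

theorem eval_neg : (neg a).eval N z ρ M = -a.eval N z ρ M := by
  rw [neg, eval_mul, eval_const]; ring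

theorem eval_sub : (sub a b).eval N z ρ M = a.eval N z ρ M - b.eval N z ρ M := by
  rw [sub, eval_add, eval_neg]; ring

theorem eval_get (hz : ∀ k, N ≤ k → z k = 0) {q : ℕ} (h : a.eval N z ρ M = q) :
    (get a).eval N z ρ M = z q := by
  classical
  rw [eval, h]
  by_cases hq : q < N
  · rw [Finset.sum_eq_single q]
    · simp
    · intro k _ hk
      rw [if_neg]
      exact_mod_cast hk.symm
    · intro h'
      exact absurd (Finset.mem_range.mpr hq) h'
  · rw [hz q (not_lt.mp hq), Finset.sum_eq_zero]
    intro k hk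
    rw [Finset.mem_range] at hk
    rw [if_neg]
    intro h'
    have : q = k := by exact_mod_cast h'
    omega

theorem sat_conj : Sat N z ρ M (conj a b) ↔ Sat N z ρ M a ∧ Sat N z ρ M b := by
  unfold conj
  rw [Sat, eval_ite]
  by_cases h : Sat N z ρ M a
  · rw [if_pos h]; exact ⟨fun h' => ⟨h, h'⟩, fun h' => h'.2⟩
  · rw [if_neg h]; exact ⟨fun h' => absurd h' h, fun h' => absurd h'.1 h⟩

theorem sat_disj : Sat N z ρ M (disj a b) ↔ Sat N z ρ M a ∨ Sat N z ρ M b := by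
  unfold disj
  rw [Sat, eval_ite]
  by_cases h : Sat N z ρ M a
  · rw [if_pos h]; exact ⟨fun h' => Or.inl h, fun _ => h⟩
  · rw [if_neg h]; exact ⟨fun h' => Or.inr h', fun h' => h'.resolve_left h⟩

theorem sat_nt : Sat N z ρ M (nt a) ↔ ¬ Sat N z ρ M a := by
  unfold nt
  rw [Sat, eval_ite]
  by_cases h : Sat N z ρ M a
  · rw [if_pos h, eval_const]; exact ⟨fun h' => by linarith, fun h' => absurd h h'⟩
  · rw [if_neg h, eval_const]; exact ⟨fun _ => h, fun _ => le_rfl⟩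

theorem sat_imp : Sat N z ρ M (imp a b) ↔ (Sat N z ρ M a → Sat N z ρ M b) := by
  rw [imp, sat_disj, sat_nt, imp_iff_not_or]

theorem sat_le : Sat N z ρ M (le a b) ↔ a.eval N z ρ M ≤ b.eval N z ρ M := by
  rw [Sat, le, eval_sub, sub_nonneg]

theorem sat_lt : Sat N z ρ M (lt a b) ↔ a.eval N z ρ M < b.eval N z ρ M := by
  rw [lt, sat_nt, sat_le, not_le]

theorem sat_eq : Sat N z ρ M (eq a b) ↔ a.eval N z ρ M = b.eval N z ρ M := by
  rw [Sat, eq, eval_neg, eval_mul, eval_sub, ← sub_eq_zero (b := b.eval N z ρ M)]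
  constructor
  · intro h
    exact mul_self_eq_zero.mp (le_antisymm (by linarith) (mul_self_nonneg _))
  · intro h
    rw [h]; simp

theorem sat_all : Sat N z ρ M (all v a) ↔ ∀ k < N, Sat N z (Function.update ρ v k) M a := by
  classical
  rw [Sat, all, eval_neg, eval_sum]
  simp only [eval_ite, eval_const]
  rw [neg_nonneg]
  constructor
  · intro h k hk
    by_contra hcon
    have h1 : (1 : ℝ) ≤ ∑ k ∈ Finset.range N,
        if Sat N z (Function.update ρ v k) M a then (0 : ℝ) else 1 := by
      refine le_trans ?_ (Finset.single_le_sum (f := fun k =>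
        if Sat N z (Function.update ρ v k) M a then (0 : ℝ) else 1)
        (fun i _ => by positivity) (Finset.mem_range.mpr hk))
      rw [if_neg hcon]
    linarith
  · intro h
    refine (Finset.sum_eq_zero fun k hk => ?_).le
    rw [if_pos (h k (Finset.mem_range.mp hk))]

theorem sat_ex : Sat N z ρ M (ex v a) ↔ ∃ k < N, Sat N z (Function.update ρ v k) M a := by
  rw [ex, sat_nt, sat_all]
  simp only [sat_nt]
  push Not
  rfl

theorem eval_sumTo {B : ℕ} (hB : B ≤ N)
    (hb : ∀ k < N, b.eval N z (Function.update ρ v k) M = B) :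
    (sumTo v b a).eval N z ρ M =
      ∑ k ∈ Finset.range B, a.eval N z (Function.update ρ v k) M := by
  classical
  rw [sumTo, eval_sum]
  simp only [eval_ite, sat_lt, eval_idx, eval_const, Function.update_self]
  rw [← Finset.sum_subset (Finset.range_subset_range.mpr hB)]
  · refine Finset.sum_congr rfl fun k hk => ?_
    rw [Finset.mem_range] at hk
    rw [if_pos]
    rw [hb k (by omega)]
    exact_mod_cast hk
  · intro k hk hk'
    rw [Finset.mem_range] at hk hk'
    rw [if_neg]
    rw [hb k hk, not_lt]
    exact_mod_cast not_lt.mp hk'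

theorem sat_allTo {B : ℕ} (hB : B ≤ N)
    (hb : ∀ k < N, b.eval N z (Function.update ρ v k) M = B) :
    Sat N z ρ M (allTo v b a) ↔ ∀ k < B, Sat N z (Function.update ρ v k) M a := by
  rw [allTo, sat_all]
  simp only [sat_imp, sat_lt, eval_idx, Function.update_self]
  constructor
  · intro h k hk
    refine h k (by omega) ?_
    rw [hb k (by omega)]
    exact_mod_cast hk
  · intro h k hk hk'
    rw [hb k hk] at hk'
    exact h k (by exact_mod_cast hk')

end Ex

end BSS

namespace SDFP

open BSS BSS.Ex

/-! ### Elimination as an expression -/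

/-- One step of symmetric elimination. -/
noncomputable def elimBody : Ex .inner :=
  .ite (conj (lt (.idx 0) (.idx 1)) (lt (.idx 0) (.idx 2)))
    (sub (.mat 1 2) (.div (.mul (.mat 1 0) (.mat 0 2)) (.mat 0 0))) (.mat 1 2)

section Tests

variable {N : ℕ} {z : ℕ → ℝ} {ρ : ℕ → ℕ} {M : ℕ → ℕ → ℝ}

theorem sat_iter_elim {g : Ex .plain} {out : Ex .inner} :
    Sat N z ρ M (.iter g elimBody out) ↔ Sat N z ρ (elim
      (fun i j => g.eval N z (Function.update (Function.update ρ 1 i) 2 j) M) N) out := by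
  rw [Sat, eval, Sat]
  have h : ∀ T, (Nat.rec
      (fun i j => g.eval N z (Function.update (Function.update ρ 1 i) 2 j) M)
      (fun t A i j => elimBody.eval N z
        (Function.update (Function.update (Function.update ρ 0 t) 1 i) 2 j) A) T : ℕ → ℕ → ℝ) =
      elim (fun i j => g.eval N z (Function.update (Function.update ρ 1 i) 2 j) M) T := by
    intro T
    induction T with
    | zero => rfl
    | succ t ih =>
      funext i j
      rw [elim, ← ih]
      simp [elimBody, eval_ite, sat_conj, sat_lt, eval_idx, eval_sub, eval_mat, eval_div, eval_mul]
  rw [h]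

/-- Tests whether the matrix of size `d` with entries `g` is positive definite. -/
noncomputable def pdTest (d : Ex .inner) (g : Ex .plain) : Ex .outer :=
  .iter g elimBody (allTo 0 d (lt (.const 0) (.mat 0 0)))

/-- Tests whether the matrix of size `d` with entries `g` is positive semidefinite. -/
noncomputable def psdTest (d : Ex .inner) (g : Ex .plain) : Ex .outer :=
  .iter g elimBody (allTo 0 d (allTo 1 d (imp (le (.idx 0) (.idx 1))
    (conj (le (.const 0) (.mat 0 0)) (imp (eq (.mat 0 0) (.const 0)) (eq (.mat 0 1) (.const 0)))))))

/-- Tests, for the matrix `g` of inner products of `R + 1` vectors, whether the last vector is a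
combination of the others. -/
noncomputable def spanTest (R : Ex .inner) (g : Ex .plain) : Ex .outer :=
  -- A matrix entry is addressed by index variables only, so the position `R` is reached by a
  -- variable that is required to equal it.
  .iter g elimBody (all 0 (imp (eq (.idx 0) R) (eq (.mat 0 0) (.const 0))))

theorem sat_pdTest {d : Ex .inner} {g : Ex .plain} {D : ℕ} {G : ℕ → ℕ → ℝ} (hD : D ≤ N)
    (hd : ∀ k A, d.eval N z (Function.update ρ 0 k) A = D)
    (hg : ∀ i j, g.eval N z (Function.update (Function.update ρ 1 i) 2 j) M = G i j)
    (hG : SymmOn D G) : Sat N z ρ M (pdTest d g) ↔ QfPos D G := by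
  rw [pdTest, sat_iter_elim, sat_allTo hD (fun k _ => hd k _), qfPos_iff_elim hG hD]
  simp only [hg, sat_lt, eval_const, eval_mat, Function.update_self]

theorem sat_psdTest {d : Ex .inner} {g : Ex .plain} {D : ℕ} {G : ℕ → ℕ → ℝ} (hD : D ≤ N)
    (hd : ∀ k A, d.eval N z (Function.update ρ 0 k) A = D)
    (hd' : ∀ k l A, d.eval N z (Function.update (Function.update ρ 0 k) 1 l) A = D)
    (hg : ∀ i j, g.eval N z (Function.update (Function.update ρ 1 i) 2 j) M = G i j)
    (hG : SymmOn D G) : Sat N z ρ M (psdTest d g) ↔ QfNonneg D G := by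
  rw [psdTest, sat_iter_elim, sat_allTo hD (fun k _ => hd k _), qfNonneg_iff_elim hG hD]
  refine forall₂_congr fun t _ => ?_
  rw [sat_allTo hD (fun k _ => hd' t k _)]
  simp [hg, sat_imp, sat_conj, sat_le, sat_eq, eval_const, eval_mat, eval_idx]

theorem sat_spanTest {R : Ex .inner} {g : Ex .plain} {d : ℕ} {G : ℕ → ℕ → ℝ} (hd : d < N)
    (hR : ∀ k A, R.eval N z (Function.update ρ 0 k) A = d)
    (hg : ∀ i j, g.eval N z (Function.update (Function.update ρ 1 i) 2 j) M = G i j) :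
    Sat N z ρ M (spanTest R g) ↔ elim G N d d = 0 := by
  rw [spanTest, sat_iter_elim, sat_all]
  simp only [hg, sat_imp, sat_eq, eval_const, eval_mat, eval_idx, Function.update_self, hR,
    Nat.cast_inj]
  exact ⟨fun h => h d hd rfl, fun h k _ hk => hk ▸ h⟩

end Tests

end SDFP

/-! ### Arithmetic notation and entries of the input -/

namespace BSS.Ex

noncomputable instance (m : Mode) : Add (Ex m) := ⟨.add⟩

noncomputable instance (m : Mode) : Mul (Ex m) := ⟨.mul⟩

noncomputable instance (m : Mode) : Sub (Ex m) := ⟨.sub⟩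

variable {m : Mode} {N : ℕ} {z : ℕ → ℝ} {ρ : ℕ → ℕ} {M : ℕ → ℕ → ℝ} {a b : Ex m}

theorem eval_add' : (a + b).eval N z ρ M = a.eval N z ρ M + b.eval N z ρ M := eval_add

theorem eval_mul' : (a * b).eval N z ρ M = a.eval N z ρ M * b.eval N z ρ M := eval_mul

theorem eval_sub' : (a - b).eval N z ρ M = a.eval N z ρ M - b.eval N z ρ M := eval_sub

open Classical in
/-- The entry of the input in position `x`. -/
noncomputable def entry (N : ℕ) (z : ℕ → ℝ) (x : ℝ) : ℝ :=
  ∑ k ∈ Finset.range N, if x = k then z k else 0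

theorem eval_get' : (get a).eval N z ρ M = entry N z (a.eval N z ρ M) := by rw [eval, entry]

theorem entry_natCast (hz : ∀ k, N ≤ k → z k = 0) (q : ℕ) : entry N z q = z q := by
  have := eval_get (m := .plain) (a := .const q) (ρ := 0) (M := 0) hz (q := q)
    (by rw [eval_const])
  rwa [eval_get', eval_const] at this

end BSS.Ex

namespace SDFP

open BSS BSS.Ex

/-! ### Expressions for the data of an instance -/

section Data

variable {m : Mode}

/-- The size `n` of the matrices. -/
noncomputable def nE : Ex m := .get (.const 1)

/-- The number `r` of equations. -/
noncomputable def rE : Ex m := .get (.const 2)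

/-- The coefficients of the equations. -/
noncomputable def aE (e i j : Ex m) : Ex m :=
  .get (.const 3 + e * nE * nE + i * nE + j)

/-- The entries of `c`. -/
noncomputable def cE (i j : Ex m) : Ex m := .get (.const 3 + rE * nE * nE + i * nE + j)

/-- The entries of the second component of the input pair. -/
noncomputable def wE (k : Ex m) : Ex m := .get (.const 1 + .get (.const 0) + k)

/-- The value of `e` at the pair `(v₄, v₅)` that is encoded by the variable `u`, if any. -/
noncomputable def unpairE (u : ℕ) (e : Ex m) : Ex m :=
  sumTo 4 nE (sumTo 5 nE (.ite (eq (.idx u) (.idx 4 * nE + .idx 5)) e (.const 0)))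

end Data

/-- The number `f i j` for the pair encoded by `k = n i + j`, and `0` if there is none. -/
def unpair (n : ℕ) (f : ℕ → ℕ → ℝ) (k : ℕ) : ℝ :=
  ∑ i ∈ Finset.range n, ∑ j ∈ Finset.range n, if k = i * n + j then f i j else 0

/-- What is known about an input that starts with the code of an instance. -/
structure InputOK (N : ℕ) (z : ℕ → ℝ) (n r ℓ : ℕ) : Prop where
  zero : ∀ k, N ≤ k → z k = 0
  n_eq : z 1 = n
  r_eq : z 2 = r
  len_eq : z 0 = ℓ
  n_lt : n < N
  sq_lt : n * n < N
  r_lt : r < N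

/-- The coefficients of the equations. -/
def aF (z : ℕ → ℝ) (n : ℕ) (e i j : ℕ) : ℝ := z (3 + e * n * n + i * n + j)

/-- The entries of `c`. -/
def cF (z : ℕ → ℝ) (n r : ℕ) (i j : ℕ) : ℝ := z (3 + r * n * n + i * n + j)

/-- The entries of the second component of the input. -/
def wF (z : ℕ → ℝ) (ℓ : ℕ) (k : ℕ) : ℝ := z (1 + ℓ + k)

section

variable {m : Mode} {N : ℕ} {z : ℕ → ℝ} {n r ℓ : ℕ} {ρ : ℕ → ℕ} {M : ℕ → ℕ → ℝ}

theorem InputOK.eval_nE (h : InputOK N z n r ℓ) : (nE : Ex m).eval N z ρ M = n := by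
  rw [nE, eval_get', eval_const, show (1 : ℝ) = ((1 : ℕ) : ℝ) by simp, entry_natCast h.zero, h.n_eq]

theorem InputOK.eval_rE (h : InputOK N z n r ℓ) : (rE : Ex m).eval N z ρ M = r := by
  rw [rE, eval_get', eval_const, show (2 : ℝ) = ((2 : ℕ) : ℝ) by simp, entry_natCast h.zero, h.r_eq]

theorem InputOK.eval_aE (h : InputOK N z n r ℓ) {e i j : Ex m} {e' i' j' : ℕ}
    (he : e.eval N z ρ M = e') (hi : i.eval N z ρ M = i') (hj : j.eval N z ρ M = j') :
    (aE e i j).eval N z ρ M = aF z n e' i' j' := by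
  rw [aE, aF, ← entry_natCast h.zero]
  simp only [eval_get', eval_add', eval_mul', eval_const, h.eval_nE, he, hi, hj]
  push_cast
  rfl

theorem InputOK.eval_cE (h : InputOK N z n r ℓ) {i j : Ex m} {i' j' : ℕ}
    (hi : i.eval N z ρ M = i') (hj : j.eval N z ρ M = j') :
    (cE i j).eval N z ρ M = cF z n r i' j' := by
  rw [cE, cF, ← entry_natCast h.zero]
  simp only [eval_get', eval_add', eval_mul', eval_const, h.eval_nE, h.eval_rE, hi, hj]
  push_cast
  rfl

theorem InputOK.eval_wE (h : InputOK N z n r ℓ) {k : Ex m} {k' : ℕ}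
    (hk : k.eval N z ρ M = k') : (wE k).eval N z ρ M = wF z ℓ k' := by
  have h0 : entry N z 0 = ℓ := by
    rw [show (0 : ℝ) = ((0 : ℕ) : ℝ) by simp, entry_natCast h.zero, h.len_eq]
  rw [wE, wF, ← entry_natCast h.zero]
  simp only [eval_get', eval_add', eval_const, hk, h0]
  push_cast
  rfl

theorem InputOK.eval_sum_n (h : InputOK N z n r ℓ) (v : ℕ) (a : Ex m) :
    (sumTo v nE a).eval N z ρ M =
      ∑ k ∈ Finset.range n, a.eval N z (Function.update ρ v k) M :=
  eval_sumTo h.n_lt.le fun _ _ => h.eval_nE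

theorem InputOK.eval_sum_r (h : InputOK N z n r ℓ) (v : ℕ) (a : Ex m) :
    (sumTo v rE a).eval N z ρ M =
      ∑ k ∈ Finset.range r, a.eval N z (Function.update ρ v k) M :=
  eval_sumTo h.r_lt.le fun _ _ => h.eval_rE

theorem InputOK.sat_all_n (h : InputOK N z n r ℓ) (v : ℕ) (a : Ex m) :
    Sat N z ρ M (allTo v nE a) ↔ ∀ k < n, Sat N z (Function.update ρ v k) M a :=
  sat_allTo h.n_lt.le fun _ _ => h.eval_nE

theorem InputOK.sat_all_r (h : InputOK N z n r ℓ) (v : ℕ) (a : Ex m) :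
    Sat N z ρ M (allTo v rE a) ↔ ∀ k < r, Sat N z (Function.update ρ v k) M a :=
  sat_allTo h.r_lt.le fun _ _ => h.eval_rE

theorem InputOK.eval_unpairE (h : InputOK N z n r ℓ) {u : ℕ} (h4 : u ≠ 4) (h5 : u ≠ 5)
    {e : Ex m} {f : ℕ → ℕ → ℝ}
    (he : ∀ i j, e.eval N z (Function.update (Function.update ρ 4 i) 5 j) M = f i j) :
    (unpairE u e).eval N z ρ M = unpair n f (ρ u) := by
  classical
  rw [unpairE, h.eval_sum_n, unpair]
  refine Finset.sum_congr rfl fun i _ => ?_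
  rw [h.eval_sum_n]
  refine Finset.sum_congr rfl fun j _ => ?_
  simp only [eval_ite, sat_eq, eval_idx, eval_add', eval_mul', h.eval_nE, eval_const, he]
  rw [Function.update_of_ne h5, Function.update_of_ne h4]
  simp only [Function.update_self, Function.update_of_ne (show 4 ≠ 5 by decide)]
  norm_cast

/-! ### Membership in the orthogonal complement -/

/-- The coordinates of the vectors for the test of membership in `L^⊥`. -/
noncomputable def perpVec (r : ℕ) (a : ℕ → ℕ → ℕ → ℝ) (w : ℕ → ℕ → ℝ) (k : ℕ) (p : ℕ × ℕ) : ℝ :=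
  if k < r then a k p.1 p.2 + a k p.2 p.1 else w p.1 p.2 + w p.2 p.1

noncomputable def perpVecE (w : ℕ → ℕ → Ex .plain) (u : ℕ) : Ex .plain :=
  .ite (lt (.idx u) rE) (aE (.idx u) (.idx 4) (.idx 5) + aE (.idx u) (.idx 5) (.idx 4))
    (w 4 5 + w 5 4)

/-- Tests whether the matrix with entries `w` is orthogonal to `L`. -/
noncomputable def perpTest (w : ℕ → ℕ → Ex .plain) : Ex .outer :=
  spanTest rE (sumTo 4 nE (sumTo 5 nE (perpVecE w 1 * perpVecE w 2)))

/-- The symmetrised coefficient matrices span `L^⊥`. They are the vectors `0, …, r - 1`, and the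
symmetrised candidate is vector `r`, so that membership becomes the vanishing of the last pivot of a
Gram matrix. -/
theorem InputOK.sat_perpTest (h : InputOK N z n r ℓ) {w : ℕ → ℕ → Ex .plain} {W : ℕ → ℕ → ℝ}
    (hw : ∀ k l i j, (w 4 5).eval N z (Function.update (Function.update (Function.update
      (Function.update ρ 1 k) 2 l) 4 i) 5 j) M = W i j)
    (hw' : ∀ k l i j, (w 5 4).eval N z (Function.update (Function.update (Function.update
      (Function.update ρ 1 k) 2 l) 4 i) 5 j) M = W j i) :
    Sat N z ρ M (perpTest w) ↔ ∃ u : ℕ → ℝ, ∀ i < n, ∀ j < n,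
      ∑ e ∈ Finset.range r, u e * (aF z n e i j + aF z n e j i) = W i j + W j i := by
  classical
  rw [perpTest, sat_spanTest (G := gram (Finset.range n ×ˢ Finset.range n)
    (perpVec r (aF z n) W)) h.r_lt (fun _ _ => h.eval_rE),
    elim_gram_eq_zero_iff (Finset.range n ×ˢ Finset.range n) (perpVec r (aF z n) W) h.r_lt.le
      (fun _ _ _ _ => rfl)]
  · refine exists_congr fun u => ?_
    simp only [Finset.mem_product, Finset.mem_range, Prod.forall, perpVec, lt_irrefl, if_false]
    refine ⟨fun h' i hi j hj => ?_, fun h' i j hij => ?_⟩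
    · rw [← h' i j ⟨hi, hj⟩]
      refine Finset.sum_congr rfl fun k hk => ?_
      rw [if_pos (Finset.mem_range.mp hk)]
    · rw [← h' i hij.1 j hij.2]
      refine Finset.sum_congr rfl fun k hk => ?_
      rw [if_pos (Finset.mem_range.mp hk)]
  · intro k l
    rw [h.eval_sum_n, gram, Finset.sum_product]
    refine Finset.sum_congr rfl fun i _ => ?_
    rw [h.eval_sum_n]
    refine Finset.sum_congr rfl fun j _ => ?_
    have key : ∀ u v, u ≠ 4 → u ≠ 5 → Function.update (Function.update ρ 1 k) 2 l u = v →
        (perpVecE w u).eval N z (Function.update (Function.update (Function.update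
          (Function.update ρ 1 k) 2 l) 4 i) 5 j) M = perpVec r (aF z n) W v (i, j) := by
      intro u v h4 h5 hv
      set ρ' := Function.update (Function.update (Function.update
          (Function.update ρ 1 k) 2 l) 4 i) 5 j with hρ'
      have hu : ρ' u = v := by
        rw [hρ', Function.update_of_ne h5, Function.update_of_ne h4, hv]
      have e4 : ρ' 4 = i := by simp [hρ']
      have e5 : ρ' 5 = j := by simp [hρ']
      rw [perpVecE, eval_ite, eval_add', eval_add', hw, hw', perpVec,
        h.eval_aE (e' := v) (i' := i) (j' := j) (by rw [eval_idx, hu]) (by rw [eval_idx, e4])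
          (by rw [eval_idx, e5]),
        h.eval_aE (e' := v) (i' := j) (j' := i) (by rw [eval_idx, hu]) (by rw [eval_idx, e5])
          (by rw [eval_idx, e4])]
      simp only [sat_lt, eval_idx, h.eval_rE, hu, Nat.cast_lt]
    rw [eval_mul', key 1 k (by decide) (by decide) (by simp),
      key 2 l (by decide) (by decide) (by simp)]

end

end SDFP

namespace SDFP

open BSS BSS.Ex

/-! ### Expressions for the data of a certificate -/

section CertData

variable {m : Mode}

/-- The number of directions. -/
noncomputable def mE : Ex m := wE (.const 0)

/-- The size of the last subproblem. -/
noncomputable def dE : Ex m := wE (.const 1)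

/-- The size of the positive definite block of a direction. -/
noncomputable def kE (l : Ex m) : Ex m := wE (.const 2 + l)

/-- The entries of a direction. -/
noncomputable def dirE (l i j : Ex m) : Ex m :=
  wE (.const 2 + mE + l * nE * nE + i * nE + j)

/-- The entries of the congruence. -/
noncomputable def congE (i j : Ex m) : Ex m :=
  wE (.const 2 + mE + mE * nE * nE + i * nE + j)

/-- The entries of the matrices `B`, `x`, `y`, for `t = 0, 1, 2`. -/
noncomputable def lastE (t : ℝ) (i j : Ex m) : Ex m :=
  wE (.const 2 + mE + mE * nE * nE + nE * nE + .const t * dE * dE + i * dE + j)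

end CertData

/-- The entries of a direction. -/
def dirF (w : ℕ → ℝ) (n m l i j : ℕ) : ℝ := w (2 + m + l * n * n + i * n + j)

/-- The entries of the congruence. -/
def congF (w : ℕ → ℝ) (n m i j : ℕ) : ℝ := w (2 + m + m * n * n + i * n + j)

/-- The entries of the matrices `B`, `x`, `y`, for `t = 0, 1, 2`. -/
def lastF (w : ℕ → ℝ) (n m d t i j : ℕ) : ℝ :=
  w (2 + m + m * n * n + n * n + t * d * d + i * d + j)

/-- What is known about an input once the numbers `m` and `d` have been checked. -/
structure CertOK (N : ℕ) (z : ℕ → ℝ) (n r ℓ m d : ℕ) : Prop extends InputOK N z n r ℓ where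
  m_eq : wF z ℓ 0 = m
  d_eq : wF z ℓ 1 = d
  m_lt : m < N
  d_le : d ≤ n

section

variable {μ : Mode} {N : ℕ} {z : ℕ → ℝ} {n r ℓ m d : ℕ} {ρ : ℕ → ℕ} {M : ℕ → ℕ → ℝ}

theorem CertOK.eval_mE (h : CertOK N z n r ℓ m d) : (mE : Ex μ).eval N z ρ M = m := by
  rw [mE, h.eval_wE (k' := 0) (by simp [eval_const]), h.m_eq]

theorem CertOK.eval_dE (h : CertOK N z n r ℓ m d) : (dE : Ex μ).eval N z ρ M = d := by
  rw [dE, h.eval_wE (k' := 1) (by simp [eval_const]), h.d_eq]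

theorem InputOK.eval_kE (h : InputOK N z n r ℓ) {l : Ex μ} {l' : ℕ}
    (hl : l.eval N z ρ M = l') : (kE l).eval N z ρ M = wF z ℓ (2 + l') := by
  rw [kE, h.eval_wE]
  simp [eval_add', eval_const, hl]

theorem CertOK.eval_dirE (h : CertOK N z n r ℓ m d) {l i j : Ex μ} {l' i' j' : ℕ}
    (hl : l.eval N z ρ M = l') (hi : i.eval N z ρ M = i') (hj : j.eval N z ρ M = j') :
    (dirE l i j).eval N z ρ M = dirF (wF z ℓ) n m l' i' j' := by
  rw [dirE, h.eval_wE, dirF]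
  simp [eval_add', eval_mul', eval_const, h.eval_nE, h.eval_mE, hl, hi, hj]

theorem CertOK.eval_congE (h : CertOK N z n r ℓ m d) {i j : Ex μ} {i' j' : ℕ}
    (hi : i.eval N z ρ M = i') (hj : j.eval N z ρ M = j') :
    (congE i j).eval N z ρ M = congF (wF z ℓ) n m i' j' := by
  rw [congE, h.eval_wE, congF]
  simp [eval_add', eval_mul', eval_const, h.eval_nE, h.eval_mE, hi, hj]

theorem CertOK.eval_lastE (h : CertOK N z n r ℓ m d) {i j : Ex μ} {t i' j' : ℕ}
    (hi : i.eval N z ρ M = i') (hj : j.eval N z ρ M = j') :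
    (lastE t i j).eval N z ρ M = lastF (wF z ℓ) n m d t i' j' := by
  rw [lastE, h.eval_wE, lastF]
  simp [eval_add', eval_mul', eval_const, h.eval_nE, h.eval_mE, h.eval_dE, hi, hj]

theorem CertOK.eval_sum_d (h : CertOK N z n r ℓ m d) (v : ℕ) (a : Ex μ) :
    (sumTo v dE a).eval N z ρ M =
      ∑ k ∈ Finset.range d, a.eval N z (Function.update ρ v k) M :=
  eval_sumTo (h.d_le.trans h.n_lt.le) fun _ _ => h.eval_dE

theorem CertOK.sat_all_d (h : CertOK N z n r ℓ m d) (v : ℕ) (a : Ex μ) :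
    Sat N z ρ M (allTo v dE a) ↔ ∀ k < d, Sat N z (Function.update ρ v k) M a :=
  sat_allTo (h.d_le.trans h.n_lt.le) fun _ _ => h.eval_dE

theorem CertOK.sat_all_m (h : CertOK N z n r ℓ m d) (v : ℕ) (a : Ex μ) :
    Sat N z ρ M (allTo v mE a) ↔ ∀ k < m, Sat N z (Function.update ρ v k) M a :=
  sat_allTo h.m_lt.le fun _ _ => h.eval_mE

/-! ### Membership in the image of `L` -/

theorem unpair_of_lt {f : ℕ → ℕ → ℝ} {i j : ℕ} (hi : i < n) (hj : j < n) :
    unpair n f (i * n + j) = f i j := by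
  rw [unpair, Finset.sum_eq_single i, Finset.sum_eq_single j]
  · simp
  · intro j' hj' hne
    rw [if_neg (by omega)]
  · intro h'; exact absurd (Finset.mem_range.mpr hj) h'
  · intro i' hi' hne
    refine Finset.sum_eq_zero fun j' hj' => ?_
    rw [Finset.mem_range] at hi' hj'
    rw [if_neg]
    intro h'
    apply hne
    have h1 : (i * n + j) / n = i := by
      rw [mul_comm, Nat.mul_add_div (by omega), Nat.div_eq_of_lt hj, add_zero]
    have h2 : (i' * n + j') / n = i' := by
      rw [mul_comm, Nat.mul_add_div (by omega), Nat.div_eq_of_lt hj', add_zero]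
    rw [← h1, h', h2]
  · intro h'; exact absurd (Finset.mem_range.mpr hi) h'

/-- The number `n * n` encodes no pair and is thus free to be the index of the right-hand side. -/
theorem unpair_sq (f : ℕ → ℕ → ℝ) : unpair n f (n * n) = 0 := by
  refine Finset.sum_eq_zero fun i hi => Finset.sum_eq_zero fun j hj => if_neg ?_
  rw [Finset.mem_range] at hi hj
  have : (i + 1) * n ≤ n * n := Nat.mul_le_mul_right _ hi
  rw [add_mul] at this
  omega

theorem sum_mul_unpair (u : ℕ → ℝ) (f : ℕ → ℕ → ℝ) :
    ∑ k ∈ Finset.range (n * n), u k * unpair n f k =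
      ∑ i ∈ Finset.range n, ∑ j ∈ Finset.range n, u (i * n + j) * f i j := by
  simp only [unpair, Finset.mul_sum]
  rw [Finset.sum_comm]
  refine Finset.sum_congr rfl fun i hi => ?_
  rw [Finset.sum_comm]
  refine Finset.sum_congr rfl fun j hj => ?_
  rw [Finset.mem_range] at hi hj
  rw [Finset.sum_eq_single (i * n + j)]
  · simp
  · intro k _ hk
    rw [if_neg hk, mul_zero]
  · intro h'
    have : (i + 1) * n ≤ n * n := Nat.mul_le_mul_right _ hi
    rw [add_mul] at this
    exact absurd (Finset.mem_range.mpr (by omega)) h'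

/-- The coordinates of the vectors for the test of membership in the image of `L`. -/
noncomputable def imageVec (n D : ℕ) (a : ℕ → ℕ → ℕ → ℝ) (P T : ℕ → ℕ → ℝ) (k : ℕ) :
    ℕ ⊕ ℕ × ℕ → ℝ
  | .inl e => unpair n (fun i j => a e i j + a e j i) k
  | .inr p => unpair n (fun i j => P i (n - D + p.1) * P j (n - D + p.2) +
      P j (n - D + p.1) * P i (n - D + p.2)) k + if k = n * n then T p.1 p.2 else 0

noncomputable def imageVecA (u : ℕ) : Ex .plain :=
  unpairE u (aE (.idx 8) (.idx 4) (.idx 5) + aE (.idx 8) (.idx 5) (.idx 4))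

noncomputable def imageVecP (b t : Ex .plain) (u : ℕ) : Ex .plain :=
  unpairE u (congE (.idx 4) (nE - b + .idx 6) * congE (.idx 5) (nE - b + .idx 7) +
    congE (.idx 5) (nE - b + .idx 6) * congE (.idx 4) (nE - b + .idx 7)) +
  .ite (eq (.idx u) (nE * nE)) t (.const 0)

/-- Tests whether the matrix of size `b` with entries `t` is the lower right block of a matrix
congruent to an element of `L`. -/
noncomputable def imageTest (b t : Ex .plain) : Ex .outer :=
  spanTest (nE * nE) (sumTo 8 rE (imageVecA 1 * imageVecA 2) +
    sumTo 6 b (sumTo 7 b (imageVecP b t 1 * imageVecP b t 2)))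

/-- A linear system in the `n²` entries of a matrix `U` whose symmetrisation is the sought element
of `L`. Each unknown contributes a column, with coordinates `inl e` for the equations of `L` and
`inr (p, q)` for the entries of the block; column `n²` is the right-hand side `(0, T)`. Arbitrary
`U` avoids parametrising symmetric matrices. The variable `v₃` stays free because `t` may depend on
the number of a direction. -/
theorem CertOK.sat_imageTest (h : CertOK N z n r ℓ m d) {b t : Ex .plain} {D l : ℕ}
    {T : ℕ → ℕ → ℝ} (hD : D ≤ n) (hl : ρ 3 = l) (hb : ∀ ρ, b.eval N z ρ M = D)
    (ht : ∀ ρ, ρ 3 = l → t.eval N z ρ M = T (ρ 6) (ρ 7)) :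
    Sat N z ρ M (imageTest b t) ↔ ∃ U : ℕ → ℕ → ℝ,
      (∀ e < r, ∑ i ∈ Finset.range n, ∑ j ∈ Finset.range n,
        U i j * (aF z n e i j + aF z n e j i) = 0) ∧
      ∀ p < D, ∀ q < D, ∑ i ∈ Finset.range n, ∑ j ∈ Finset.range n, U i j *
        (congF (wF z ℓ) n m i (n - D + p) * congF (wF z ℓ) n m j (n - D + q) +
          congF (wF z ℓ) n m j (n - D + p) * congF (wF z ℓ) n m i (n - D + q)) = T p q := by
  classical
  set s : Finset (ℕ ⊕ ℕ × ℕ) := (Finset.range r).disjSum (Finset.range D ×ˢ Finset.range D) with hs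
  set f := imageVec n D (aF z n) (congF (wF z ℓ) n m) T with hf
  have hcol : ∀ (ρ : ℕ → ℕ) v, (nE - b + .idx v : Ex .plain).eval N z ρ M =
      ((n - D + ρ v : ℕ) : ℝ) := by
    intro ρ v
    simp [eval_add', eval_sub', h.eval_nE, hb, eval_idx, Nat.cast_sub hD]
  have hA : ∀ (ρ : ℕ → ℕ) u, u ≠ 4 → u ≠ 5 →
      (imageVecA u).eval N z ρ M = f (ρ u) (.inl (ρ 8)) := by
    intro ρ u h4 h5
    rw [imageVecA, h.eval_unpairE h4 h5 (f := fun i j => aF z n (ρ 8) i j + aF z n (ρ 8) j i)]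
    · rfl
    · intro i j
      rw [eval_add', h.eval_aE (e' := ρ 8) (i' := i) (j' := j) (by simp [eval_idx])
        (by simp [eval_idx]) (by simp [eval_idx]), h.eval_aE (e' := ρ 8) (i' := j) (j' := i)
        (by simp [eval_idx]) (by simp [eval_idx]) (by simp [eval_idx])]
  have hP : ∀ (ρ : ℕ → ℕ) u, u ≠ 4 → u ≠ 5 → ρ 3 = l →
      (imageVecP b t u).eval N z ρ M = f (ρ u) (.inr (ρ 6, ρ 7)) := by
    intro ρ u h4 h5 h3
    rw [imageVecP, eval_add', h.eval_unpairE h4 h5 (f := fun i j =>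
      congF (wF z ℓ) n m i (n - D + ρ 6) * congF (wF z ℓ) n m j (n - D + ρ 7) +
          congF (wF z ℓ) n m j (n - D + ρ 6) * congF (wF z ℓ) n m i (n - D + ρ 7)), eval_ite, ht ρ h3]
    · simp only [sat_eq, eval_idx, eval_mul', h.eval_nE, eval_const, hf, imageVec]
      norm_cast
    · intro i j
      rw [eval_add', eval_mul', eval_mul',
        h.eval_congE (i' := i) (by simp [eval_idx]) (hcol _ 6),
        h.eval_congE (i' := j) (by simp [eval_idx]) (hcol _ 7),
        h.eval_congE (i' := j) (by simp [eval_idx]) (hcol _ 6),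
        h.eval_congE (i' := i) (by simp [eval_idx]) (hcol _ 7)]
      simp
  rw [imageTest, sat_spanTest (G := gram s f) (d := n * n) h.sq_lt
    (fun _ _ => by simp [eval_mul', h.eval_nE]),
    elim_gram_eq_zero_iff s f h.sq_lt.le (fun _ _ _ _ => rfl)]
  · have key : ∀ u : ℕ → ℝ, (∀ c ∈ s, ∑ k ∈ Finset.range (n * n), u k * f k c = f (n * n) c) ↔
        (∀ e < r, ∑ i ∈ Finset.range n, ∑ j ∈ Finset.range n,
          u (i * n + j) * (aF z n e i j + aF z n e j i) = 0) ∧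
        ∀ p < D, ∀ q < D, ∑ i ∈ Finset.range n, ∑ j ∈ Finset.range n, u (i * n + j) *
        (congF (wF z ℓ) n m i (n - D + p) * congF (wF z ℓ) n m j (n - D + q) +
          congF (wF z ℓ) n m j (n - D + p) * congF (wF z ℓ) n m i (n - D + q)) = T p q := by
      intro u
      have h1 : ∀ e, f (n * n) (.inl e) = 0 := fun e => unpair_sq _
      have h2 : ∀ p, f (n * n) (.inr p) = T p.1 p.2 := by
        intro p; simp [hf, imageVec, unpair_sq]
      have h3 : ∀ e, ∑ k ∈ Finset.range (n * n), u k * f k (.inl e) =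
          ∑ i ∈ Finset.range n, ∑ j ∈ Finset.range n,
          u (i * n + j) * (aF z n e i j + aF z n e j i) := fun e => sum_mul_unpair _ _
      have h4 : ∀ p q, ∑ k ∈ Finset.range (n * n), u k * f k (.inr (p, q)) =
          ∑ i ∈ Finset.range n, ∑ j ∈ Finset.range n, u (i * n + j) *
        (congF (wF z ℓ) n m i (n - D + p) * congF (wF z ℓ) n m j (n - D + q) +
          congF (wF z ℓ) n m j (n - D + p) * congF (wF z ℓ) n m i (n - D + q)) := by
        intro p q
        rw [← sum_mul_unpair]
        refine Finset.sum_congr rfl fun k hk => ?_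
        rw [hf, imageVec, if_neg (Finset.mem_range.mp hk).ne, add_zero]
      constructor
      · intro h'
        refine ⟨fun e he => ?_, fun p hp q hq => ?_⟩
        · rw [← h3, h' _ (by simp [hs, he]), h1]
        · rw [← h4, h' _ (by simp [hs, hp, hq]), h2]
      · rintro ⟨h', h''⟩ (e | ⟨p, q⟩) hc
        · rw [h3, h1, h' e (by simpa [hs] using hc)]
        · have hc' : p < D ∧ q < D := by simpa [hs] using hc
          rw [h4, h2, h'' p hc'.1 q hc'.2]
    simp only [key]
    constructor
    · rintro ⟨u, hu⟩
      exact ⟨fun i j => u (i * n + j), hu⟩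
    · rintro ⟨U, hU⟩
      -- The coefficient of column `n i + j` is to be `U i j`.
      refine ⟨unpair n U, ?_⟩
      have h5 : ∀ F : ℕ → ℕ → ℝ, ∑ i ∈ Finset.range n, ∑ j ∈ Finset.range n,
          unpair n U (i * n + j) * F i j =
          ∑ i ∈ Finset.range n, ∑ j ∈ Finset.range n, U i j * F i j := by
        intro F
        refine Finset.sum_congr rfl fun i hi => Finset.sum_congr rfl fun j hj => ?_
        rw [unpair_of_lt (Finset.mem_range.mp hi) (Finset.mem_range.mp hj)]
      simp only [h5]
      exact hU
  · intro k k'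
    rw [eval_add', h.eval_sum_r, gram, hs, Finset.sum_disjSum, Finset.sum_product]
    have hDN : D ≤ N := hD.trans h.n_lt.le
    rw [eval_sumTo hDN (fun _ _ => hb _)]
    congr 1
    · refine Finset.sum_congr rfl fun e _ => ?_
      rw [eval_mul', hA _ 1 (by decide) (by decide), hA _ 2 (by decide) (by decide)]
      simp
    · refine Finset.sum_congr rfl fun p _ => ?_
      rw [eval_sumTo hDN (fun _ _ => hb _)]
      refine Finset.sum_congr rfl fun q _ => ?_
      rw [eval_mul', hP _ 1 (by decide) (by decide) (by simpa using hl),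
        hP _ 2 (by decide) (by decide) (by simpa using hl)]
      simp

end

end SDFP

namespace SDFP

open BSS BSS.Ex

/-! ### The conditions to be tested, for matrices given by their entries -/

/-- The matrix with entries `T` is the lower right block of a matrix congruent to an element of
the subspace with equations `a`. -/
def ImageCond (n r D : ℕ) (a : ℕ → ℕ → ℕ → ℝ) (P T : ℕ → ℕ → ℝ) : Prop :=
  ∃ U : ℕ → ℕ → ℝ,
    (∀ e < r, ∑ i ∈ Finset.range n, ∑ j ∈ Finset.range n, U i j * (a e i j + a e j i) = 0) ∧
    ∀ p < D, ∀ q < D, ∑ i ∈ Finset.range n, ∑ j ∈ Finset.range n, U i j *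
      (P i (n - D + p) * P j (n - D + q) + P j (n - D + p) * P i (n - D + q)) = T p q

/-- The matrix with entries `T` is orthogonal to the subspace with equations `a`. -/
def PerpCond (n r : ℕ) (a : ℕ → ℕ → ℕ → ℝ) (T : ℕ → ℕ → ℝ) : Prop :=
  ∃ u : ℕ → ℝ, ∀ i < n, ∀ j < n,
    ∑ e ∈ Finset.range r, u e * (a e i j + a e j i) = T i j + T j i

/-- The entries of the matrix `P (0 ⊕ T) Pᵀ`. -/
def liftF (n d : ℕ) (P T : ℕ → ℕ → ℝ) (i j : ℕ) : ℝ :=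
  ∑ p ∈ Finset.range d, ∑ q ∈ Finset.range d, P i (n - d + p) * T p q * P j (n - d + q)

/-- The entries of the lower right block of `Pᵀ c P`. -/
def compF (n d : ℕ) (P c : ℕ → ℕ → ℝ) (p q : ℕ) : ℝ :=
  ∑ i ∈ Finset.range n, ∑ j ∈ Finset.range n, P i (n - d + p) * c i j * P j (n - d + q)

/-- The condition on a direction `A` with a block of size `k` in position `s`. -/
def DirCond (n r s k : ℕ) (a : ℕ → ℕ → ℕ → ℝ) (P A : ℕ → ℕ → ℝ) : Prop :=
  SymmOn n A ∧
  (∀ i < n, ∀ j < n, s ≤ i → s ≤ j → ¬ (i < s + k ∧ j < s + k) → A i j = 0) ∧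
  QfPos k (fun i j => A (s + i) (s + j)) ∧ ImageCond n r n a P A

/-- The numbers at the beginning of the code of a certificate. -/
structure Numbers (w : ℕ → ℝ) (n m d : ℕ) (k : ℕ → ℕ) : Prop where
  m_eq : w 0 = m
  d_eq : w 1 = d
  k_eq : ∀ l < m, w (2 + l) = k l
  k_pos : ∀ l < m, 1 ≤ k l
  sum_eq : ∑ l ∈ Finset.range m, k l + d = n

/-- The conditions on the matrices of a certificate. -/
def CertCond (n r m d : ℕ) (k : ℕ → ℕ) (a A : ℕ → ℕ → ℕ → ℝ) (c P B x y : ℕ → ℕ → ℝ) : Prop :=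
  QfPos n (fun i j => ∑ t ∈ Finset.range n, P t i * P t j) ∧
  (∀ l < m, DirCond n r (∑ l' ∈ Finset.range l, k l') (k l) a P (A l)) ∧
  (SymmOn d B ∧ QfPos d B ∧ ∑ p ∈ Finset.range d, B p p = 1 ∧ PerpCond n r a (liftF n d P B)) ∧
  (SymmOn d x ∧ QfNonneg d x ∧ ImageCond n r d a P (fun p q => x p q - compF n d P c p q)) ∧
  (SymmOn d y ∧ QfNonneg d y ∧ (¬ ∀ p < d, ∀ q < d, y p q = 0) ∧
    ∑ p ∈ Finset.range d, ∑ q ∈ Finset.range d, y p q * compF n d P c p q = 0 ∧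
    PerpCond n r a (liftF n d P y))

/-- The condition on a certificate of strong feasibility or strong infeasibility. -/
def StrongCond (n r : ℕ) (a : ℕ → ℕ → ℕ → ℝ) (c X : ℕ → ℕ → ℝ) : Prop :=
  SymmOn n X ∧
  ((QfPos n X ∧ ∀ e < r, ∑ i ∈ Finset.range n, ∑ j ∈ Finset.range n,
      a e i j * (X i j - c i j) = 0) ∨
    (QfNonneg n X ∧ PerpCond n r a X ∧
      ∑ i ∈ Finset.range n, ∑ j ∈ Finset.range n, X i j * c i j = -1))

/-! ### The tests -/

/-- Tests symmetry of the matrix of size `b` with entries `t`. -/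
noncomputable def symTest (b : Ex .outer) (t : ℕ → ℕ → Ex .outer) : Ex .outer :=
  allTo 6 b (allTo 7 b (eq (t 6 7) (t 7 6)))

section Exprs

variable {μ : Mode}

/-- The sum of the sizes of the blocks before the current direction. -/
noncomputable def offE : Ex μ := sumTo 9 (.idx 3) (kE (.idx 9))

/-- The entries of the lower right block of `Pᵀ c P`. -/
noncomputable def compE : Ex μ :=
  sumTo 4 nE (sumTo 5 nE (congE (.idx 4) (nE - dE + .idx 6) * cE (.idx 4) (.idx 5) *
    congE (.idx 5) (nE - dE + .idx 7)))

/-- The entries of `P (0 ⊕ T) Pᵀ`. -/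
noncomputable def liftE (t : ℝ) (u v : ℕ) : Ex μ :=
  sumTo 6 dE (sumTo 7 dE (congE (.idx u) (nE - dE + .idx 6) * lastE t (.idx 6) (.idx 7) *
    congE (.idx v) (nE - dE + .idx 7)))

end Exprs

noncomputable def numbersTest : Ex .outer :=
  conj (allTo 3 mE (ex 9 (conj (eq (kE (.idx 3)) (.idx 9)) (le (.const 1) (.idx 9)))))
    (eq (sumTo 3 mE (kE (.idx 3)) + dE) nE)

noncomputable def gramTest : Ex .outer :=
  pdTest nE (sumTo 4 nE (congE (.idx 4) (.idx 1) * congE (.idx 4) (.idx 2)))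

noncomputable def dirTest : Ex .outer :=
  conj (symTest nE fun u v => dirE (.idx 3) (.idx u) (.idx v)) <|
  conj (allTo 4 nE (allTo 5 nE (imp (le offE (.idx 4)) (imp (le offE (.idx 5))
    (imp (nt (conj (lt (.idx 4) (offE + kE (.idx 3))) (lt (.idx 5) (offE + kE (.idx 3)))))
      (eq (dirE (.idx 3) (.idx 4) (.idx 5)) (.const 0))))))) <|
  conj (pdTest (kE (.idx 3)) (dirE (.idx 3) (offE + .idx 1) (offE + .idx 2)))
    (imageTest nE (dirE (.idx 3) (.idx 6) (.idx 7)))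

noncomputable def bTest : Ex .outer :=
  conj (symTest dE fun u v => lastE 0 (.idx u) (.idx v)) <|
  conj (pdTest dE (lastE 0 (.idx 1) (.idx 2))) <|
  conj (eq (sumTo 6 dE (lastE 0 (.idx 6) (.idx 6))) (.const 1)) (perpTest (liftE 0))

noncomputable def xTest : Ex .outer :=
  conj (symTest dE fun u v => lastE 1 (.idx u) (.idx v)) <|
  conj (psdTest dE (lastE 1 (.idx 1) (.idx 2))) <|
  imageTest dE (lastE 1 (.idx 6) (.idx 7) - compE)

noncomputable def yTest : Ex .outer :=
  conj (symTest dE fun u v => lastE 2 (.idx u) (.idx v)) <|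
  conj (psdTest dE (lastE 2 (.idx 1) (.idx 2))) <|
  conj (nt (allTo 6 dE (allTo 7 dE (eq (lastE 2 (.idx 6) (.idx 7)) (.const 0))))) <|
  conj (eq (sumTo 6 dE (sumTo 7 dE (lastE 2 (.idx 6) (.idx 7) * compE))) (.const 0))
    (perpTest (liftE 2))

/-- Tests whether a certificate is valid for an instance. -/
noncomputable def certTest : Ex .outer :=
  conj (le (.const 1) nE) <| conj (ex 9 (eq mE (.idx 9))) <| conj (ex 9 (eq dE (.idx 9))) <|
  conj numbersTest <| conj gramTest <| conj (allTo 3 mE dirTest) <|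
  conj bTest <| conj xTest yTest

/-- Tests whether the second component of the input is a certificate of strong feasibility or
infeasibility; the answer is affirmative for matrices of size zero. -/
noncomputable def strongTest : Ex .outer :=
  disj (le nE (.const 0)) <|
  conj (symTest nE fun u v => wE (.idx u * nE + .idx v)) <|
  disj (conj (pdTest nE (wE (.idx 1 * nE + .idx 2)))
    (allTo 8 rE (eq (sumTo 6 nE (sumTo 7 nE (aE (.idx 8) (.idx 6) (.idx 7) *
      (wE (.idx 6 * nE + .idx 7) - cE (.idx 6) (.idx 7))))) (.const 0)))) <|
  conj (psdTest nE (wE (.idx 1 * nE + .idx 2))) <|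
  conj (perpTest fun u v => wE (.idx u * nE + .idx v)) <|
  eq (sumTo 6 nE (sumTo 7 nE (wE (.idx 6 * nE + .idx 7) * cE (.idx 6) (.idx 7)))) (.const (-1))

section

variable {μ : Mode} {N : ℕ} {z : ℕ → ℝ} {n r ℓ m d : ℕ} {ρ : ℕ → ℕ} {M : ℕ → ℕ → ℝ}

theorem sat_symTest {b : Ex .outer} {t : ℕ → ℕ → Ex .outer} {D l : ℕ} {T : ℕ → ℕ → ℝ}
    (hD : D ≤ N) (hl : ρ 3 = l) (hb : ∀ ρ, b.eval N z ρ M = D)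
    (ht : ∀ ρ u v, ρ 3 = l → (t u v).eval N z ρ M = T (ρ u) (ρ v)) :
    Sat N z ρ M (symTest b t) ↔ SymmOn D T := by
  rw [symTest, sat_allTo hD (fun _ _ => hb _), SymmOn]
  refine forall₂_congr fun i _ => ?_
  rw [sat_allTo hD (fun _ _ => hb _)]
  refine forall₂_congr fun j _ => ?_
  rw [sat_eq, ht _ _ _ (by simpa using hl), ht _ _ _ (by simpa using hl)]
  simp

theorem CertOK.eval_col (h : CertOK N z n r ℓ m d) (v : ℕ) :
    (nE - dE + .idx v : Ex μ).eval N z ρ M = ((n - d + ρ v : ℕ) : ℝ) := by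
  simp [eval_add', eval_sub', h.eval_nE, h.eval_dE, eval_idx, Nat.cast_sub h.d_le]

theorem CertOK.eval_compE (h : CertOK N z n r ℓ m d) : (compE : Ex μ).eval N z ρ M =
    compF n d (congF (wF z ℓ) n m) (cF z n r) (ρ 6) (ρ 7) := by
  rw [compE, compF, h.eval_sum_n]
  refine Finset.sum_congr rfl fun i _ => ?_
  rw [h.eval_sum_n]
  refine Finset.sum_congr rfl fun j _ => ?_
  rw [eval_mul', eval_mul', h.eval_congE (i' := i) (by simp [eval_idx]) (h.eval_col 6),
    h.eval_congE (i' := j) (by simp [eval_idx]) (h.eval_col 7),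
    h.eval_cE (i' := i) (j' := j) (by simp [eval_idx]) (by simp [eval_idx])]
  simp

theorem CertOK.eval_lastE_idx (h : CertOK N z n r ℓ m d) (t u v : ℕ) :
    (lastE t (.idx u) (.idx v) : Ex μ).eval N z ρ M =
      lastF (wF z ℓ) n m d t (ρ u) (ρ v) :=
  h.eval_lastE eval_idx eval_idx

theorem CertOK.eval_liftE (h : CertOK N z n r ℓ m d) {t u v : ℕ} (hu : u < 6) (hv : v < 6) :
    (liftE t u v : Ex μ).eval N z ρ M =
      liftF n d (congF (wF z ℓ) n m) (lastF (wF z ℓ) n m d t) (ρ u) (ρ v) := by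
  rw [liftE, liftF, h.eval_sum_d]
  refine Finset.sum_congr rfl fun p _ => ?_
  rw [h.eval_sum_d]
  refine Finset.sum_congr rfl fun q _ => ?_
  rw [eval_mul', eval_mul', h.eval_lastE_idx,
    h.eval_congE (i' := ρ u) ?_ (h.eval_col 6), h.eval_congE (i' := ρ v) ?_ (h.eval_col 7)]
  · simp
  · rw [eval_idx, Function.update_of_ne (by omega), Function.update_of_ne (by omega)]
  · rw [eval_idx, Function.update_of_ne (by omega), Function.update_of_ne (by omega)]

theorem CertOK.sat_perpTest_lift (h : CertOK N z n r ℓ m d) (t : ℕ) :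
    Sat N z ρ M (perpTest (liftE t)) ↔ PerpCond n r (aF z n)
      (liftF n d (congF (wF z ℓ) n m) (lastF (wF z ℓ) n m d t)) := by
  rw [h.sat_perpTest (W := liftF n d (congF (wF z ℓ) n m) (lastF (wF z ℓ) n m d t)), PerpCond]
  · intro k l i j
    rw [h.eval_liftE (by decide) (by decide)]
    simp
  · intro k l i j
    rw [h.eval_liftE (by decide) (by decide)]
    simp

theorem CertOK.sat_symTest_last (h : CertOK N z n r ℓ m d) (t : ℕ) :
    Sat N z ρ M (symTest dE fun u v => lastE t (.idx u) (.idx v)) ↔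
      SymmOn d (lastF (wF z ℓ) n m d t) :=
  sat_symTest (h.d_le.trans h.n_lt.le) rfl (fun _ => h.eval_dE)
    fun _ u v _ => h.eval_lastE_idx t u v

theorem CertOK.sat_bTest (h : CertOK N z n r ℓ m d) :
    Sat N z ρ M bTest ↔ SymmOn d (lastF (wF z ℓ) n m d 0) ∧ QfPos d (lastF (wF z ℓ) n m d 0) ∧
      ∑ p ∈ Finset.range d, lastF (wF z ℓ) n m d 0 p p = 1 ∧
      PerpCond n r (aF z n) (liftF n d (congF (wF z ℓ) n m) (lastF (wF z ℓ) n m d 0)) := by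
  have e0 : (0 : ℝ) = ((0 : ℕ) : ℝ) := by simp
  rw [bTest, sat_conj, sat_conj, sat_conj, e0, h.sat_symTest_last, h.sat_perpTest_lift]
  refine and_congr_right fun hs => ?_
  rw [sat_pdTest (h.d_le.trans h.n_lt.le) (fun _ _ => h.eval_dE)
    (fun i j => by rw [h.eval_lastE_idx]; simp) hs, sat_eq, h.eval_sum_d]
  simp only [h.eval_lastE_idx, eval_const]
  simp

theorem CertOK.sat_xTest (h : CertOK N z n r ℓ m d) :
    Sat N z ρ M xTest ↔ SymmOn d (lastF (wF z ℓ) n m d 1) ∧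
      QfNonneg d (lastF (wF z ℓ) n m d 1) ∧
      ImageCond n r d (aF z n) (congF (wF z ℓ) n m) (fun p q => lastF (wF z ℓ) n m d 1 p q -
        compF n d (congF (wF z ℓ) n m) (cF z n r) p q) := by
  have e1 : (1 : ℝ) = ((1 : ℕ) : ℝ) := by simp
  rw [xTest, sat_conj, sat_conj, e1, h.sat_symTest_last]
  refine and_congr_right fun hs => ?_
  rw [sat_psdTest (h.d_le.trans h.n_lt.le) (fun _ _ => h.eval_dE) (fun _ _ _ => h.eval_dE)
    (fun i j => by rw [h.eval_lastE_idx]; simp) hs,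
    h.sat_imageTest (T := fun p q => lastF (wF z ℓ) n m d 1 p q -
        compF n d (congF (wF z ℓ) n m) (cF z n r) p q) h.d_le rfl (fun _ => h.eval_dE)
    (fun ρ _ => by rw [eval_sub', h.eval_lastE_idx, h.eval_compE]), ImageCond]

theorem CertOK.sat_yTest (h : CertOK N z n r ℓ m d) :
    Sat N z ρ M yTest ↔ SymmOn d (lastF (wF z ℓ) n m d 2) ∧
      QfNonneg d (lastF (wF z ℓ) n m d 2) ∧
      (¬ ∀ p < d, ∀ q < d, lastF (wF z ℓ) n m d 2 p q = 0) ∧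
      ∑ p ∈ Finset.range d, ∑ q ∈ Finset.range d, lastF (wF z ℓ) n m d 2 p q *
        compF n d (congF (wF z ℓ) n m) (cF z n r) p q = 0 ∧
      PerpCond n r (aF z n) (liftF n d (congF (wF z ℓ) n m) (lastF (wF z ℓ) n m d 2)) := by
  have e2 : (2 : ℝ) = ((2 : ℕ) : ℝ) := by simp
  rw [yTest, sat_conj, sat_conj, sat_conj, sat_conj, e2, h.sat_symTest_last, h.sat_perpTest_lift]
  refine and_congr_right fun hs => ?_
  rw [sat_psdTest (h.d_le.trans h.n_lt.le) (fun _ _ => h.eval_dE) (fun _ _ _ => h.eval_dE)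
    (fun i j => by rw [h.eval_lastE_idx]; simp) hs, sat_nt, h.sat_all_d, sat_eq, h.eval_sum_d]
  simp only [h.sat_all_d, h.eval_sum_d, h.eval_lastE_idx, h.eval_compE, eval_const, eval_mul',
    sat_eq]
  simp

theorem CertOK.sat_gramTest (h : CertOK N z n r ℓ m d) :
    Sat N z ρ M gramTest ↔ QfPos n
      (fun i j => ∑ t ∈ Finset.range n, congF (wF z ℓ) n m t i * congF (wF z ℓ) n m t j) := by
  rw [gramTest, sat_pdTest h.n_lt.le (fun _ _ => h.eval_nE)]
  · intro i j
    rw [h.eval_sum_n]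
    refine Finset.sum_congr rfl fun t _ => ?_
    rw [eval_mul', h.eval_congE (i' := t) (j' := i) (by simp [eval_idx]) (by simp [eval_idx]),
      h.eval_congE (i' := t) (j' := j) (by simp [eval_idx]) (by simp [eval_idx])]
  · intro i _ j _
    exact Finset.sum_congr rfl fun t _ => mul_comm _ _

/-- The number of the direction stands in `v₃`, which none of the tests involved binds again. -/
theorem CertOK.sat_dirTest (h : CertOK N z n r ℓ m d) {k : ℕ → ℕ}
    (hk : ∀ l < m, wF z ℓ (2 + l) = k l) (hsum : ∑ l ∈ Finset.range m, k l ≤ n)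
    {l : ℕ} (hl : ρ 3 = l) (hlm : l < m) :
    Sat N z ρ M dirTest ↔ DirCond n r (∑ l' ∈ Finset.range l, k l') (k l) (aF z n)
      (congF (wF z ℓ) n m) (dirF (wF z ℓ) n m l) := by
  set s := ∑ l' ∈ Finset.range l, k l' with hs
  have hsk : s + k l ≤ n := by
    rw [hs, ← Finset.sum_range_succ]
    exact (Finset.sum_le_sum_of_subset (Finset.range_subset_range.mpr hlm)).trans hsum
  have hoff : ∀ {μ : Mode} (ρ : ℕ → ℕ) M, ρ 3 = l → (offE : Ex μ).eval N z ρ M = s := by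
    intro μ ρ M h3
    rw [offE, eval_sumTo (B := l) (hlm.le.trans h.m_lt.le) (fun k _ => by
      rw [eval_idx, Function.update_of_ne (by decide), h3]), hs]
    push_cast
    refine Finset.sum_congr rfl fun l' hl' => ?_
    rw [h.eval_kE (l' := l') (by simp [eval_idx]),
      hk l' ((Finset.mem_range.mp hl').trans hlm)]
  have hkE : ∀ {μ : Mode} (ρ : ℕ → ℕ) M, ρ 3 = l → (kE (.idx 3) : Ex μ).eval N z ρ M = k l := by
    intro μ ρ M h3
    rw [h.eval_kE (l' := l) (by rw [eval_idx, h3]), hk l hlm]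
  have hdir : ∀ {μ : Mode} (ρ : ℕ → ℕ) M u v, ρ 3 = l →
      (dirE (.idx 3) (.idx u) (.idx v) : Ex μ).eval N z ρ M =
        dirF (wF z ℓ) n m l (ρ u) (ρ v) := by
    intro μ ρ M u v h3
    rw [h.eval_dirE (l' := l) (by rw [eval_idx, h3]) eval_idx eval_idx]
  rw [dirTest, DirCond, sat_conj, sat_conj, sat_conj,
    sat_symTest (T := dirF (wF z ℓ) n m l) h.n_lt.le hl (fun _ => h.eval_nE)
      (fun ρ u v h3 => hdir ρ M u v h3)]
  refine and_congr_right fun hsym => and_congr ?_ (and_congr ?_ ?_)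
  · rw [h.sat_all_n]
    refine forall₂_congr fun i _ => ?_
    rw [h.sat_all_n]
    refine forall₂_congr fun j _ => ?_
    have h3 : Function.update (Function.update ρ 4 i) 5 j 3 = l := by simpa using hl
    simp only [sat_imp, sat_le, sat_nt, sat_conj, sat_lt, sat_eq, eval_idx, eval_add', eval_const,
      hoff _ _ h3, hkE _ _ h3, hdir _ _ _ _ h3]
    simp
    norm_cast
  · refine sat_pdTest (by have := h.n_lt; omega) (fun i A => hkE _ _ (by simpa using hl)) ?_ ?_
    · intro i j
      have h3 : Function.update (Function.update ρ 1 i) 2 j 3 = l := by simpa using hl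
      rw [h.eval_dirE (l' := l) (i' := s + i) (j' := s + j) (by rw [eval_idx, h3])
        (by rw [eval_add', hoff _ _ h3, eval_idx]; simp)
        (by rw [eval_add', hoff _ _ h3, eval_idx]; simp)]
    · intro i hi j hj
      exact hsym _ (by omega) _ (by omega)
  · rw [h.sat_imageTest (T := dirF (wF z ℓ) n m l) le_rfl hl (fun _ => h.eval_nE)
      (fun ρ h3 => hdir ρ M 6 7 h3), ImageCond]

/-- The meaning of the test of a certificate. -/
theorem InputOK.sat_certTest (h : InputOK N z n r ℓ) (hn : 1 ≤ n) :
    Sat N z ρ M certTest ↔ ∃ (m d : ℕ) (k : ℕ → ℕ), Numbers (wF z ℓ) n m d k ∧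
      CertCond n r m d k (aF z n) (dirF (wF z ℓ) n m) (cF z n r) (congF (wF z ℓ) n m)
        (lastF (wF z ℓ) n m d 0) (lastF (wF z ℓ) n m d 1) (lastF (wF z ℓ) n m d 2) := by
  have hmE : ∀ ρ, (mE : Ex .outer).eval N z ρ M = wF z ℓ 0 := fun ρ => by
    rw [mE, h.eval_wE (k' := 0) (by simp [eval_const])]
  have hdE : ∀ ρ, (dE : Ex .outer).eval N z ρ M = wF z ℓ 1 := fun ρ => by
    rw [dE, h.eval_wE (k' := 1) (by simp [eval_const])]
  have tail : ∀ {m d : ℕ} {k : ℕ → ℕ}, CertOK N z n r ℓ m d → Numbers (wF z ℓ) n m d k →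
      (Sat N z ρ M (conj gramTest <| conj (allTo 3 mE dirTest) <| conj bTest <| conj xTest yTest) ↔
      CertCond n r m d k (aF z n) (dirF (wF z ℓ) n m) (cF z n r) (congF (wF z ℓ) n m)
        (lastF (wF z ℓ) n m d 0) (lastF (wF z ℓ) n m d 1) (lastF (wF z ℓ) n m d 2)) := by
    intro m d k hC hN
    rw [sat_conj, sat_conj, sat_conj, sat_conj, hC.sat_gramTest, hC.sat_all_m, hC.sat_bTest,
      hC.sat_xTest, hC.sat_yTest, CertCond]
    refine and_congr_right fun _ => and_congr_left fun _ => forall₂_congr fun l hl => ?_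
    exact hC.sat_dirTest hN.k_eq (by have := hN.sum_eq; omega) (by simp) hl
  have hnum : ∀ {m d : ℕ}, CertOK N z n r ℓ m d →
      (Sat N z ρ M numbersTest ↔ ∃ k, Numbers (wF z ℓ) n m d k) := by
    intro m d hC
    rw [numbersTest, sat_conj, hC.sat_all_m, sat_eq, eval_add', eval_sumTo hC.m_lt.le
      (fun _ _ => hC.eval_mE), hC.eval_dE, hC.eval_nE]
    have e1 : ∀ l, (kE (.idx 3) : Ex .outer).eval N z (Function.update ρ 3 l) M =
        wF z ℓ (2 + l) := fun l => hC.eval_kE (by simp [eval_idx])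
    have e2 : ∀ l t, (kE (.idx 3) : Ex .outer).eval N z
        (Function.update (Function.update ρ 3 l) 9 t) M = wF z ℓ (2 + l) :=
      fun l t => hC.eval_kE (by simp [eval_idx])
    simp only [sat_ex, sat_conj, sat_eq, sat_le, e1, e2, eval_idx, eval_const,
      Function.update_self, Nat.one_le_cast]
    constructor
    · rintro ⟨h1, h2⟩
      choose! k hk using h1
      refine ⟨k, hC.m_eq, hC.d_eq, fun l hl => (hk l hl).2.1, fun l hl => (hk l hl).2.2, ?_⟩
      rw [Finset.sum_congr rfl fun l hl => (hk l (Finset.mem_range.mp hl)).2.1] at h2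
      exact_mod_cast h2
    · rintro ⟨k, hk⟩
      refine ⟨fun l hl => ⟨k l, ?_, hk.k_eq l hl, hk.k_pos l hl⟩, ?_⟩
      · have h1 := Finset.single_le_sum (f := k) (fun _ _ => Nat.zero_le _)
          (Finset.mem_range.mpr hl)
        have h2 := hk.sum_eq
        have h3 := hC.n_lt
        omega
      · rw [Finset.sum_congr rfl fun l hl => hk.k_eq l (Finset.mem_range.mp hl)]
        exact_mod_cast hk.sum_eq
  rw [certTest, sat_conj, sat_conj, sat_conj, sat_conj, sat_ex, sat_ex, sat_le, eval_const,
    h.eval_nE]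
  simp only [sat_eq, hmE, hdE, eval_idx, Function.update_self]
  constructor
  · rintro ⟨_, ⟨m, hm, hm'⟩, ⟨d, hd, hd'⟩, h1, h2⟩
    -- The general evaluation lemmas presuppose `d ≤ n`, so this is extracted first, from the tested
    -- equation for the sizes and the nonnegativity of its summands.
    have hdn : d ≤ n := by
      have h3 := (sat_conj.mp h1).1
      have h4 := (sat_conj.mp h1).2
      rw [sat_allTo hm.le (fun _ _ => (hmE _).trans hm')] at h3
      rw [sat_eq, eval_add', eval_sumTo hm.le (fun _ _ => (hmE _).trans hm'), hdE, hd',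
        h.eval_nE] at h4
      have h5 : (0 : ℝ) ≤ ∑ l ∈ Finset.range m,
          (kE (.idx 3) : Ex .outer).eval N z (Function.update ρ 3 l) M := by
        refine Finset.sum_nonneg fun l hl => ?_
        have h6 := h3 l (Finset.mem_range.mp hl)
        rw [sat_ex] at h6
        obtain ⟨t, _, ht⟩ := h6
        rw [sat_conj, sat_eq, h.eval_kE (l' := l) (by simp [eval_idx]), eval_idx,
          Function.update_self] at ht
        rw [h.eval_kE (l' := l) (by simp [eval_idx]), ht.1]
        exact Nat.cast_nonneg t
      have h7 : (d : ℝ) ≤ n := by linarith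
      exact_mod_cast h7
    have hC : CertOK N z n r ℓ m d := ⟨h, hm', hd', hm, hdn⟩
    obtain ⟨k, hk⟩ := (hnum hC).mp h1
    exact ⟨m, d, k, hk, (tail hC hk).mp h2⟩
  · rintro ⟨m, d, k, hk, hcond⟩
    -- All blocks are nonempty, so there are at most `n` of them, and `m` is within the range of the
    -- index variables.
    have hm : m ≤ n := by
      have h1 : m ≤ ∑ l ∈ Finset.range m, k l := by
        calc m = ∑ l ∈ Finset.range m, 1 := by simp
          _ ≤ _ := Finset.sum_le_sum fun l hl => hk.k_pos l (Finset.mem_range.mp hl)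
      have := hk.sum_eq
      omega
    have hd : d ≤ n := by have := hk.sum_eq; omega
    have hnN := h.n_lt
    have hC : CertOK N z n r ℓ m d := ⟨h, hk.m_eq, hk.d_eq, by omega, hd⟩
    exact ⟨by exact_mod_cast hn, ⟨m, by omega, hk.m_eq⟩, ⟨d, by omega, hk.d_eq⟩,
      (hnum hC).mpr ⟨k, hk⟩, (tail hC hk).mpr hcond⟩

/-- The meaning of the test for strong feasibility or infeasibility. -/
theorem InputOK.sat_strongTest (h : InputOK N z n r ℓ) (hn : 1 ≤ n) :
    Sat N z ρ M strongTest ↔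
      StrongCond n r (aF z n) (cF z n r) (fun i j => wF z ℓ (i * n + j)) := by
  have hw : ∀ {μ : Mode} (ρ : ℕ → ℕ) u v, (wE (.idx u * nE + .idx v) : Ex μ).eval N z ρ M =
      wF z ℓ (ρ u * n + ρ v) := fun ρ u v =>
    h.eval_wE (by simp [eval_add', eval_mul', eval_idx, h.eval_nE])
  have hc : ∀ {μ : Mode} (ρ : ℕ → ℕ) u v, (cE (.idx u) (.idx v) : Ex μ).eval N z ρ M =
      cF z n r (ρ u) (ρ v) := fun ρ u v => h.eval_cE eval_idx eval_idx
  have ha : ∀ {μ : Mode} (ρ : ℕ → ℕ) e u v, (aE (.idx e) (.idx u) (.idx v) : Ex μ).eval N z ρ M =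
      aF z n (ρ e) (ρ u) (ρ v) := fun ρ e u v => h.eval_aE eval_idx eval_idx eval_idx
  have hn0 : ¬ Sat N z ρ M (le nE (.const 0) : Ex .outer) := by
    rw [sat_le, h.eval_nE, eval_const, not_le]
    exact_mod_cast hn
  rw [strongTest, sat_disj, or_iff_right hn0, sat_conj, StrongCond,
    sat_symTest (T := fun i j => wF z ℓ (i * n + j)) h.n_lt.le rfl (fun _ => h.eval_nE)
      (fun ρ u v _ => hw ρ u v)]
  refine and_congr_right fun hs => ?_
  rw [sat_disj, sat_conj, sat_conj, sat_conj,
    sat_pdTest h.n_lt.le (fun _ _ => h.eval_nE) (fun i j => by rw [hw]; simp) hs,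
    sat_psdTest h.n_lt.le (fun _ _ => h.eval_nE) (fun _ _ _ => h.eval_nE)
      (fun i j => by rw [hw]; simp) hs,
    h.sat_perpTest (W := fun i j => wF z ℓ (i * n + j)) (fun k l i j => by rw [hw]; simp)
      (fun k l i j => by rw [hw]; simp), h.sat_all_r, PerpCond]
  simp [sat_eq, h.eval_sum_n, eval_mul', eval_sub', hw, hc, ha, eval_const]

end

end SDFP

namespace SDFP

/-! ### The conditions in terms of matrices -/

/-- The function `F` of two natural numbers gives the entries of the matrix `M`. -/
def Rep {d : ℕ} (F : ℕ → ℕ → ℝ) (M : Matrix (Fin d) (Fin d) ℝ) : Prop :=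
  ∀ i j : Fin d, F i j = M i j

theorem Rep.symmOn {d : ℕ} {F : ℕ → ℕ → ℝ} {x : Sym d} (h : Rep F x.1) : SymmOn d F := by
  intro i hi j hj
  rw [h ⟨i, hi⟩ ⟨j, hj⟩, h ⟨j, hj⟩ ⟨i, hi⟩, x.apply_comm]

theorem Rep.qf_eq {d : ℕ} {F : ℕ → ℕ → ℝ} {M : Matrix (Fin d) (Fin d) ℝ} (h : Rep F M)
    (v : ℕ → ℝ) : qf d F v = (fun i : Fin d => v i) ⬝ᵥ M *ᵥ (fun i : Fin d => v i) := by
  rw [dotProduct_mulVec_eq_sum, qf, Finset.sum_range]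
  refine Finset.sum_congr rfl fun i _ => ?_
  rw [Finset.sum_range]
  refine Finset.sum_congr rfl fun j _ => ?_
  rw [h i j]
  ring

theorem exists_extend {d : ℕ} (v : Fin d → ℝ) : ∃ w : ℕ → ℝ, (fun i : Fin d => w i) = v :=
  ⟨fun i => if h : i < d then v ⟨i, h⟩ else 0, by funext i; simp⟩

theorem exists_symm_rep {d : ℕ} {F : ℕ → ℕ → ℝ} (h : SymmOn d F) : ∃ x : Sym d, Rep F x.1 :=
  ⟨⟨Matrix.of fun i j => F i j, by
    ext i j
    exact h j j.2 i i.2⟩, fun _ _ => rfl⟩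

theorem Rep.qfPos_iff {d : ℕ} {F : ℕ → ℕ → ℝ} {x : Sym d} (h : Rep F x.1) :
    QfPos d F ↔ x.1.PosDef := by
  rw [x.posDef_iff]
  constructor
  · intro hF v hv
    obtain ⟨w, rfl⟩ := exists_extend v
    rw [← h.qf_eq]
    apply hF
    by_contra hcon
    push Not at hcon
    exact hv (funext fun i => hcon i i.2)
  · rintro hx v ⟨i, hi, hv⟩
    rw [h.qf_eq]
    exact hx _ fun h' => hv (congrFun h' ⟨i, hi⟩)

theorem Rep.qfNonneg_iff {d : ℕ} {F : ℕ → ℕ → ℝ} {x : Sym d} (h : Rep F x.1) :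
    QfNonneg d F ↔ x ∈ K d := by
  rw [K, Set.mem_ofPred_eq, x.posSemidef_iff]
  constructor
  · intro hF v
    obtain ⟨w, rfl⟩ := exists_extend v
    rw [← h.qf_eq]
    exact hF w
  · intro hx v
    rw [h.qf_eq]
    exact hx _

theorem Rep.sum_eq {d : ℕ} {F G : ℕ → ℕ → ℝ} {M M' : Matrix (Fin d) (Fin d) ℝ} (h : Rep F M)
    (h' : Rep G M') : ∑ i ∈ Finset.range d, ∑ j ∈ Finset.range d, F i j * G i j =
      ∑ i, ∑ j, M i j * M' i j := by
  rw [Finset.sum_range]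
  refine Finset.sum_congr rfl fun i _ => ?_
  rw [Finset.sum_range]
  exact Finset.sum_congr rfl fun j _ => by rw [h, h']

/-- Non-singularity is tested through the positive definiteness of `Pᵀ P`, so elimination serves
here too and no determinant is computed. -/
theorem Rep.qfPos_gram_iff {n : ℕ} {F : ℕ → ℕ → ℝ} {P : Matrix (Fin n) (Fin n) ℝ} (h : Rep F P) :
    QfPos n (fun i j => ∑ t ∈ Finset.range n, F t i * F t j) ↔ IsUnit P.det := by
  have h1 : Rep (fun i j => ∑ t ∈ Finset.range n, F t i * F t j) (cong P (Sym.one n)).1 := by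
    intro i j
    change ∑ t ∈ Finset.range n, F t i * F t j =
      (Pᵀ * (1 : Matrix (Fin n) (Fin n) ℝ) * P) i j
    rw [Matrix.mul_one, Matrix.mul_apply, Finset.sum_range]
    exact Finset.sum_congr rfl fun t _ => by rw [h, h, Matrix.transpose_apply]
  rw [h1.qfPos_iff]
  constructor
  · intro hp
    have h2 : (Pᵀ * (1 : Matrix (Fin n) (Fin n) ℝ) * P).det ≠ 0 := hp.det_pos.ne'
    rw [Matrix.mul_one, Matrix.det_mul] at h2
    exact isUnit_iff_ne_zero.mpr (right_ne_zero_of_mul h2)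
  · intro hP
    exact (posDef_cong_iff hP _).mpr Matrix.PosDef.one

theorem sum_mul_add_swap {ι : Type*} [Fintype ι] (U f : ι → ι → ℝ) :
    ∑ i, ∑ j, U i j * (f i j + f j i) = ∑ i, ∑ j, (U i j + U j i) * f i j := by
  simp only [mul_add, add_mul, Finset.sum_add_distrib]
  congr 1
  rw [Finset.sum_comm]

/-- The symmetric coefficients of an equation. -/
def Instance.eqn (I : Instance) (e : Fin I.r) : Sym I.n :=
  ⟨I.a e + (I.a e)ᵀ, by
    change (I.a e + (I.a e)ᵀ)ᵀ = _
    rw [Matrix.transpose_add, Matrix.transpose_transpose, add_comm]⟩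

theorem Instance.ip_eqn (I : Instance) (e : Fin I.r) (x : Sym I.n) :
    ip (I.eqn e) x = 2 * ∑ i, ∑ j, I.a e i j * x.1 i j := by
  have h := sum_mul_add_swap (fun i j => x.1 i j) (fun i j => I.a e i j)
  rw [ip_eq_sum, two_mul]
  calc ∑ i, ∑ j, (I.eqn e).1 i j * x.1 i j = ∑ i, ∑ j, x.1 i j * (I.a e i j + I.a e j i) :=
        Finset.sum_congr rfl fun i _ => Finset.sum_congr rfl fun j _ => mul_comm _ _
    _ = _ := h
    _ = _ := by
      rw [← Finset.sum_add_distrib]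
      refine Finset.sum_congr rfl fun i _ => ?_
      rw [← Finset.sum_add_distrib]
      refine Finset.sum_congr rfl fun j _ => ?_
      rw [x.apply_comm j i]
      ring

theorem Instance.mem_L_iff (I : Instance) (x : Sym I.n) :
    x ∈ I.L ↔ ∀ e, ∑ i, ∑ j, I.a e i j * x.1 i j = 0 := Iff.rfl

/-- `L` is the orthogonal complement of the span of the symmetrised equations, and taking the
complement twice gives the span back. -/
theorem Instance.mem_perp_L_iff (I : Instance) (S : Sym I.n) :
    S ∈ perp I.L ↔ ∃ u : Fin I.r → ℝ, ∑ e, u e • I.eqn e = S := by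
  rw [← Submodule.mem_span_range_iff_exists_fun]
  constructor
  · intro hS
    refine mem_of_perp fun y hy => ?_
    have hyL : y ∈ I.L := by
      rw [I.mem_L_iff]
      intro e
      have h1 := hy (I.eqn e) (Submodule.subset_span ⟨e, rfl⟩)
      rw [ip_comm, I.ip_eqn] at h1
      linarith
    rw [ip_comm]
    exact hS y hyL
  · intro hS x hx
    rw [ip_comm]
    have : Submodule.span ℝ (Set.range I.eqn) ≤ LinearMap.ker (ipL x) := by
      rw [Submodule.span_le]
      rintro _ ⟨e, rfl⟩
      change ip x (I.eqn e) = 0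
      rw [ip_comm, I.ip_eqn, (I.mem_L_iff x).mp hx e, mul_zero]
    exact this hS

theorem perpCond_iff {I : Instance} {a : ℕ → ℕ → ℕ → ℝ}
    (ha : ∀ e : Fin I.r, Rep (a e) (I.a e)) {T : ℕ → ℕ → ℝ} {S : Sym I.n} (hS : Rep T S.1) :
    PerpCond I.n I.r a T ↔ S ∈ perp I.L := by
  rw [I.mem_perp_L_iff, PerpCond]
  have key : ∀ (u : ℕ → ℝ) (i j : Fin I.n), ∑ e ∈ Finset.range I.r, u e * (a e i j + a e j i) =
      (∑ e : Fin I.r, u e • I.eqn e).1 i j := by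
    intro u i j
    rw [Finset.sum_range, AddSubmonoidClass.coe_finsetSum, Matrix.sum_apply]
    refine Finset.sum_congr rfl fun e _ => ?_
    rw [ha, ha]
    rfl
  constructor
  · rintro ⟨u, hu⟩
    -- The tested right-hand side is `T + Tᵀ`, which is twice the matrix.
    refine ⟨fun e => u e / 2, ?_⟩
    apply Subtype.ext
    ext i j
    have h1 := key (fun e => u e / 2) i j
    rw [← h1]
    have h2 := hu i i.2 j j.2
    rw [hS, hS, S.apply_comm j i] at h2
    have h3 : ∑ e ∈ Finset.range I.r, u e / 2 * (a e i j + a e j i) =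
        (∑ e ∈ Finset.range I.r, u e * (a e i j + a e j i)) / 2 := by
      rw [Finset.sum_div]
      exact Finset.sum_congr rfl fun e _ => by ring
    rw [h3, h2]
    ring
  · rintro ⟨u, hu⟩
    obtain ⟨w, rfl⟩ := exists_extend u
    refine ⟨fun e => 2 * w e, fun i hi j hj => ?_⟩
    have h1 := key w ⟨i, hi⟩ ⟨j, hj⟩
    rw [hu] at h1
    have h3 : ∑ e ∈ Finset.range I.r, 2 * w e * (a e i j + a e j i) =
        2 * ∑ e ∈ Finset.range I.r, w e * (a e i j + a e j i) := by
      rw [Finset.mul_sum]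
      exact Finset.sum_congr rfl fun e _ => by ring
    have h4 := hS ⟨i, hi⟩ ⟨j, hj⟩
    have h5 := hS ⟨j, hj⟩ ⟨i, hi⟩
    rw [S.apply_comm] at h5
    simp only at h1 h4 h5
    rw [h3, h1, h4, h5]
    ring

theorem lowerRight_cong_apply {d n : ℕ} (h : d ≤ n) (P : Matrix (Fin n) (Fin n) ℝ) (x : Sym n)
    (p q : Fin d) : (lowerRight h (cong P x)).1 p q =
      ∑ i, ∑ j, P i (tailIdx h p) * x.1 i j * P j (tailIdx h q) := by
  change (Pᵀ * x.1 * P) (tailIdx h p) (tailIdx h q) = _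
  rw [Matrix.mul_apply, Finset.sum_comm]
  refine Finset.sum_congr rfl fun j _ => ?_
  rw [Matrix.mul_apply, Finset.sum_mul]
  rfl

theorem Rep.compF {d n : ℕ} (h : d ≤ n) {F c : ℕ → ℕ → ℝ} {P : Matrix (Fin n) (Fin n) ℝ}
    {x : Sym n} (hF : Rep F P) (hc : Rep c x.1) :
    Rep (compF n d F c) (lowerRight h (cong P x)).1 := by
  intro p q
  rw [lowerRight_cong_apply, SDFP.compF, Finset.sum_range]
  refine Finset.sum_congr rfl fun i _ => ?_
  rw [Finset.sum_range]
  refine Finset.sum_congr rfl fun j _ => ?_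
  rw [hc, ← hF, ← hF]
  rfl

/-- The matrix `P (0 ⊕ y) Pᵀ`. -/
def liftSym {d n : ℕ} (h : d ≤ n) (P : Matrix (Fin n) (Fin n) ℝ) (y : Sym d) : Sym n :=
  ⟨Matrix.of fun i j => ∑ p, ∑ q, P i (tailIdx h p) * y.1 p q * P j (tailIdx h q), by
    ext i j
    simp only [Matrix.transpose_apply, Matrix.of_apply]
    rw [Finset.sum_comm]
    refine Finset.sum_congr rfl fun p _ => Finset.sum_congr rfl fun q _ => ?_
    rw [y.apply_comm]
    ring⟩

/-- The lift is adjoint to taking the lower right block of `Pᵀ x P`. Orthogonality to the linear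
part of the last subproblem thus becomes orthogonality to `L`, whose equations are given. -/
theorem ip_liftSym {d n : ℕ} (h : d ≤ n) (P : Matrix (Fin n) (Fin n) ℝ) (y : Sym d) (x : Sym n) :
    ip (liftSym h P y) x = ip y (lowerRight h (cong P x)) := by
  simp only [ip_eq_sum, lowerRight_cong_apply, liftSym, Matrix.of_apply, Finset.mul_sum,
    Finset.sum_mul]
  have h1 : ∀ f : Fin n → Fin n → Fin d → Fin d → ℝ,
      ∑ i, ∑ j, ∑ p, ∑ q, f i j p q = ∑ p, ∑ q, ∑ i, ∑ j, f i j p q := by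
    intro f
    calc ∑ i, ∑ j, ∑ p, ∑ q, f i j p q = ∑ i, ∑ p, ∑ j, ∑ q, f i j p q :=
          Finset.sum_congr rfl fun i _ => Finset.sum_comm
      _ = ∑ p, ∑ i, ∑ j, ∑ q, f i j p q := Finset.sum_comm
      _ = ∑ p, ∑ i, ∑ q, ∑ j, f i j p q :=
          Finset.sum_congr rfl fun p _ => Finset.sum_congr rfl fun i _ => Finset.sum_comm
      _ = _ := Finset.sum_congr rfl fun p _ => Finset.sum_comm
  rw [h1]
  refine Finset.sum_congr rfl fun p _ => Finset.sum_congr rfl fun q _ =>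
    Finset.sum_congr rfl fun i _ => Finset.sum_congr rfl fun j _ => by ring

theorem mem_perp_map_iff {d n : ℕ} (h : d ≤ n) (P : Matrix (Fin n) (Fin n) ℝ)
    (L : Submodule ℝ (Sym n)) (y : Sym d) :
    y ∈ perp ((L.map (cong P)).map (lowerRight h)) ↔ liftSym h P y ∈ perp L := by
  constructor
  · intro hy x hx
    rw [ip_liftSym]
    exact hy _ (Submodule.mem_map_of_mem (Submodule.mem_map_of_mem hx))
  · rintro hy _ ⟨_, ⟨x, hx, rfl⟩, rfl⟩
    rw [← ip_liftSym]
    exact hy x hx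

theorem Rep.liftF {d n : ℕ} (h : d ≤ n) {F T : ℕ → ℕ → ℝ} {P : Matrix (Fin n) (Fin n) ℝ}
    {y : Sym d} (hF : Rep F P) (hT : Rep T y.1) :
    Rep (liftF n d F T) (liftSym h P y).1 := by
  intro i j
  rw [SDFP.liftF, Finset.sum_range]
  refine Finset.sum_congr rfl fun p _ => ?_
  rw [Finset.sum_range]
  refine Finset.sum_congr rfl fun q _ => ?_
  rw [hT, ← hF, ← hF]
  rfl

theorem imageCond_iff {I : Instance} {a : ℕ → ℕ → ℕ → ℝ}
    (ha : ∀ e : Fin I.r, Rep (a e) (I.a e)) {D : ℕ} (h : D ≤ I.n) {F T : ℕ → ℕ → ℝ} {P : Matrix (Fin I.n) (Fin I.n) ℝ}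
    {t : Sym D} (hF : Rep F P) (hT : Rep T t.1) :
    ImageCond I.n I.r D a F T ↔ t ∈ (I.L.map (cong P)).map (lowerRight h) := by
  have e1 : ∀ (U : ℕ → ℕ → ℝ) (e : Fin I.r),
      ∑ i ∈ Finset.range I.n, ∑ j ∈ Finset.range I.n, U i j * (a e i j + a e j i) =
      ∑ i : Fin I.n, ∑ j : Fin I.n, I.a e i j * (U i j + U j i) := by
    intro U e
    rw [Finset.sum_range]
    simp only [Finset.sum_range]
    rw [sum_mul_add_swap (fun i j : Fin I.n => U i j) (fun i j : Fin I.n => a e i j)]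
    refine Finset.sum_congr rfl fun i _ => Finset.sum_congr rfl fun j _ => ?_
    rw [ha e i j, mul_comm]
  have e2 : ∀ (U : ℕ → ℕ → ℝ) (p q : Fin D),
      ∑ i ∈ Finset.range I.n, ∑ j ∈ Finset.range I.n, U i j *
        (F i (I.n - D + p) * F j (I.n - D + q) + F j (I.n - D + p) * F i (I.n - D + q)) =
      ∑ i : Fin I.n, ∑ j : Fin I.n, P i (tailIdx h p) * (U i j + U j i) * P j (tailIdx h q) := by
    intro U p q
    rw [Finset.sum_range]
    simp only [Finset.sum_range]
    rw [sum_mul_add_swap (fun i j : Fin I.n => U i j)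
      (fun i j : Fin I.n => F i (I.n - D + p) * F j (I.n - D + q))]
    refine Finset.sum_congr rfl fun i _ => Finset.sum_congr rfl fun j _ => ?_
    rw [← hF i (tailIdx h p), ← hF j (tailIdx h q)]
    simp only [tailIdx]
    ring
  constructor
  · rintro ⟨U, hU1, hU2⟩
    let l : Sym I.n := ⟨Matrix.of fun i j : Fin I.n => U i j + U j i, by
      ext i j
      simp only [Matrix.transpose_apply, Matrix.of_apply]
      ring⟩
    refine ⟨cong P l, ⟨l, ?_, rfl⟩, ?_⟩
    · change l ∈ I.L
      rw [I.mem_L_iff]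
      intro e
      rw [← hU1 e e.2, e1]
      rfl
    · apply Subtype.ext
      ext p q
      rw [lowerRight_cong_apply, ← hT p q, ← hU2 p p.2 q q.2, e2]
      rfl
  · rintro ⟨_, ⟨l, hl, rfl⟩, rfl⟩
    -- Half of `l` has symmetrisation `l`; the values outside the matrix are never read.
    let U : ℕ → ℕ → ℝ := fun i j =>
      if h : i < I.n ∧ j < I.n then l.1 ⟨i, h.1⟩ ⟨j, h.2⟩ / 2 else 0
    have hU : ∀ i j : Fin I.n, U i j + U j i = l.1 i j := by
      intro i j
      simp only [U, i.2, j.2, and_self, dif_pos, Fin.eta]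
      rw [l.apply_comm j i]
      ring
    refine ⟨U, fun e he => ?_, fun p hp q hq => ?_⟩
    · rw [e1 U ⟨e, he⟩]
      simp only [hU]
      exact (I.mem_L_iff l).mp hl ⟨e, he⟩
    · have h1 := hT ⟨p, hp⟩ ⟨q, hq⟩
      simp only at h1
      rw [h1, lowerRight_cong_apply, e2 U ⟨p, hp⟩ ⟨q, hq⟩]
      simp only [hU]

theorem dirCond_iff {I : Instance} {a : ℕ → ℕ → ℕ → ℝ}
    (ha : ∀ e : Fin I.r, Rep (a e) (I.a e)) {s k : ℕ} (hsk : s + k ≤ I.n) (hk : 1 ≤ k) {F T : ℕ → ℕ → ℝ}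
    {P : Matrix (Fin I.n) (Fin I.n) ℝ} {A : Sym I.n} (hF : Rep F P) (hT : Rep T A.1) :
    DirCond I.n I.r s k a F T ↔ DirOK I.L P s (k, A) := by
  rw [DirCond, DirOK, imageCond_iff ha le_rfl hF hT]
  have hid : (I.L.map (cong P)).map (lowerRight (le_refl I.n)) = I.L.map (cong P) := by
    rw [show lowerRight (le_refl I.n) = LinearMap.id from
      LinearMap.ext fun x => lowerRight_self _ x, Submodule.map_id]
  rw [hid]
  have hsub : SymmOn k (fun i j => T (s + i) (s + j)) :=
    fun i hi j hj => hT.symmOn _ (by omega) _ (by omega)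
  obtain ⟨Ah, hAh⟩ := exists_symm_rep hsub
  have htail : ∀ i : Fin (I.n - s), (tailIdx (Nat.sub_le I.n s) i : ℕ) = s + i := by
    intro i
    simp only [tailIdx]
    omega
  have hlr : ∀ i j : Fin (I.n - s), (lowerRight (Nat.sub_le I.n s) A).1 i j =
      T (s + i) (s + j) := by
    intro i j
    rw [← htail, ← htail, hT]
    rfl
  constructor
  · rintro ⟨_, h1, h2, h3⟩
    refine ⟨hk, h3, Ah.1, hAh.qfPos_iff.mp h2, ?_⟩
    ext i j
    rw [hlr, pad]
    split_ifs with hij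
    · exact hAh ⟨i, hij.1⟩ ⟨j, hij.2⟩
    · exact h1 _ (by omega) _ (by omega) (by omega) (by omega) (by omega)
  · rintro ⟨_, h3, A', h4, h5⟩
    have h6 : ∀ i j, (hi : i < I.n - s) → (hj : j < I.n - s) →
        T (s + i) (s + j) = pad (I.n - s) A' ⟨i, hi⟩ ⟨j, hj⟩ := by
      intro i j hi hj
      rw [← h5, hlr]
    refine ⟨hT.symmOn, ?_, ?_, h3⟩
    · intro i hi j hj hsi hsj hij
      obtain ⟨i, rfl⟩ := Nat.exists_eq_add_of_le hsi
      obtain ⟨j, rfl⟩ := Nat.exists_eq_add_of_le hsj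
      rw [h6 i j (by omega) (by omega), pad, dif_neg]
      simp only
      omega
    · have h7 : Ah.1 = A' := by
        ext i j
        rw [← hAh i j]
        simp only
        rw [h6 i j (by omega) (by omega), pad, dif_pos ⟨i.2, j.2⟩]
      rw [hAh.qfPos_iff, h7]
      exact h4

end SDFP

namespace SDFP

open BSS BSS.Ex

/-! ### Codes of instances and certificates -/

theorem getD_append_add (l l' : List ℝ) {c : ℕ} (h : l.length = c) (k : ℕ) :
    (l ++ l').getD (c + k) 0 = l'.getD k 0 := by
  subst h
  rw [List.getD_append_right _ _ _ _ (Nat.le_add_right _ _), Nat.add_sub_cancel_left]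

theorem getD_flatten {c : ℕ} (ls : List (List ℝ)) (h : ∀ l ∈ ls, l.length = c) {i j : ℕ}
    (hi : i < ls.length) (hj : j < c) : ls.flatten.getD (i * c + j) 0 = ls[i].getD j 0 := by
  induction ls generalizing i with
  | nil => simp at hi
  | cons l ls ih =>
    have hl : l.length = c := h l (by simp)
    rw [List.flatten_cons]
    cases i with
    | zero =>
      rw [zero_mul, zero_add, List.getD_append _ _ _ _ (by omega)]
      rfl
    | succ i =>
      rw [show (i + 1) * c + j = c + (i * c + j) by ring, getD_append_add _ _ hl,
        ih (fun l' hl' => h l' (by simp [hl'])) (by simpa using hi)]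
      rfl

theorem length_flatten_eq {c : ℕ} (ls : List (List ℝ)) (h : ∀ l ∈ ls, l.length = c) :
    ls.flatten.length = ls.length * c := by
  induction ls with
  | nil => simp
  | cons l ls ih =>
    rw [List.flatten_cons, List.length_append, h l (by simp),
      ih fun l' hl' => h l' (by simp [hl']), List.length_cons]
    ring

theorem length_entries {d : ℕ} (M : Matrix (Fin d) (Fin d) ℝ) :
    (entries M).length = d * d := by
  rw [entries, length_flatten_eq (c := d)]
  · simp
  · intro l hl
    obtain ⟨i, rfl⟩ := List.mem_ofFn.mp hl
    simp

theorem getD_entries {d : ℕ} (M : Matrix (Fin d) (Fin d) ℝ) (i j : Fin d) :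
    (entries M).getD (i * d + j) 0 = M i j := by
  rw [entries, getD_flatten (c := d) _ _ (by simp) j.2]
  · simp
  · intro l hl
    obtain ⟨i, rfl⟩ := List.mem_ofFn.mp hl
    simp

/-- The position of an entry lies within the list of entries. -/
theorem pos_lt {d : ℕ} (i j : Fin d) : (i : ℕ) * d + j < d * d := by
  have h : ((i : ℕ) + 1) * d ≤ d * d := Nat.mul_le_mul_right _ i.2
  have := j.2
  rw [add_mul] at h
  omega

theorem getD_entries_append {d : ℕ} (M : Matrix (Fin d) (Fin d) ℝ) (l : List ℝ) (i j : Fin d) :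
    (entries M ++ l).getD (i * d + j) 0 = M i j := by
  rw [List.getD_append _ _ _ _ (by rw [length_entries]; exact pos_lt i j), getD_entries]

theorem length_flatten_entries {d m : ℕ} {α : Type*} (l : List α) (hl : l.length = m)
    (f : α → Matrix (Fin d) (Fin d) ℝ) :
    (l.map fun x => entries (f x)).flatten.length = m * d * d := by
  rw [length_flatten_eq (c := d * d)]
  · simp [hl, mul_assoc]
  · intro x hx
    obtain ⟨y, _, rfl⟩ := List.mem_map.mp hx
    exact length_entries _

theorem getD_flatten_entries {d : ℕ} {α : Type*} (l : List α)
    (f : α → Matrix (Fin d) (Fin d) ℝ) (l' : List ℝ) {e : ℕ} (he : e < l.length) (i j : Fin d) :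
    ((l.map fun x => entries (f x)).flatten ++ l').getD (e * d * d + i * d + j) 0 =
      f l[e] i j := by
  have hc : ∀ x ∈ l.map fun x => entries (f x), x.length = d * d := by
    intro x hx
    obtain ⟨y, _, rfl⟩ := List.mem_map.mp hx
    exact length_entries _
  have hpos := pos_lt i j
  rw [List.getD_append, show e * d * d + i * d + j = e * (d * d) + (i * d + j) by ring,
    getD_flatten _ hc (by simpa using he) hpos]
  · simp only [List.getElem_map, getD_entries]
  · rw [length_flatten_entries l rfl]
    have : (e + 1) * (d * d) ≤ l.length * (d * d) := Nat.mul_le_mul_right _ he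
    rw [add_mul] at this
    calc e * d * d + i * d + j = e * (d * d) + (i * d + j) := by ring
      _ < l.length * (d * d) := by omega
      _ = _ := by ring

theorem Instance.length_encode (I : Instance) :
    I.encode.length = 2 + I.r * I.n * I.n + I.n * I.n := by
  rw [Instance.encode, List.length_append, List.length_append, List.ofFn_eq_map,
    length_flatten_entries (List.finRange I.r) (List.length_finRange), length_entries]
  simp

/-- The input that consists of the code of an instance and a second component. -/
noncomputable def inputF (I : Instance) (w : List ℝ) (k : ℕ) : ℝ := (pair I.encode w).getD k 0

theorem inputF_one_add (I : Instance) (w : List ℝ) (k : ℕ) :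
    inputF I w (1 + k) = (I.encode ++ w).getD k 0 :=
  getD_append_add [(I.encode.length : ℝ)] (I.encode ++ w) rfl k

theorem wF_inputF (I : Instance) (w : List ℝ) :
    wF (inputF I w) I.encode.length = fun k => w.getD k 0 := by
  funext k
  rw [wF, add_assoc, inputF_one_add, getD_append_add _ _ rfl]

theorem inputF_three_add (I : Instance) (w : List ℝ) (k : ℕ) :
    inputF I w (3 + k) =
      ((List.ofFn fun e => entries (I.a e)).flatten ++ (entries I.c.1 ++ w)).getD k 0 := by
  rw [show 3 + k = 1 + (2 + k) by ring, inputF_one_add, Instance.encode, List.append_assoc,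
    List.append_assoc, getD_append_add _ _ (by simp)]

theorem rep_aF (I : Instance) (w : List ℝ) (e : Fin I.r) :
    Rep (aF (inputF I w) I.n e) (I.a e) := by
  intro i j
  rw [aF, show 3 + (e : ℕ) * I.n * I.n + i * I.n + j = 3 + (e * I.n * I.n + i * I.n + j) by ring,
    inputF_three_add, List.ofFn_eq_map, getD_flatten_entries _ _ _ (by simp)]
  simp

theorem rep_cF (I : Instance) (w : List ℝ) : Rep (cF (inputF I w) I.n I.r) I.c.1 := by
  intro i j
  rw [cF, show 3 + I.r * I.n * I.n + (i : ℕ) * I.n + j =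
    3 + (I.r * I.n * I.n + (i * I.n + j)) by ring,
    inputF_three_add, List.ofFn_eq_map, getD_append_add _ _
      (length_flatten_entries (List.finRange I.r) (List.length_finRange) _), getD_entries_append]

theorem inputF_one (I : Instance) (w : List ℝ) : inputF I w 1 = I.n := rfl

theorem inputF_eq_zero (I : Instance) (w : List ℝ) {k : ℕ} (hk : (pair I.encode w).length ≤ k) :
    inputF I w k = 0 := List.getD_eq_default _ _ hk

/-- For `1 ≤ n` the entries of `c` and of the equations make the input longer than `n`, `n²` and
`r`, so index variables can reach these numbers. For `n = 0` the number `r` is not bounded by the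
length, and this size is treated apart. -/
theorem inputOK (I : Instance) (w : List ℝ) (hn : 1 ≤ I.n) :
    InputOK (pair I.encode w).length (inputF I w) I.n I.r I.encode.length := by
  have hlen : (pair I.encode w).length = 1 + (2 + I.r * I.n * I.n + I.n * I.n) + w.length := by
    rw [pair, List.length_cons, List.length_append, I.length_encode]
    ring
  have h1 : I.n ≤ I.n * I.n := Nat.le_mul_of_pos_left _ hn
  have h2 : I.r ≤ I.r * I.n * I.n := by
    rw [mul_assoc]
    exact Nat.le_mul_of_pos_right _ (by positivity)
  exact ⟨fun k hk => inputF_eq_zero I w hk, rfl, rfl, rfl, by omega, by omega, by omega⟩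

theorem eval_nE_inputF {μ : Mode} (I : Instance) (w : List ℝ) {ρ : ℕ → ℕ} {M : ℕ → ℕ → ℝ} :
    (nE : Ex μ).eval (pair I.encode w).length (inputF I w) ρ M = I.n := by
  rw [nE, eval_get', eval_const, show (1 : ℝ) = ((1 : ℕ) : ℝ) by simp,
    entry_natCast fun k hk => inputF_eq_zero I w hk, inputF_one]

/-- The sequence `w` starts with the code of `D`. -/
structure Encodes {n : ℕ} (w : ℕ → ℝ) (D : WeakCert n) : Prop where
  m_eq : w 0 = D.out.dirs.length
  d_eq : w 1 = D.out.d
  k_eq : ∀ l (h : l < D.out.dirs.length), w (2 + l) = D.out.dirs[l].1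
  dir : ∀ l (h : l < D.out.dirs.length), Rep (dirF w n D.out.dirs.length l) D.out.dirs[l].2.1
  cong : Rep (congF w n D.out.dirs.length) D.out.P
  b : Rep (lastF w n D.out.dirs.length D.out.d 0) D.out.B.1
  x : Rep (lastF w n D.out.dirs.length D.out.d 1) D.x.1
  y : Rep (lastF w n D.out.dirs.length D.out.d 2) D.y.1

theorem WeakCert.length_encode {n : ℕ} (D : WeakCert n) :
    D.encode.length = 2 + D.out.dirs.length + D.out.dirs.length * n * n + n * n +
      3 * (D.out.d * D.out.d) := by
  rw [WeakCert.encode]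
  simp only [List.length_append, length_entries, length_flatten_entries _ rfl, List.length_map,
    List.length_cons, List.length_nil]
  ring

theorem WeakCert.encodes {n : ℕ} (D : WeakCert n) : Encodes (fun k => D.encode.getD k 0) D := by
  set m := D.out.dirs.length with hm
  set d := D.out.d with hd
  have hA : (D.out.dirs.map (fun kA => entries kA.2.1)).flatten.length = m * n * n :=
    length_flatten_entries _ rfl _
  have h2 : ∀ k, D.encode.getD (2 + k) 0 = (D.out.dirs.map (fun kA => (kA.1 : ℝ)) ++
    ((D.out.dirs.map (fun kA => entries kA.2.1)).flatten ++ (entries D.out.P ++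
    (entries D.out.B.1 ++ (entries D.x.1 ++ entries D.y.1))))).getD k 0 := by
    intro k
    rw [WeakCert.encode]
    simp only [List.append_assoc]
    exact getD_append_add [(m : ℝ), (d : ℝ)] _ rfl k
  have h3 : ∀ k, D.encode.getD (2 + (m + k)) 0 =
    ((D.out.dirs.map (fun kA => entries kA.2.1)).flatten ++ (entries D.out.P ++
    (entries D.out.B.1 ++ (entries D.x.1 ++ entries D.y.1)))).getD k 0 := by
    intro k
    rw [h2, getD_append_add _ _ (by simp [hm])]
  have h4 : ∀ k, D.encode.getD (2 + (m + (m * n * n + k))) 0 = (entries D.out.P ++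
    (entries D.out.B.1 ++ (entries D.x.1 ++ entries D.y.1))).getD k 0 := by
    intro k
    rw [h3, getD_append_add _ _ hA]
  have h5 : ∀ k, D.encode.getD (2 + (m + (m * n * n + (n * n + k)))) 0 =
    (entries D.out.B.1 ++ (entries D.x.1 ++ entries D.y.1)).getD k 0 := by
    intro k
    rw [h4, getD_append_add _ _ (length_entries _)]
  have h6 : ∀ k, D.encode.getD (2 + (m + (m * n * n + (n * n + (d * d + k))))) 0 =
    (entries D.x.1 ++ entries D.y.1).getD k 0 := by
    intro k
    rw [h5, getD_append_add _ _ (length_entries _)]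
  have h7 : ∀ k, D.encode.getD (2 + (m + (m * n * n + (n * n + (d * d + (d * d + k)))))) 0 =
    (entries D.y.1).getD k 0 := by
    intro k
    rw [h6, getD_append_add _ _ (length_entries _)]
  refine ⟨rfl, rfl, fun l h => ?_, fun l h i j => ?_, fun i j => ?_, fun i j => ?_, fun i j => ?_,
    fun i j => ?_⟩
  · rw [h2, List.getD_append _ _ _ _ (by simpa using h), List.getD_eq_getElem _ _ (by simpa using h)]
    simp
  · rw [dirF, show 2 + m + l * n * n + (i : ℕ) * n + j =
      2 + (m + (l * n * n + i * n + j)) by ring, h3, getD_flatten_entries _ _ _ h]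
  · rw [congF, show 2 + m + m * n * n + (i : ℕ) * n + j =
      2 + (m + (m * n * n + (i * n + j))) by ring, h4, getD_entries_append]
  · rw [lastF, show 2 + m + m * n * n + n * n + 0 * d * d + (i : ℕ) * d + j =
      2 + (m + (m * n * n + (n * n + (i * d + j)))) by ring, h5, getD_entries_append]
  · rw [lastF, show 2 + m + m * n * n + n * n + 1 * d * d + (i : ℕ) * d + j =
      2 + (m + (m * n * n + (n * n + (d * d + (i * d + j))))) by ring, h6, getD_entries_append]
  · rw [lastF, show 2 + m + m * n * n + n * n + 2 * d * d + (i : ℕ) * d + j =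
      2 + (m + (m * n * n + (n * n + (d * d + (d * d + (i * d + j)))))) by ring, h7, getD_entries]

theorem sum_map_take {n : ℕ} (dirs : List (ℕ × Sym n)) {k : ℕ → ℕ}
    (hk : ∀ l (h : l < dirs.length), k l = dirs[l].1) {l : ℕ} (hl : l ≤ dirs.length) :
    ∑ l' ∈ Finset.range l, k l' = ((dirs.take l).map Prod.fst).sum := by
  induction l with
  | zero => simp
  | succ l ih =>
    rw [Finset.sum_range_succ, ih (by omega), hk l (by omega), List.take_add_one,
      List.map_append, List.sum_append]
    simp [List.getElem?_eq_getElem (show l < dirs.length by omega)]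

theorem Encodes.certCond_iff {I : Instance} {w : ℕ → ℝ} {D : WeakCert I.n} (h : Encodes w D)
    {a : ℕ → ℕ → ℕ → ℝ} (ha : ∀ e : Fin I.r, Rep (a e) (I.a e)) {c : ℕ → ℕ → ℝ}
    (hc : Rep c I.c.1) {k : ℕ → ℕ} (hk : ∀ l (h : l < D.out.dirs.length), k l = D.out.dirs[l].1)
    (hpos : ∀ l < D.out.dirs.length, 1 ≤ k l) :
    CertCond I.n I.r D.out.dirs.length D.out.d k a (dirF w I.n D.out.dirs.length) c
      (congF w I.n D.out.dirs.length) (lastF w I.n D.out.dirs.length D.out.d 0)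
      (lastF w I.n D.out.dirs.length D.out.d 1) (lastF w I.n D.out.dirs.length D.out.d 2) ↔
    D.IsValid I.L I.c := by
  have hdn := D.out.d_le
  have hcomp := Rep.compF hdn h.cong hc
  have hx : Rep (fun p q => lastF w I.n D.out.dirs.length D.out.d 1 p q -
      compF I.n D.out.d (congF w I.n D.out.dirs.length) c p q)
      (D.x - D.out.lastC I.c).1 := fun p q => by
    simp only [h.x p q, hcomp p q]
    rfl
  have hdirs : (∀ l < D.out.dirs.length, DirCond I.n I.r (∑ l' ∈ Finset.range l, k l') (k l) a
      (congF w I.n D.out.dirs.length) (dirF w I.n D.out.dirs.length l)) ↔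
      DirsOK I.L D.out.P 0 D.out.dirs := by
    rw [dirsOK_iff]
    have key : ∀ l (hl : l < D.out.dirs.length),
        DirCond I.n I.r (∑ l' ∈ Finset.range l, k l') (k l) a
        (congF w I.n D.out.dirs.length) (dirF w I.n D.out.dirs.length l) ↔
        DirOK I.L D.out.P (0 + ((D.out.dirs.take l).map Prod.fst).sum) D.out.dirs[l] := by
      intro l hl
      have hsum : ∑ l' ∈ Finset.range l, k l' + k l ≤ I.n := by
        have h1 := sum_map_take D.out.dirs hk le_rfl
        rw [List.take_length] at h1
        have h2 := D.out.size_eq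
        rw [← Finset.sum_range_succ]
        have h3 : ∑ l' ∈ Finset.range (l + 1), k l' ≤
            ∑ l' ∈ Finset.range D.out.dirs.length, k l' :=
          Finset.sum_le_sum_of_subset (Finset.range_subset_range.mpr hl)
        omega
      rw [dirCond_iff ha hsum (hpos l hl) h.cong (h.dir l hl), sum_map_take _ hk hl.le, zero_add,
        hk l hl]
    constructor
    · intro h' i
      exact (key i i.2).mp (h' i i.2)
    · intro h' l hl
      exact (key l hl).mpr (h' ⟨l, hl⟩)
  have htr : ∑ p ∈ Finset.range D.out.d, lastF w I.n D.out.dirs.length D.out.d 0 p p =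
      D.out.B.1.trace := by
    rw [Finset.sum_range, Matrix.trace]
    exact Finset.sum_congr rfl fun p _ => h.b p p
  have hy0 : (∀ p < D.out.d, ∀ q < D.out.d, lastF w I.n D.out.dirs.length D.out.d 2 p q = 0) ↔
      D.y = 0 := by
    constructor
    · intro h'
      apply Subtype.ext
      ext p q
      rw [← h.y p q]
      exact h' p p.2 q q.2
    · intro h' p hp q hq
      rw [h.y ⟨p, hp⟩ ⟨q, hq⟩, h']
      rfl
  have haff : D.x - D.out.lastC I.c ∈ (I.L.map (SDFP.cong D.out.P)).map (lowerRight hdn) ↔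
      D.x ∈ aff (D.out.lastL I.L) (D.out.lastC I.c) := by
    constructor
    · intro h'
      exact ⟨_, h', (sub_add_cancel _ _).symm⟩
    · rintro ⟨l, hl, hl'⟩
      rw [hl', add_sub_cancel_right]
      exact hl
  rw [CertCond, h.cong.qfPos_gram_iff, hdirs, h.b.qfPos_iff, htr,
    perpCond_iff ha (Rep.liftF hdn h.cong h.b), ← mem_perp_map_iff,
    h.x.qfNonneg_iff, imageCond_iff ha hdn h.cong hx, haff, h.y.qfNonneg_iff, hy0,
    h.y.sum_eq hcomp, ← ip_eq_sum, perpCond_iff ha (Rep.liftF hdn h.cong h.y),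
    ← mem_perp_map_iff, WeakCert.IsValid, meetsSpec_iff, WeakFeasCert, mem_interior_K]
  have hb := h.b.symmOn
  have hx := h.x.symmOn
  have hy := h.y.symmOn
  simp only [FPOutput.lastL, FPOutput.lastC]
  tauto

theorem Encodes.exists_numbers_iff {I : Instance} {w : ℕ → ℝ} {D : WeakCert I.n}
    (h : Encodes w D) {a : ℕ → ℕ → ℕ → ℝ} (ha : ∀ e : Fin I.r, Rep (a e) (I.a e))
    {c : ℕ → ℕ → ℝ} (hc : Rep c I.c.1) :
    (∃ (m d : ℕ) (k : ℕ → ℕ), Numbers w I.n m d k ∧ CertCond I.n I.r m d k a (dirF w I.n m) c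
      (congF w I.n m) (lastF w I.n m d 0) (lastF w I.n m d 1) (lastF w I.n m d 2)) ↔
    D.IsValid I.L I.c := by
  constructor
  · rintro ⟨m, d, k, hN, hC⟩
    have hm : m = D.out.dirs.length := by
      have := hN.m_eq
      rw [h.m_eq] at this
      exact_mod_cast this.symm
    have hd : d = D.out.d := by
      have := hN.d_eq
      rw [h.d_eq] at this
      exact_mod_cast this.symm
    subst hm hd
    refine (h.certCond_iff ha hc (fun l hl => ?_) hN.k_pos).mp hC
    have := hN.k_eq l hl
    rw [h.k_eq l hl] at this
    exact_mod_cast this.symm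
  · intro hD
    have hk : ∀ l (hl : l < D.out.dirs.length),
        (D.out.dirs.getD l (0, 0)).1 = D.out.dirs[l].1 := by
      intro l hl
      rw [List.getD_eq_getElem _ _ hl]
    have hpos : ∀ l < D.out.dirs.length, 1 ≤ (D.out.dirs.getD l (0, 0)).1 := by
      intro l hl
      rw [hk l hl]
      exact (hD.1.2.1 ⟨l, hl⟩).1
    refine ⟨_, _, fun l => (D.out.dirs.getD l (0, 0)).1,
      ⟨h.m_eq, h.d_eq, fun l hl => by rw [h.k_eq l hl, hk l hl], hpos, ?_⟩,
      (h.certCond_iff ha hc hk hpos).mpr hD⟩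
    rw [sum_map_take _ hk le_rfl, List.take_length]
    exact D.out.size_eq

/-- The witness in `NP` is an arbitrary real vector. The numbers and symmetries that have been
tested allow a genuine certificate to be read off from it; whatever follows the code is ignored. -/
theorem exists_encodes {n r m d : ℕ} {k : ℕ → ℕ} {w : ℕ → ℝ} {a : ℕ → ℕ → ℕ → ℝ}
    {c : ℕ → ℕ → ℝ} (hN : Numbers w n m d k) (hC : CertCond n r m d k a (dirF w n m) c
      (congF w n m) (lastF w n m d 0) (lastF w n m d 1) (lastF w n m d 2)) :
    ∃ D : WeakCert n, Encodes w D := by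
  obtain ⟨_, hA, ⟨hB, _⟩, ⟨hx, _⟩, hy, _⟩ := hC
  choose A hA' using fun l : Fin m => exists_symm_rep (hA l l.2).1
  obtain ⟨B, hB'⟩ := exists_symm_rep hB
  obtain ⟨x, hx'⟩ := exists_symm_rep hx
  obtain ⟨y, hy'⟩ := exists_symm_rep hy
  let dirs : List (ℕ × Sym n) := List.ofFn fun l : Fin m => (k l, A l)
  have hlen : dirs.length = m := by simp [dirs]
  have hsize : (dirs.map Prod.fst).sum + d = n := by
    refine Eq.trans ?_ hN.sum_eq
    rw [Finset.sum_range]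
    simp [dirs, List.map_ofFn, List.sum_ofFn]
  refine ⟨⟨⟨dirs, d, hsize, Matrix.of fun i j => congF w n m i j, B⟩, x, y⟩, ?_⟩
  have hdir : ∀ l (h : l < dirs.length), dirs[l] = (k l, A ⟨l, by omega⟩) := by
    intro l h
    simp [dirs]
  constructor
  · rw [hN.m_eq, hlen]
  · exact hN.d_eq
  · intro l h
    simp only at h ⊢
    rw [hdir l h, hN.k_eq l (by omega)]
  · intro l h
    simp only at h ⊢
    rw [hdir l h, hlen]
    exact hA' ⟨l, by omega⟩
  · intro i j
    simp only [hlen]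
    rfl
  · simp only [hlen]
    exact hB'
  · simp only [hlen]
    exact hx'
  · simp only [hlen]
    exact hy'

/-- An empty `B` has trace zero, not one. -/
theorem WeakCert.IsValid.one_le {n : ℕ} {L : Submodule ℝ (Sym n)} {c : Sym n} {D : WeakCert n}
    (h : D.IsValid L c) : 1 ≤ n := by
  have h1 : D.out.B.1.trace = 1 := h.1.2.2.2.2
  have h2 := D.out.d_le
  by_contra hn
  have h3 : IsEmpty (Fin D.out.d) := ⟨fun i => by have := i.2; omega⟩
  rw [Matrix.trace, Finset.univ_eq_empty, Finset.sum_empty] at h1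
  exact zero_ne_one h1

theorem one_le_of_sat_certTest {I : Instance} {w : List ℝ}
    (h : Sat (pair I.encode w).length (inputF I w) 0 0 certTest) : 1 ≤ I.n := by
  rw [certTest, sat_conj, sat_le, eval_nE_inputF, eval_const] at h
  exact_mod_cast h.1

theorem sat_certTest_iff (I : Instance) (w : List ℝ) (hn : 1 ≤ I.n) {D : WeakCert I.n}
    (hD : Encodes (fun k => w.getD k 0) D) :
    Sat (pair I.encode w).length (inputF I w) 0 0 certTest ↔ D.IsValid I.L I.c := by
  rw [(inputOK I w hn).sat_certTest hn, wF_inputF]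
  exact hD.exists_numbers_iff (rep_aF I w) (rep_cF I w)

/-- A certificate is valid if and only if it passes the test. -/
theorem sat_certTest_encode (I : Instance) (D : WeakCert I.n) :
    Sat (pair I.encode D.encode).length (inputF I D.encode) 0 0 certTest ↔
      D.IsValid I.L I.c :=
  ⟨fun h => (sat_certTest_iff I _ (one_le_of_sat_certTest h) D.encodes).mp h,
    fun h => (sat_certTest_iff I _ h.one_le D.encodes).mpr h⟩

theorem exists_valid_of_sat_certTest {I : Instance} {w : List ℝ}
    (h : Sat (pair I.encode w).length (inputF I w) 0 0 certTest) :
    ∃ D : WeakCert I.n, D.IsValid I.L I.c := by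
  have hn := one_le_of_sat_certTest h
  obtain ⟨m, d, k, hN, hC⟩ := ((inputOK I w hn).sat_certTest hn).mp h
  rw [wF_inputF] at hN hC
  obtain ⟨D, hD⟩ := exists_encodes hN hC
  exact ⟨D, (sat_certTest_iff I w hn hD).mp h⟩

theorem not_weakStatus_of_size_zero {I : Instance} (hn : I.n = 0) : ¬ WeakStatus I.L I.c := by
  rw [not_weakStatus_iff]
  refine Or.inl ⟨I.c, ⟨0, I.L.zero_mem, (zero_add _).symm⟩, (Sym.posDef_iff _).mpr fun v hv => ?_⟩
  have : IsEmpty (Fin I.n) := by rw [hn]; infer_instance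
  exact absurd (Subsingleton.elim v 0) hv

theorem strongCond_iff (I : Instance) {a : ℕ → ℕ → ℕ → ℝ}
    (ha : ∀ e : Fin I.r, Rep (a e) (I.a e)) {c X : ℕ → ℕ → ℝ} (hc : Rep c I.c.1) {x : Sym I.n}
    (hX : Rep X x.1) : StrongCond I.n I.r a c X ↔
      StrongFeasCert I.L I.c x ∨ StrongInfeasCert I.L I.c x := by
  have haff : (∀ e < I.r, ∑ i ∈ Finset.range I.n, ∑ j ∈ Finset.range I.n,
      a e i j * (X i j - c i j) = 0) ↔ x ∈ aff I.L I.c := by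
    have h1 : Rep (fun i j => X i j - c i j) (x - I.c).1 := fun i j => by
      simp only [hX i j, hc i j]
      rfl
    have h2 : ∀ e : Fin I.r, ∑ i ∈ Finset.range I.n, ∑ j ∈ Finset.range I.n,
      a e i j * (X i j - c i j) = ∑ i, ∑ j, I.a e i j * (x - I.c).1 i j :=
      fun e => (ha e).sum_eq h1
    have h3 : x ∈ aff I.L I.c ↔ x - I.c ∈ I.L := by
      constructor
      · rintro ⟨l, hl, rfl⟩
        rwa [add_sub_cancel_right]
      · intro h'
        exact ⟨_, h', (sub_add_cancel _ _).symm⟩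
    rw [h3, I.mem_L_iff]
    exact ⟨fun h e => by rw [← h2]; exact h e e.2, fun h e he => by rw [h2 ⟨e, he⟩]; exact h _⟩
  rw [StrongCond, hX.qfPos_iff, haff, hX.qfNonneg_iff, perpCond_iff ha hX, hX.sum_eq hc,
    ← ip_eq_sum, StrongFeasCert, StrongInfeasCert]
  have := hX.symmOn
  tauto

theorem sat_strongTest_of_not_weakStatus {I : Instance} (h : ¬ WeakStatus I.L I.c) :
    ∃ x : Sym I.n, Sat (pair I.encode (entries x.1)).length (inputF I (entries x.1)) 0 0
      strongTest := by
  rw [not_weakStatus_iff, ← exists_or] at h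
  obtain ⟨x, hx⟩ := h
  refine ⟨x, ?_⟩
  rcases Nat.eq_zero_or_pos I.n with hn | hn
  · rw [strongTest, sat_disj, sat_le, eval_nE_inputF, eval_const]
    exact Or.inl (by exact_mod_cast hn.le)
  · rw [(inputOK I _ hn).sat_strongTest hn, wF_inputF]
    exact (strongCond_iff I (rep_aF I _) (rep_cF I _)
      (fun i j => getD_entries x.1 i j)).mpr hx

theorem not_weakStatus_of_sat_strongTest {I : Instance} {w : List ℝ}
    (h : Sat (pair I.encode w).length (inputF I w) 0 0 strongTest) : ¬ WeakStatus I.L I.c := by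
  rcases Nat.eq_zero_or_pos I.n with hn | hn
  · exact not_weakStatus_of_size_zero hn
  · rw [(inputOK I _ hn).sat_strongTest hn] at h
    obtain ⟨x, hx⟩ := exists_symm_rep h.1
    rw [strongCond_iff I (rep_aF I _) (rep_cF I _) hx] at h
    rw [not_weakStatus_iff, ← exists_or]
    exact ⟨x, h⟩

/-! ### Length of certificates -/

/-- The bound for the length of a certificate. -/
noncomputable def lengthBound : Polynomial ℕ :=
  2 + Polynomial.X + Polynomial.X ^ 3 + 4 * Polynomial.X ^ 2

theorem eval_lengthBound (n : ℕ) : lengthBound.eval n = 2 + n + n ^ 3 + 4 * n ^ 2 := by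
  simp [lengthBound]

theorem WeakCert.IsValid.length_le {n : ℕ} {L : Submodule ℝ (Sym n)} {c : Sym n} {D : WeakCert n}
    (h : D.IsValid L c) : D.encode.length ≤ lengthBound.eval n := by
  have hd := D.out.d_le
  have hm : D.out.dirs.length ≤ n := by
    -- Every `kᵢ` is at least `1` in a valid certificate, so there are at most `n` directions.
    have h1 : D.out.dirs.length ≤ (D.out.dirs.map Prod.fst).sum := by
      have := List.card_nsmul_le_sum (D.out.dirs.map Prod.fst) 1 (by
        intro k hk
        obtain ⟨a, ha, rfl⟩ := List.mem_map.mp hk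
        obtain ⟨i, hi⟩ := List.get_of_mem ha
        rw [← hi]
        exact (h.1.2.1 i).1)
      simpa using this
    have := D.out.size_eq
    omega
  rw [D.length_encode, eval_lengthBound]
  have h1 : D.out.dirs.length * n * n ≤ n * n * n := by gcongr
  have h2 : D.out.d * D.out.d ≤ n * n := Nat.mul_le_mul hd hd
  calc _ ≤ 2 + n + n * n * n + n * n + 3 * (n * n) := by omega
    _ = _ := by ring

theorem Instance.n_le_length (I : Instance) : I.n ≤ I.encode.length := by
  rw [I.length_encode]
  have := Nat.le_mul_self I.n
  omega

theorem lengthBound_mono {m n : ℕ} (h : m ≤ n) : lengthBound.eval m ≤ lengthBound.eval n := by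
  rw [eval_lengthBound, eval_lengthBound]
  gcongr

/-! ### Complexity -/

/-- The inputs that satisfy a formula. -/
def satSet (e : Ex .outer) : Set (List ℝ) :=
  {z | Sat z.length (fun k => z.getD k 0) 0 0 e}

theorem mem_satSet_pair {e : Ex .outer} {I : Instance} {w : List ℝ} :
    pair I.encode w ∈ satSet e ↔ Sat (pair I.encode w).length (inputF I w) 0 0 e := Iff.rfl

theorem pair_ne_nil (x w : List ℝ) : pair x w ≠ [] := List.cons_ne_nil _ _

theorem inP_certPairs : InP certPairs validCertPairs := by
  refine InP.of_ex certTest ?_ ?_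
  · rintro _ ⟨I, D, rfl⟩
    exact pair_ne_nil _ _
  · rintro _ ⟨I, D, rfl⟩
    change _ ↔ Sat _ (inputF I D.encode) 0 0 certTest
    constructor
    -- The coding need not be shown injective: the test sees only the code, so it passes for `(I,
    -- D)` because it passes for `(I', D')`.
    · rintro ⟨I', D', hD', heq⟩
      have h := (sat_certTest_encode I' D').mpr hD'
      rw [← mem_satSet_pair, ← heq] at h
      exact h
    · intro h
      exact ⟨I, D, (sat_certTest_encode I D).mp h, rfl⟩

theorem inP_satSet {X : Set (List ℝ)} (hX : ∀ x ∈ X, x ≠ []) (e : Ex .outer) :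
    InP X (satSet e) := InP.of_ex e hX fun _ _ => Iff.rfl

/-- The verifier is the certificate test itself. Soundness holds for every witness, whatever its
form, since passing the test yields some valid certificate; completeness uses the length bound. -/
theorem inNP_weakInstances : InNP instances weakInstances := by
  refine ⟨satSet certTest, lengthBound, inP_satSet ?_ _, ?_⟩
  · rintro _ ⟨x, _, w, _, rfl⟩
    exact pair_ne_nil _ _
  · rintro _ ⟨I, rfl⟩
    constructor
    · rintro ⟨I', hI', heq⟩
      rw [← heq]
      obtain ⟨D, hD⟩ := weakStatus_iff_cert.mp hI'
      exact ⟨D.encode, hD.length_le.trans (lengthBound_mono I'.n_le_length),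
        mem_satSet_pair.mpr ((sat_certTest_encode I' D).mpr hD)⟩
    · rintro ⟨w, _, hw⟩
      exact ⟨I, weakStatus_iff_cert.mpr
        (exists_valid_of_sat_certTest (mem_satSet_pair.mp hw)), rfl⟩

/-- The witness consists of the `n²` entries of one matrix, a certificate of strong feasibility or
of strong infeasibility; the two are disjuncts of one test. -/
theorem inCoNP_weakInstances : InCoNP instances weakInstances := by
  refine ⟨satSet strongTest, Polynomial.X ^ 2, inP_satSet ?_ _, ?_⟩
  · rintro _ ⟨x, _, w, _, rfl⟩
    exact pair_ne_nil _ _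
  · rintro _ ⟨I, rfl⟩
    constructor
    · rintro ⟨_, hI⟩
      obtain ⟨x, hx⟩ := sat_strongTest_of_not_weakStatus fun h : WeakStatus I.L I.c =>
        hI ⟨I, h, rfl⟩
      refine ⟨entries x.1, ?_, mem_satSet_pair.mpr hx⟩
      rw [length_entries, Polynomial.eval_pow, Polynomial.eval_X, sq]
      exact Nat.mul_le_mul I.n_le_length I.n_le_length
    · rintro ⟨w, _, hw⟩
      refine ⟨⟨I, rfl⟩, ?_⟩
      rintro ⟨I', hI', heq⟩
      rw [← heq] at hw
      exact not_weakStatus_of_sat_strongTest (mem_satSet_pair.mp hw) hI'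

end SDFP

theorem mainTheorem5 :
    -- the certificate, for every problem `(Kₙ, L, c)`
    (∀ (n : ℕ) (L : Submodule ℝ (SDFP.Sym n)) (c : SDFP.Sym n),
      -- every output of the forward procedure is as specified
      (∀ O : SDFP.FPOutput n, SDFP.IsFPOutput L c O → O.MeetsSpec L) ∧
      -- for every output, weak status is attested by certificates of weak feasibility of the
      -- last subproblem, and by nothing else
      (∀ O : SDFP.FPOutput n, O.MeetsSpec L →
        (SDFP.WeakStatus L c ↔
          ∃ x y : SDFP.Sym O.d, SDFP.WeakFeasCert (O.lastL L) (O.lastC c) x y)) ∧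
      -- in weak status the forward procedure has an output
      (SDFP.WeakStatus L c → ∃ O : SDFP.FPOutput n, SDFP.IsFPOutput L c O) ∧
      -- hence weak status is equivalent to the existence of a certificate
      (SDFP.WeakStatus L c ↔ ∃ D : SDFP.WeakCert n, D.IsValid L c) ∧
      -- without a certificate, the problem is strongly feasible or strongly infeasible
      ((¬ ∃ D : SDFP.WeakCert n, D.IsValid L c) →
        (SDFP.StronglyFeasible L c ∧ ∃ x : SDFP.Sym n, SDFP.StrongFeasCert L c x) ∨
        (SDFP.StronglyInfeasible L c ∧ ∃ s : SDFP.Sym n, SDFP.StrongInfeasCert L c s))) ∧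
    -- the certificates have polynomial length and are verified in polynomial time
    (∃ q : Polynomial ℕ, ∀ (n : ℕ) (L : Submodule ℝ (SDFP.Sym n)) (c : SDFP.Sym n)
      (D : SDFP.WeakCert n), D.IsValid L c → D.encode.length ≤ q.eval n) ∧
    BSS.InP SDFP.certPairs SDFP.validCertPairs ∧
    -- deciding weak status is in `NP ∩ coNP`
    BSS.InNP SDFP.instances SDFP.weakInstances ∧
    BSS.InCoNP SDFP.instances SDFP.weakInstances := by
  refine ⟨fun n L c => ⟨fun O hO => hO.meetsSpec, fun O hO =>
    SDFP.weakStatus_iff_of_meetsSpec hO c, SDFP.exists_fpOutput, SDFP.weakStatus_iff_cert,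
    fun h => SDFP.strong_of_not_weakStatus fun hw => h (SDFP.weakStatus_iff_cert.mp hw)⟩,
    ⟨SDFP.lengthBound, fun n L c D hD => hD.length_le⟩, SDFP.inP_certPairs,
    SDFP.inNP_weakInstances, SDFP.inCoNP_weakInstances⟩
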